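/- Let $\mathbb{K}$ be an algebraically closed field of arbitrary characteristic, $V$ a finite-dimensional vector space over $\mathbb{K}$, and $e\in\mathfrak{g}=\mathfrak{gl}(V)$ nilpotent, with Jordan block sizes $\lambda_1\ge\dots\ge\lambda_n\geq 1$ and vectors $w_1,\dots,w_n$ such that $e^{\lambda_i}w_i=0$ and $\{e^sw_i : 1\le i\le n,\ 0\le s<\lambda_i\}$ is a basis of $V$. Let $G_e$ and $\mathfrak{g}_e$ be the centralisers of $e$ in $G=GL(V)$ and in $\mathfrak{g}$. For $1\le i,j\le n$ and $\lambda_j-\min(\lambda_i,\lambda_j)\le s<\lambda_j$ let $\xi_i^{j,s}\in\mathfrak{g}_e$ be the element with $\xi_i^{j,s}w_i=e^sw_j$ and $\xi_i^{j,s}w_k=0$ for $k\ne i$; these elements form a basis of $\mathfrak{g}_e$, and $(\xi_i^{j,s})^*$ denotes the dual basis of $\mathfrak{g}_e^*$. Put $$\alpha=\sum_{i=1}^n a_i(\xi_i^{i,\lambda_i-1})^*\in\mathfrak{g}_e^*,$$ where $a_1,\dots,a_n\in\mathbb{K}$ are pairwise distinct and $a_i\neq0$ whenever $\lambda_i$ is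 not the smallest block size. Let an algebraic group $Q$ with Lie algebra $\mathfrak{q}$ act rationally on a vector space $W$, and for $w\in W$ let $\mathfrak{q}_w=\{x\in\mathfrak{q}: x\cdot w=0\}$. The point $w$ is called regular if $\dim\mathfrak{q}_w=\min_{v\in W}\dim\mathfrak{q}_v$, and generic if there is a nonempty Zariski open $\mathcal{O}\subseteq W$ such that for every $v\in\mathcal{O}$ the stabilisers $\mathfrak{q}_w$ and $\mathfrak{q}_v$ are conjugate under the adjoint action of $Q$ on $\mathfrak{q}$. (The Lie algebras of the groups $G_e$ and $K_e$ below are $\mathfrak{g}_e$ and $\mathfrak{k}_e$.) For parts (2) and (3) let $\operatorname{char}\mathbb{K}\ne2$, let $(\cdot,\cdot)$ be a non-degenerate bilinear form on $V$ with $(u,v)=\epsilon(v,u)$, $\epsilon=\pm1$, let $K\subseteq G$ be the group of isometries of the form, let $\mathfrak{k}$ and $\mathfrak{p}$ be the spaces of skew self-adjoint and of self-adjoint elements of $\mathfrak{g}$, and let $e\in\mathfrak{k}$; write $K_e$, $\mathfrak{k}_e$, $\mathfrak{p}_e$ for the centralisers of $e$ in $K$, $\mathfrak{k}$, $\mathfrak{p}$.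 Then $\mathfrak{g}_e=\mathfrak{k}_e\oplus\mathfrak{p}_e$, and $\mathfrak{k}_e^*$, $\mathfrak{p}_e^*$ are identified with the annihilators in $\mathfrak{g}_e^*$ of $\mathfrak{p}_e$ and of $\mathfrak{k}_e$. Let the $w_i$ be normalised for the form: there is an involution $i\mapsto i'$ of $\{1,\dots,n\}$ with $\lambda_{i'}=\lambda_i$, with $i'=i$ if and only if $\epsilon(-1)^{\lambda_i}=-1$, such that $(e^sw_i,e^tw_j)=0$ for $0\le s<\lambda_i$, $0\le t<\lambda_j$ unless $j=i'$ and $s+t=\lambda_i-1$, and $(w_i,e^{\lambda_i-1}w_{i'})=1$ whenever $i\le i'$. Assume in these parts also that $a_{i'}=-a_i$ whenever $i'\ne i$. Then: 1. $\alpha$ is a generic, regular point for the (coadjoint) action of $G_e$ on $\mathfrak{g}_e^*$; 2. if $\epsilon=-1$, then $\alpha\in\mathfrak{k}_e^*$, and $\alpha$ is a generic, regular point for the action of $K_e$ on $\mathfrak{k}_e^*$; 3. if $\epsilon=1$, then $\alpha\in\mathfrak{p}_e^*$, and $\alpha$ is a generic, regular point for the action of $K_e$ on $\mathfrak{p}_e^*$.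 -/

import Mathlib

attribute [local instance 100] LieRing.ofAssociativeRing

open Module

namespace CentGen

noncomputable section

/-! ### The Zariski topology of a vector space, generic points, regular points -/

section General

variable (𝕜 : Type*) [Field 𝕜]

/-- The algebra `𝕜[W]` of polynomial functions on a vector space `W`: the algebra of functions
generated by the linear forms. -/
def polyFun (W : Type*) [AddCommGroup W] [Module 𝕜 W] : Subalgebra 𝕜 (W → 𝕜) :=
  Algebra.adjoin 𝕜 (Set.range fun f : Dual 𝕜 W => (f : W → 𝕜))

/-- A subset of `W` is Zariski open if its complement is the common zero set of a set of
polynomial functions. -/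
def IsZariskiOpen {W : Type*} [AddCommGroup W] [Module 𝕜 W] (O : Set W) : Prop :=
  ∃ F : Set (W → 𝕜), F ⊆ polyFun 𝕜 W ∧ Oᶜ = {w | ∀ f ∈ F, f w = 0}

variable (q : Type*) [LieRing q] [LieAlgebra 𝕜 q]
variable {W : Type*} [AddCommGroup W] [Module 𝕜 W] [LieRingModule q W] [LieModule 𝕜 q W]

/-- The stabiliser `𝔮_w = {x ∈ 𝔮 | x · w = 0}` of a point `w` of a `𝔮`-module. -/
def lieStab (w : W) : Submodule 𝕜 q where
  carrier := {x | ⁅x, w⁆ = 0}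
  zero_mem' := by simp
  add_mem' := by
    intro x y hx hy
    simp only [Set.mem_ofPred_eq] at hx hy ⊢
    rw [add_lie, hx, hy, add_zero]
  smul_mem' := by
    intro c x hx
    simp only [Set.mem_ofPred_eq] at hx ⊢
    rw [smul_lie, hx, smul_zero]

variable (W) in
/-- The minimal dimension of the stabiliser in `𝔮` of a point of `W`. For `W = M^*` this is the
index of `𝔮` in `M`. -/
def stabIndex : ℕ := ⨅ w : W, finrank 𝕜 (lieStab 𝕜 q w)

/-- `w` is a regular point: its stabiliser has the minimal dimension. -/
def IsRegularPoint (w : W) : Prop :=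
  finrank 𝕜 (lieStab 𝕜 q w) = stabIndex 𝕜 q W

variable {q}

/-- Let a group `Q` act on its Lie algebra `𝔮` through `Ad`, and let `W` be a `Q`-module with
differential the `𝔮`-module `W`. A point `w` is generic if there is a nonempty Zariski open
`O ⊆ W` such that for all `v ∈ O` the stabilisers `𝔮_w` and `𝔮_v` are conjugate under `Ad Q`. -/
def IsGenericPoint {Q : Type*} [Group Q] (Ad : Representation 𝕜 Q q) (w : W) : Prop :=
  ∃ O : Set W, IsZariskiOpen 𝕜 O ∧ O.Nonempty ∧
    ∀ v ∈ O, ∃ g : Q, (lieStab 𝕜 q w).map (Ad g) = lieStab 𝕜 q v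

end General

variable {𝕜 : Type*} [Field 𝕜] {V : Type*} [AddCommGroup V] [Module 𝕜 V]

/-! ### Centralisers in the general linear case -/

/-- The centraliser `𝔤_e` of `e` in `𝔤 = 𝔤𝔩(V)`. -/
def gCent (e : End 𝕜 V) : LieSubalgebra 𝕜 (End 𝕜 V) where
  carrier := {x | ⁅x, e⁆ = 0}
  zero_mem' := by simp
  add_mem' := by
    intro x y hx hy
    simp only [Set.mem_ofPred_eq] at hx hy ⊢
    rw [add_lie, hx, hy, add_zero]
  smul_mem' := by
    intro c x hx
    simp only [Set.mem_ofPred_eq] at hx ⊢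
    rw [smul_lie, hx, smul_zero]
  lie_mem' := by
    intro x y hx hy
    simp only [Set.mem_ofPred_eq] at hx hy ⊢
    rw [lie_lie, hx, hy, lie_zero, lie_zero, sub_zero]

theorem mem_gCent {e x : End 𝕜 V} : x ∈ gCent e ↔ x * e = e * x := by
  change x * e - e * x = 0 ↔ _
  exact sub_eq_zero

/-- The centraliser `G_e` of `e` in `G = GL(V)`. -/
def GCent (e : End 𝕜 V) : Subgroup (LinearMap.GeneralLinearGroup 𝕜 V) where
  carrier := {g | (g : End 𝕜 V) * e * ((g⁻¹ : LinearMap.GeneralLinearGroup 𝕜 V) : End 𝕜 V) = e}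
  one_mem' := by simp
  mul_mem' := by
    intro g h hg hh
    simp only [Set.mem_ofPred_eq] at hg hh ⊢
    conv_rhs => rw [← hg, ← hh]
    simp only [mul_inv_rev, Units.val_mul, mul_assoc]
  inv_mem' := by
    intro g hg
    simp only [Set.mem_ofPred_eq, inv_inv] at hg ⊢
    conv_lhs => rw [← hg]
    simp [mul_assoc]

theorem mem_GCent {e : End 𝕜 V} {g : LinearMap.GeneralLinearGroup 𝕜 V} :
    g ∈ GCent e ↔ (g : End 𝕜 V) * e = e * g := by
  change (g : End 𝕜 V) * e * ((g⁻¹ : LinearMap.GeneralLinearGroup 𝕜 V) : End 𝕜 V) = e ↔ _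
  rw [Units.mul_inv_eq_iff_eq_mul]

/-- The adjoint action of `G_e` on `𝔤_e`, `Ad(g) x = g x g⁻¹`. -/
def AdG (e : End 𝕜 V) : Representation 𝕜 (GCent e) (gCent e) where
  toFun g :=
    { toFun := fun x =>
        ⟨(g.1 : End 𝕜 V) * x.1 * ((g.1⁻¹ : LinearMap.GeneralLinearGroup 𝕜 V) : End 𝕜 V), by
          have h1 := mem_GCent.1 g.2
          have h2 := mem_GCent.1 (inv_mem g.2)
          have h3 := mem_gCent.1 x.2
          rw [mem_gCent, mul_assoc, h2, ← mul_assoc, mul_assoc (g.1 : End 𝕜 V), h3, ← mul_assoc,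
            h1]
          simp only [mul_assoc]⟩
      map_add' := by
        intro x y
        ext1
        simp [mul_add, add_mul]
      map_smul' := by
        intro c x
        ext1
        simp }
  map_one' := by
    ext x v
    simp
  map_mul' := by
    intro g h
    ext x v
    simp [mul_assoc]

/-! ### Jordan bases and the linear form `α` -/

/-- Jordan block sizes `λ_1 ≥ … ≥ λ_n ≥ 1` of `e`, with generators `w_1, …, w_n` of the Jordan
blocks: `e ^ λ_i w_i = 0` and the `e ^ s w_i`, `0 ≤ s < λ_i`, form a basis of `V`. -/
structure JordanBasis (e : End 𝕜 V) where
  n : ℕ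
  size : Fin n → ℕ
  size_pos : ∀ i, 0 < size i
  size_anti : Antitone size
  gen : Fin n → V
  pow_size : ∀ i, (e ^ size i) (gen i) = 0
  basis : Basis (Σ i, Fin (size i)) 𝕜 V
  basis_apply : ∀ p, basis p = (e ^ (p.2 : ℕ)) (gen p.1)

namespace JordanBasis

variable {e : End 𝕜 V} (b : JordanBasis e)

theorem pow_gen (i : Fin b.n) (s : ℕ) :
    (e ^ s) (b.gen i) = if h : s < b.size i then b.basis ⟨i, ⟨s, h⟩⟩ else 0 := by
  split_ifs with h
  · rw [b.basis_apply]
  · obtain ⟨k, rfl⟩ := Nat.exists_eq_add_of_le (not_lt.1 h)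
    rw [add_comm, pow_add, Module.End.mul_apply, b.pow_size, map_zero]

/-- For `λ_j - min(λ_i, λ_j) ≤ s`, the endomorphism `ξ_i^{j,s}` of `V` with
`ξ_i^{j,s} (e ^ t w_k) = e ^ t (e ^ s w_j)` if `k = i`, and `0` otherwise. -/
def xiEnd (i j : Fin b.n) (s : ℕ) : End 𝕜 V :=
  b.basis.constr 𝕜 fun p => if p.1 = i then (e ^ (p.2 : ℕ)) ((e ^ s) (b.gen j)) else 0

theorem xiEnd_gen (i j k : Fin b.n) (s t : ℕ) (h : b.size j ≤ s + b.size i) :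
    b.xiEnd i j s ((e ^ t) (b.gen k)) = if k = i then (e ^ (t + s)) (b.gen j) else 0 := by
  rw [b.pow_gen k t]
  split_ifs with h1 h2 h2
  · rw [xiEnd, b.basis.constr_basis, if_pos h2, pow_add, Module.End.mul_apply]
  · rw [xiEnd, b.basis.constr_basis, if_neg h2]
  · subst h2
    rw [map_zero, b.pow_gen, dif_neg (by omega)]
  · rw [map_zero]

theorem xiEnd_mem (i j : Fin b.n) (s : ℕ) (h : b.size j ≤ s + b.size i) :
    b.xiEnd i j s ∈ gCent e := by
  rw [mem_gCent]
  refine b.basis.ext fun p => ?_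
  rw [b.basis_apply, Module.End.mul_apply, Module.End.mul_apply, ← Module.End.mul_apply e,
    ← pow_succ', b.xiEnd_gen _ _ _ _ _ h, b.xiEnd_gen _ _ _ _ _ h]
  split_ifs
  · rw [← Module.End.mul_apply, ← pow_succ']
    congr 2
    omega
  · rw [map_zero]

/-- The elements `ξ_i^{j,s}` of `𝔤_e`, taken to be `0` for `s` outside the range
`λ_j - min(λ_i, λ_j) ≤ s < λ_j`. -/
def xi (i j : Fin b.n) (s : ℕ) : gCent e :=
  if h : b.size j ≤ s + b.size i ∧ s < b.size j then ⟨b.xiEnd i j s, b.xiEnd_mem i j s h.1⟩ else 0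

/-- The linear form `(ξ_i^{j,s})^*` on `𝔤_e`, dual to the basis of the `ξ_i^{j,s}`: its value at
`x` is the coefficient of `e ^ s w_j` in `x w_i`. -/
def xiDual (i j : Fin b.n) (s : Fin (b.size j)) : Dual 𝕜 (gCent e) where
  toFun x := b.basis.coord ⟨j, s⟩ ((x : End 𝕜 V) (b.gen i))
  map_add' := by intro x y; simp
  map_smul' := by intro c x; simp

/-- The forms `(ξ_i^{j,s})^*` are dual to the `ξ_i^{j,s}`. -/
theorem xiDual_xi (i j k l : Fin b.n) (s : Fin (b.size j)) (r : ℕ)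
    (h : b.size l ≤ r + b.size k ∧ r < b.size l) :
    b.xiDual i j s (b.xi k l r) = if i = k ∧ j = l ∧ (s : ℕ) = r then 1 else 0 := by
  have h0 := b.xiEnd_gen k l i r 0 h.1
  rw [pow_zero, Module.End.one_apply, zero_add] at h0
  simp only [xiDual, xi, dif_pos h, LinearMap.coe_mk, AddHom.coe_mk, h0]
  by_cases hik : i = k
  · rw [if_pos hik, b.pow_gen, dif_pos h.2, Basis.coord_apply, Basis.repr_self,
      Finsupp.single_apply]
    by_cases hjl : j = l
    · subst hjl
      simp [hik, Fin.ext_iff, eq_comm]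
    · have : ¬ l = j := fun h => hjl h.symm
      simp [hjl, this]
  · simp [hik]

/-- The `ξ_i^{j,s}` span `𝔤_e`: every `x` is the combination of them with the coefficients
`(ξ_i^{j,s})^* (x)`. Together with `xiDual_xi`, they form a basis with dual basis the
`(ξ_i^{j,s})^*`. -/
theorem sum_xiDual_smul_xi (x : gCent e) :
    ∑ i, ∑ p : Σ j, Fin (b.size j), b.xiDual i p.1 p.2 x • b.xi i p.1 p.2 = x := by
  have hx := mem_gCent.1 x.2
  have hxp : ∀ t : ℕ, ∀ v : V, (x : End 𝕜 V) ((e ^ t) v) = (e ^ t) ((x : End 𝕜 V) v) := by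
    intro t v
    have : Commute (x : End 𝕜 V) (e ^ t) := (show Commute (x : End 𝕜 V) e from hx).pow_right t
    exact LinearMap.congr_fun this.eq v
  have key : ∀ (i : Fin b.n) (p : Σ j, Fin (b.size j)), ¬ b.size p.1 ≤ (p.2 : ℕ) + b.size i →
      b.xiDual i p.1 p.2 x = 0 := by
    rintro i ⟨j, s⟩ hs
    simp only at hs
    have h0 : (e ^ b.size i) ((x : End 𝕜 V) (b.gen i)) = 0 := by
      rw [← hxp, b.pow_size, map_zero]
    set y := (x : End 𝕜 V) (b.gen i) with hy
    have h1 : b.basis.coord ⟨j, ⟨s + b.size i, by omega⟩⟩ ((e ^ b.size i) y)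
        = b.basis.coord ⟨j, s⟩ y := by
      have : (b.basis.coord ⟨j, ⟨s + b.size i, by omega⟩⟩).comp (e ^ b.size i)
          = b.basis.coord ⟨j, s⟩ := by
        refine b.basis.ext fun p => ?_
        obtain ⟨k, t⟩ := p
        rw [LinearMap.comp_apply, b.basis_apply, ← Module.End.mul_apply, ← pow_add, b.pow_gen,
          b.pow_gen, dif_pos t.2]
        split_ifs with h
        · simp only [Basis.coord_apply, Basis.repr_self, Finsupp.single_apply]
          by_cases hk : k = j
          · subst hk
            congr 1
            simp only [Sigma.mk.injEq, heq_eq_eq, true_and, Fin.ext_iff, eq_iff_iff]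
            omega
          · simp [hk]
        · simp only [map_zero, Basis.coord_apply, Basis.repr_self, Finsupp.single_apply]
          rw [if_neg]
          intro hh
          have h2 : k = j := congrArg Sigma.fst hh
          subst h2
          simp only [Sigma.mk.injEq, heq_eq_eq, true_and, Fin.ext_iff] at hh
          have := s.2
          simp only at h
          omega
      exact LinearMap.congr_fun this y
    change b.basis.coord ⟨j, s⟩ y = 0
    rw [← h1, h0, map_zero]
  have hterm : ∀ (i : Fin b.n) (p : Σ j, Fin (b.size j)) (k : Fin b.n) (t : ℕ),
      ((b.xiDual i p.1 p.2 x • b.xi i p.1 p.2 : gCent e) : End 𝕜 V) ((e ^ t) (b.gen k)) =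
        if k = i then b.xiDual i p.1 p.2 x • (e ^ t) (b.basis p) else 0 := by
    intro i p k t
    by_cases h : b.size p.1 ≤ (p.2 : ℕ) + b.size i
    · have h' : b.size p.1 ≤ (p.2 : ℕ) + b.size i ∧ (p.2 : ℕ) < b.size p.1 := ⟨h, p.2.2⟩
      rw [xi, dif_pos h']
      change b.xiDual i p.1 p.2 x • b.xiEnd i p.1 p.2 ((e ^ t) (b.gen k)) = _
      rw [b.xiEnd_gen _ _ _ _ _ h]
      split_ifs
      · rw [b.basis_apply, ← Module.End.mul_apply, ← pow_add]
      · rw [smul_zero]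
    · rw [key i p h]
      simp
  have hcoe : ((∑ i, ∑ p : Σ j, Fin (b.size j), b.xiDual i p.1 p.2 x • b.xi i p.1 p.2 : gCent e)
      : End 𝕜 V) = ∑ i, ∑ p : Σ j, Fin (b.size j),
        ((b.xiDual i p.1 p.2 x • b.xi i p.1 p.2 : gCent e) : End 𝕜 V) := by
    simp only [AddSubmonoidClass.coe_finsetSum]
  apply Subtype.ext
  rw [hcoe]
  refine b.basis.ext fun q => ?_
  rw [b.basis_apply]
  simp only [LinearMap.sum_apply, hterm]
  simp only [Finset.sum_ite_irrel, Finset.sum_const_zero, Finset.sum_ite_eq,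
    Finset.mem_univ, if_true]
  rw [hxp]
  conv_rhs => rw [← b.basis.sum_repr ((x : End 𝕜 V) (b.gen q.1)), map_sum]
  refine Finset.sum_congr rfl fun p _ => ?_
  rw [map_smul]
  rfl

/-- The linear form `α = ∑ a_i (ξ_i^{i, λ_i - 1})^*` on `𝔤_e`. -/
def alpha (a : Fin b.n → 𝕜) : Dual 𝕜 (gCent e) :=
  ∑ i, a i • b.xiDual i i ⟨b.size i - 1, Nat.sub_one_lt_of_lt (b.size_pos i)⟩

end JordanBasis

/-! ### The orthogonal and symplectic cases -/

section Form

variable (B : LinearMap.BilinForm 𝕜 V) (e : End 𝕜 V)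

/-- The centraliser `K_e` of `e` in the group `K` of isometries of the form, as a subgroup of
`G_e`. -/
def KCent : Subgroup (GCent e) where
  carrier := {g | ∀ u v, B ((g.1 : End 𝕜 V) u) ((g.1 : End 𝕜 V) v) = B u v}
  one_mem' := by intro u v; simp
  mul_mem' := by
    intro g h hg hh u v
    simp only [Set.mem_ofPred_eq] at hg hh
    simp only [Subgroup.coe_mul, Units.val_mul, Module.End.mul_apply, hg, hh]
  inv_mem' := by
    intro g hg u v
    simp only [Set.mem_ofPred_eq] at hg
    rw [← hg]
    simp only [InvMemClass.coe_inv, ← Module.End.mul_apply, Units.mul_inv, Module.End.one_apply]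

/-- The centraliser `𝔨_e` of `e` in the Lie algebra `𝔨` of the endomorphisms that are skew
self-adjoint for the form, as a Lie subalgebra of `𝔤_e`. -/
def kCent : LieSubalgebra 𝕜 (gCent e) :=
  (skewAdjointLieSubalgebra B).comap (gCent e).incl

theorem mem_kCent {x : gCent e} :
    x ∈ kCent B e ↔ ∀ u v, B ((x : End 𝕜 V) u) v = - B u ((x : End 𝕜 V) v) := by
  change (∀ u v, B ((x : End 𝕜 V) u) v = (-B) u ((x : End 𝕜 V) v)) ↔ _
  simp

/-- `𝔭_e`, the space of the elements of `𝔤_e` that are self-adjoint for the form (the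
`-1`-eigenspace in `𝔤_e` of the involution with fixed points `𝔨_e`), as a `𝔨_e`-module. -/
def pCent : LieSubmodule 𝕜 (kCent B e) (gCent e) where
  carrier := {x | ∀ u v, B ((x : End 𝕜 V) u) v = B u ((x : End 𝕜 V) v)}
  zero_mem' := by intro u v; simp
  add_mem' := by
    intro x y hx hy u v
    simp only [Set.mem_ofPred_eq] at hx hy
    simp [hx, hy]
  smul_mem' := by
    intro c x hx u v
    simp only [Set.mem_ofPred_eq] at hx
    simp [hx]
  lie_mem := by
    intro y x hx u v
    have hx' : ∀ u v, B ((x : End 𝕜 V) u) v = B u ((x : End 𝕜 V) v) := hx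
    have hy := (mem_kCent B e).1 y.2
    change B ((y.1.1 * x.1 - x.1 * y.1.1) u) v = B u ((y.1.1 * x.1 - x.1 * y.1.1) v)
    simp only [LinearMap.sub_apply, Module.End.mul_apply, map_sub, LinearMap.sub_apply, hx', hy]
    ring

/-- The adjoint action of `K_e` on `𝔨_e`. -/
def AdK : Representation 𝕜 (KCent B e) (kCent B e) where
  toFun g :=
    ((AdG e g.1).comp (kCent B e).toSubmodule.subtype).codRestrict (kCent B e).toSubmodule (by
      intro x
      change AdG e g.1 x.1 ∈ kCent B e
      rw [mem_kCent]
      intro u v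
      have hg : ∀ u v, B ((g.1.1 : End 𝕜 V) u) ((g.1.1 : End 𝕜 V) v) = B u v := g.2
      have hx := (mem_kCent B e).1 x.2
      have h1 : ∀ v, (g.1.1 : End 𝕜 V)
          (((g.1.1⁻¹ : LinearMap.GeneralLinearGroup 𝕜 V) : End 𝕜 V) v) = v := by
        intro v
        rw [← Module.End.mul_apply, Units.mul_inv, Module.End.one_apply]
      change B ((g.1.1 : End 𝕜 V) (x.1.1
          (((g.1.1⁻¹ : LinearMap.GeneralLinearGroup 𝕜 V) : End 𝕜 V) u))) v
        = - B u ((g.1.1 : End 𝕜 V) (x.1.1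
          (((g.1.1⁻¹ : LinearMap.GeneralLinearGroup 𝕜 V) : End 𝕜 V) v)))
      conv_lhs => rw [← h1 v]
      rw [hg, hx]
      conv_rhs => rw [← h1 u]
      rw [hg])
  map_one' := by
    ext1 x
    apply Subtype.ext
    simp
  map_mul' := by
    intro g h
    ext1 x
    apply Subtype.ext
    simp

end Form

/-- A Jordan basis of `e` is normalised for the form `B`, which satisfies `B u v = ε B v u` with
`ε = ± 1`, by means of an involution `i ↦ i'` of the set of its blocks, if
* `λ_{i'} = λ_i`, and `i' = i` if and only if `ε (-1) ^ λ_i = -1`;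
* `(e ^ s w_i, e ^ t w_j) = 0` for `s < λ_i`, `t < λ_j`, unless `j = i'` and `s + t = λ_i - 1`;
* `(w_i, e ^ (λ_i - 1) w_{i'}) = 1` whenever `i ≤ i'`. -/
structure JordanBasis.IsNormalised {e : End 𝕜 V} (b : JordanBasis e) (B : LinearMap.BilinForm 𝕜 V)
    (ε : ℤ) (inv : Fin b.n → Fin b.n) : Prop where
  involutive : Function.Involutive inv
  size_inv : ∀ i, b.size (inv i) = b.size i
  inv_eq_iff : ∀ i, inv i = i ↔ ε * (-1) ^ b.size i = -1
  orthogonal : ∀ i j (s t : ℕ), s < b.size i → t < b.size j → ¬ (j = inv i ∧ s + t + 1 = b.size i) →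
    B ((e ^ s) (b.gen i)) ((e ^ t) (b.gen j)) = 0
  normal : ∀ i, i ≤ inv i → B (b.gen i) ((e ^ (b.size i - 1)) (b.gen (inv i))) = 1

end

end CentGen

/-! The stabiliser of a linear form `M` on `𝔤_e` is an associative algebra: the `x` with `M (x y) =
M (y x)` for all `y` commuting with `e`. For `α` it is `diag`, the algebra of endomorphisms that
commute with `e` and preserve every Jordan block. Testing `x` against the `ξ_j^{i,r}` gives
recursions that kill its off-diagonal coefficients (`symStab_alphaEnd_le`). Dimensions do the rest:
`dim diag ≤ dim V`, and no form on `𝔤_e` has a stabiliser of dimension below `dim V`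
(`finrank_le_finrank_symStab`). That bound is a degeneration of the bound for centralisers in
`𝔤𝔩(V)`, by letting `t → 0` in `[e + t m, x + t u]`.

Genericity for `G_e`: since the stabiliser of `α` has minimal dimension, Cramer's rule extends an
element of `diag` with distinct scalars on the blocks to a polynomial section of the stabilisers.
Near `α` its value `x` still has distinct eigenvalues on `V / e V`, so polynomials in `x` provide
orthogonal idempotents inside the stabiliser. By uniqueness of the Jordan type these are conjugate
under `G_e` to the block projections. A stabiliser that contains the conjugated projections contains
the conjugate of `diag`, and equals it for dimension reasons (`exists_conj_symStab`).

For a form `B`, write `x*` for the adjoint. Then `α(x*) = ε α(x)`, so `α` lives on `𝔨_e` if `ε = -1`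
and on `𝔭_e` if `ε = 1`. Extending forms by zero to `𝔤_e` reduces everything to choosing the
conjugating `g` in `K_e`. Nearby stabilisers are stable under `*`, so `*` transported by `g`
permutes the block projections by a size-preserving involution `π`. Parity shows that the fixed
points of `π` are fixed by `i ↦ i'`. A self-adjoint element of the stabiliser has as many
eigenvalues on `V / e V` as `i ↦ i'` has orbits, which forces equal fixed points. After a
permutation of equal blocks `π` is the given involution (`exists_adj_pullForm_blockProj`). Then `g*
g` lies in `diag`, and the polar part `g (g* g)^(-1/2)` is an isometry that conjugates in the same
way (`exists_isometry`).

Regularity follows from genericity by semicontinuity of the stabiliser dimension. -/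

namespace CentGen

/-! ### Polynomial functions and linear families of linear maps. -/

section Zariski

variable {𝕜 : Type*} [Field 𝕜] {W : Type*} [AddCommGroup W] [Module 𝕜 W]

theorem dual_mem_polyFun (f : Dual 𝕜 W) : (fun w => f w) ∈ polyFun 𝕜 W :=
  Algebra.subset_adjoin ⟨f, rfl⟩

theorem const_mem_polyFun (c : 𝕜) : (fun _ : W => c) ∈ polyFun 𝕜 W :=
  (polyFun 𝕜 W).algebraMap_mem c

/-- Evaluation of polynomial functions at a point. -/
def evalHom (w : W) : polyFun 𝕜 W →ₐ[𝕜] 𝕜 :=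
  (Pi.evalAlgHom 𝕜 (fun _ : W => 𝕜) w).comp (polyFun 𝕜 W).val

@[simp]
theorem evalHom_apply (w : W) (f : polyFun 𝕜 W) : evalHom w f = f.1 w := rfl

theorem isZariskiOpen_ne {f : W → 𝕜} (hf : f ∈ polyFun 𝕜 W) : IsZariskiOpen 𝕜 {w | f w ≠ 0} :=
  ⟨{f}, by simpa using hf, by ext w; simp⟩

theorem IsZariskiOpen.exists_basic {O : Set W} (hO : IsZariskiOpen 𝕜 O) (hne : O.Nonempty) :
    ∃ f ∈ polyFun 𝕜 W, (∃ w, f w ≠ 0) ∧ ∀ w, f w ≠ 0 → w ∈ O := by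
  obtain ⟨F, hF, hOF⟩ := hO
  obtain ⟨u, hu⟩ := hne
  have h1 : ¬ u ∈ Oᶜ := by simpa using hu
  rw [hOF] at h1
  simp only [Set.mem_ofPred_eq, not_forall] at h1
  obtain ⟨f, hf, hfu⟩ := h1
  refine ⟨f, hF hf, ⟨u, hfu⟩, fun w hw => ?_⟩
  by_contra hwO
  have h2 : w ∈ Oᶜ := hwO
  rw [hOF] at h2
  exact hw (h2 f hf)

/-- Restriction to the line with `u` at `t = 0` and `v` at `t = 1` reduces the irreducibility of
`W`, which may have infinite dimension, to polynomials in one variable. -/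
theorem polyFun_line {f : W → 𝕜} (hf : f ∈ polyFun 𝕜 W) (u v : W) :
    ∃ p : Polynomial 𝕜, ∀ t : 𝕜, p.eval t = f (u + t • (v - u)) := by
  induction hf using Algebra.adjoin_induction with
  | mem f hf =>
    obtain ⟨ℓ, rfl⟩ := hf
    exact ⟨Polynomial.C (ℓ u) + Polynomial.X * Polynomial.C (ℓ (v - u)), fun t => by simp⟩
  | algebraMap r => exact ⟨Polynomial.C r, fun t => by simp⟩
  | add f g _ _ hf hg =>
    obtain ⟨p, hp⟩ := hf
    obtain ⟨q, hq⟩ := hg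
    exact ⟨p + q, fun t => by simp [hp, hq]⟩
  | mul f g _ _ hf hg =>
    obtain ⟨p, hp⟩ := hf
    obtain ⟨q, hq⟩ := hg
    exact ⟨p * q, fun t => by simp [hp, hq]⟩

/-- Two nonempty basic open sets meet. -/
theorem exists_ne_zero_of_polyFun [Infinite 𝕜] {f g : W → 𝕜} (hf : f ∈ polyFun 𝕜 W)
    (hg : g ∈ polyFun 𝕜 W) {u v : W} (hu : f u ≠ 0) (hv : g v ≠ 0) : ∃ w, f w ≠ 0 ∧ g w ≠ 0 := by
  obtain ⟨p, hp⟩ := polyFun_line hf u v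
  obtain ⟨q, hq⟩ := polyFun_line hg u v
  have hp0 : p ≠ 0 := by
    rintro rfl
    apply hu
    simpa using (hp 0).symm
  have hq0 : q ≠ 0 := by
    rintro rfl
    apply hv
    simpa using (hq 1).symm
  obtain ⟨t, ht⟩ := Polynomial.exists_eval_ne_zero_of_natDegree_lt_card (p * q)
    (mul_ne_zero hp0 hq0) (lt_of_lt_of_le Cardinal.natCast_lt_aleph0 (Cardinal.aleph0_le_mk 𝕜))
  rw [Polynomial.eval_mul] at ht
  exact ⟨_, hp t ▸ left_ne_zero_of_mul ht, hq t ▸ right_ne_zero_of_mul ht⟩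

variable {U U' : Type*} [AddCommGroup U] [Module 𝕜 U]
  [AddCommGroup U'] [Module 𝕜 U']

/-- A map between vector spaces is polynomial if its composites with linear forms are. -/
def IsPolyMap (𝕜 : Type*) [Field 𝕜] {W U : Type*} [AddCommGroup W] [Module 𝕜 W] [AddCommGroup U]
    [Module 𝕜 U] (x : W → U) : Prop :=
  ∀ ℓ : Dual 𝕜 U, (fun w => ℓ (x w)) ∈ polyFun 𝕜 W

theorem IsPolyMap.const (u : U) : IsPolyMap 𝕜 fun _ : W => u :=
  fun ℓ => const_mem_polyFun (ℓ u)

theorem IsPolyMap.linear (f : W →ₗ[𝕜] U) : IsPolyMap 𝕜 fun w => f w :=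
  fun ℓ => dual_mem_polyFun (ℓ ∘ₗ f)

theorem IsPolyMap.linear_comp {x : W → U} (hx : IsPolyMap 𝕜 x) (f : U →ₗ[𝕜] U') :
    IsPolyMap 𝕜 fun w => f (x w) :=
  fun ℓ => hx (ℓ ∘ₗ f)

theorem IsPolyMap.add {x y : W → U} (hx : IsPolyMap 𝕜 x) (hy : IsPolyMap 𝕜 y) :
    IsPolyMap 𝕜 fun w => x w + y w := by
  intro ℓ
  simp only [map_add]
  exact (polyFun 𝕜 W).add_mem (hx ℓ) (hy ℓ)

/-- Expanding the first argument in a basis leaves a finite sum of products of polynomial functions.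
Applied to multiplication, this makes powers of endomorphisms polynomial. -/
theorem IsPolyMap.bilin [FiniteDimensional 𝕜 U] {U'' : Type*} [AddCommGroup U''] [Module 𝕜 U'']
    {x : W → U} {y : W → U'} (hx : IsPolyMap 𝕜 x) (hy : IsPolyMap 𝕜 y)
    (B : U →ₗ[𝕜] U' →ₗ[𝕜] U'') : IsPolyMap 𝕜 fun w => B (x w) (y w) := by
  intro ℓ
  have h : (fun w => ℓ (B (x w) (y w))) = ∑ i, (fun w => (finBasis 𝕜 U).coord i (x w)) *
      fun w => (ℓ ∘ₗ B (finBasis 𝕜 U i)) (y w) := by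
    funext w
    conv_lhs => rw [← (finBasis 𝕜 U).sum_repr (x w), map_sum, LinearMap.sum_apply, map_sum]
    simp [-Basis.sum_repr]
  rw [h]
  exact (polyFun 𝕜 W).sum_mem fun i _ => (polyFun 𝕜 W).mul_mem (hx _) (hy _)

theorem IsPolyMap.pow {A : Type*} [Ring A] [Algebra 𝕜 A] [FiniteDimensional 𝕜 A] {x : W → A}
    (hx : IsPolyMap 𝕜 x) (k : ℕ) : IsPolyMap 𝕜 fun w => x w ^ k := by
  induction k with
  | zero => simpa using IsPolyMap.const (1 : A)
  | succ k ih => simpa [pow_succ] using ih.bilin hx (LinearMap.mul 𝕜 A)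

/-- A linear map of rank `r` restricts to the identity of `𝕜 ^ r`. -/
theorem exists_comp_eq_id [FiniteDimensional 𝕜 U] (f : U →ₗ[𝕜] U') :
    ∃ (Q : (Fin (finrank 𝕜 (LinearMap.range f)) → 𝕜) →ₗ[𝕜] U)
      (P : U' →ₗ[𝕜] (Fin (finrank 𝕜 (LinearMap.range f)) → 𝕜)),
      P ∘ₗ f ∘ₗ Q = LinearMap.id := by
  obtain ⟨s, hs⟩ := f.rangeRestrict.exists_rightInverse_of_surjective f.range_rangeRestrict
  let ψ := (finBasis 𝕜 (LinearMap.range f)).equivFun.symm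
  let Q : (Fin (finrank 𝕜 (LinearMap.range f)) → 𝕜) →ₗ[𝕜] U := s ∘ₗ ψ.toLinearMap
  have hQ : ∀ x, f (Q x) = ψ x := fun x =>
    congrArg Subtype.val (LinearMap.congr_fun hs (ψ x))
  obtain ⟨P, hP⟩ := (f ∘ₗ Q).exists_leftInverse_of_injective (by
    rw [LinearMap.ker_eq_bot]
    intro x y hxy
    simp only [LinearMap.comp_apply, hQ] at hxy
    exact ψ.injective (Subtype.ext hxy))
  exact ⟨Q, P, hP⟩

/-- The matrix of polynomial functions attached to a linear family of linear maps. -/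
def familyMatrix {r : ℕ} (C : W →ₗ[𝕜] U →ₗ[𝕜] U') (Q : (Fin r → 𝕜) →ₗ[𝕜] U)
    (P : U' →ₗ[𝕜] (Fin r → 𝕜)) : Matrix (Fin r) (Fin r) (polyFun 𝕜 W) :=
  fun i j => ⟨fun w => P (C w (Q (Pi.single j 1))) i,
    dual_mem_polyFun (LinearMap.proj i ∘ₗ P ∘ₗ C.flip (Q (Pi.single j 1)))⟩

theorem familyMatrix_map {r : ℕ} (C : W →ₗ[𝕜] U →ₗ[𝕜] U') (Q : (Fin r → 𝕜) →ₗ[𝕜] U)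
    (P : U' →ₗ[𝕜] (Fin r → 𝕜)) (w : W) :
    (familyMatrix C Q P).map (evalHom w) = LinearMap.toMatrix' (P ∘ₗ C w ∘ₗ Q) := by
  ext i j
  simp [familyMatrix, LinearMap.toMatrix'_apply]

theorem familyMatrix_det {r : ℕ} (C : W →ₗ[𝕜] U →ₗ[𝕜] U') (Q : (Fin r → 𝕜) →ₗ[𝕜] U)
    (P : U' →ₗ[𝕜] (Fin r → 𝕜)) (w : W) :
    (familyMatrix C Q P).det.1 w = (LinearMap.toMatrix' (P ∘ₗ C w ∘ₗ Q)).det := by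
  rw [← familyMatrix_map, ← evalHom_apply, AlgHom.map_det]
  rfl

theorem bijective_of_toMatrix'_det_ne_zero {r : ℕ} {f : (Fin r → 𝕜) →ₗ[𝕜] (Fin r → 𝕜)}
    (h : (LinearMap.toMatrix' f).det ≠ 0) : Function.Bijective f := by
  rw [LinearMap.det_toMatrix'] at h
  exact (Module.End.isUnit_iff f).1 ((LinearMap.isUnit_iff_isUnit_det _).2 (isUnit_iff_ne_zero.2 h))

theorem rank_le_of_det_ne_zero [FiniteDimensional 𝕜 U] {r : ℕ} {f : U →ₗ[𝕜] U'} {Q : (Fin r → 𝕜) →ₗ[𝕜] U}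
    {P : U' →ₗ[𝕜] (Fin r → 𝕜)} (h : (LinearMap.toMatrix' (P ∘ₗ f ∘ₗ Q)).det ≠ 0) :
    r ≤ finrank 𝕜 (LinearMap.range f) := by
  have hinj : Function.Injective (P ∘ₗ f ∘ₗ Q) := (bijective_of_toMatrix'_det_ne_zero h).1
  have h1 : Function.Injective ((f.rangeRestrict ∘ₗ Q)) := by
    intro x y hxy
    apply hinj
    exact congrArg P (congrArg Subtype.val hxy)
  simpa using LinearMap.finrank_le_finrank_of_injective h1

/-- Semicontinuity of the dimension of the kernel in a linear family of linear maps. -/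
theorem exists_finrank_ker_le [FiniteDimensional 𝕜 U] (C : W →ₗ[𝕜] U →ₗ[𝕜] U') (w₀ : W) :
    ∃ δ ∈ polyFun 𝕜 W, δ w₀ ≠ 0 ∧ ∀ w, δ w ≠ 0 →
      finrank 𝕜 (LinearMap.ker (C w)) ≤ finrank 𝕜 (LinearMap.ker (C w₀)) := by
  -- `P` and `Q` cut out a minor of the size of the rank at `w₀`, with value 1 there. Where it is
  -- nonzero, the rank cannot be smaller.
  obtain ⟨Q, P, hPQ⟩ := exists_comp_eq_id (C w₀)
  refine ⟨_, (familyMatrix C Q P).det.2, ?_, fun w hw => ?_⟩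
  · rw [familyMatrix_det, hPQ]
    simp
  · rw [familyMatrix_det] at hw
    have h1 := rank_le_of_det_ne_zero hw
    have h2 := (C w).finrank_range_add_finrank_ker
    have h3 := (C w₀).finrank_range_add_finrank_ker
    omega

/-- If the dimension of the kernel in a linear family of linear maps is minimal at `w₀`, then a
vector of the kernel at `w₀` extends to a polynomial section of the kernels over a basic open
neighbourhood of `w₀`. -/
theorem exists_ker_section [FiniteDimensional 𝕜 U] (C : W →ₗ[𝕜] U →ₗ[𝕜] U') (w₀ : W)
    (hmin : ∀ w, finrank 𝕜 (LinearMap.ker (C w₀)) ≤ finrank 𝕜 (LinearMap.ker (C w)))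
    (u₀ : U) (hu₀ : C w₀ u₀ = 0) :
    ∃ δ ∈ polyFun 𝕜 W, ∃ x : W → U, IsPolyMap 𝕜 x ∧
      δ w₀ ≠ 0 ∧ x w₀ = u₀ ∧ ∀ w, δ w ≠ 0 → C w (x w) = 0 := by
  obtain ⟨r, hr, Q, P, hPQ⟩ : ∃ r, r = finrank 𝕜 (LinearMap.range (C w₀)) ∧
      ∃ (Q : (Fin r → 𝕜) →ₗ[𝕜] U) (P : U' →ₗ[𝕜] (Fin r → 𝕜)),
        P ∘ₗ C w₀ ∘ₗ Q = LinearMap.id := ⟨_, rfl, exists_comp_eq_id (C w₀)⟩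
  set D := familyMatrix C Q P with hD
  let c : Fin r → polyFun 𝕜 W := fun i => ⟨fun w => P (C w u₀) i,
    dual_mem_polyFun (LinearMap.proj i ∘ₗ P ∘ₗ C.flip u₀)⟩
  -- Cramer's rule without denominators: as `D * D.adjugate = det D`, the vector `det D • u₀ - Q y`
  -- is killed by `P ∘ C w`. At `w₀` it is `u₀`, because `det D = 1` and `c = 0` there.
  let y : Fin r → polyFun 𝕜 W := D.adjugate.mulVec c
  have hDw : ∀ w, D.map (evalHom w) = LinearMap.toMatrix' (P ∘ₗ C w ∘ₗ Q) :=
    familyMatrix_map C Q P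
  have hc : ∀ w, evalHom w ∘ c = P (C w u₀) := fun w => rfl
  have h0 : D.det.1 w₀ = 1 := by rw [familyMatrix_det, hPQ]; simp
  refine ⟨D.det.1, D.det.2, fun w => D.det.1 w • u₀ - Q (evalHom w ∘ y), fun ℓ => ?_, ?_, ?_,
    fun w hw => ?_⟩
  · have h1 : (fun w => ℓ (D.det.1 w • u₀ - Q (evalHom w ∘ y))) =
        (D.det * algebraMap 𝕜 _ (ℓ u₀) - ∑ i, y i * algebraMap 𝕜 _ (ℓ (Q (Pi.single i 1))) :
          polyFun 𝕜 W).1 := by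
      funext w
      have h2 : evalHom w ∘ y = ∑ i, (y i).1 w • (Pi.single i 1 : Fin r → 𝕜) := by
        rw [pi_eq_sum_univ' (evalHom w ∘ y)]
        rfl
      rw [h2, ← evalHom_apply w (_ - _ : polyFun 𝕜 W)]
      simp only [map_sub, map_smul, map_sum, map_mul, smul_eq_mul, evalHom_apply,
        AlgHom.commutes]
      rfl
    rw [h1]
    exact Subtype.property _
  · rw [h0]
    exact one_ne_zero
  · change D.det.1 w₀ • u₀ - Q (evalHom w₀ ∘ y) = u₀
    have h2 : evalHom w₀ ∘ y = 0 := by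
      funext i
      simp only [Function.comp_apply, y, Matrix.mulVec, dotProduct, map_sum, map_mul]
      refine Finset.sum_eq_zero fun j _ => ?_
      have : evalHom w₀ (c j) = 0 := by
        change P (C w₀ u₀) j = 0
        rw [hu₀, map_zero, Pi.zero_apply]
      rw [this, mul_zero]
    rw [h0, h2, one_smul, map_zero, sub_zero]
  · have hPx : P (C w (D.det.1 w • u₀ - Q (evalHom w ∘ y))) = 0 := by
      rw [map_sub, map_sub, map_smul, map_smul, ← hc w]
      have h3 : P (C w (Q (evalHom w ∘ y))) = (D.map (evalHom w)).mulVec (evalHom w ∘ y) := by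
        rw [hDw, ← Matrix.toLin'_apply, Matrix.toLin'_toMatrix']
        rfl
      have h4 : (D.map (evalHom w)).mulVec (evalHom w ∘ y) = evalHom w ∘ (D.mulVec y) := by
        funext i
        exact ((evalHom w : polyFun 𝕜 W →ₐ[𝕜] 𝕜).toRingHom.map_mulVec D y i).symm
      have h5 : D.mulVec y = D.det • c := by
        rw [Matrix.mulVec_mulVec, Matrix.mul_adjugate, Matrix.smul_mulVec, Matrix.one_mulVec]
      rw [h3, h4, h5, sub_eq_zero]
      funext i
      simp
    rw [familyMatrix_det] at hw
    have h6 := rank_le_of_det_ne_zero hw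
    have h7 := (C w).finrank_range_add_finrank_ker
    have h8 := (C w₀).finrank_range_add_finrank_ker
    have h9 := hmin w
    -- Minimality of the kernel at `w₀` bounds the rank by `r`, so `P` is injective on the range of
    -- `C w` and detects whether `C w x` vanishes.
    have hrank : finrank 𝕜 (LinearMap.range (C w)) = r := by omega
    have hsurj : Function.Surjective (P ∘ₗ (LinearMap.range (C w)).subtype) := by
      intro z
      obtain ⟨a, ha⟩ := (bijective_of_toMatrix'_det_ne_zero hw).2 z
      exact ⟨⟨C w (Q a), LinearMap.mem_range_self _ _⟩, ha⟩
    have hinj : Function.Injective (P ∘ₗ (LinearMap.range (C w)).subtype) := by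
      rw [LinearMap.injective_iff_surjective_of_finrank_eq_finrank (by simpa using hrank)]
      exact hsurj
    have h10 := @hinj ⟨C w (D.det.1 w • u₀ - Q (evalHom w ∘ y)), LinearMap.mem_range_self _ _⟩ 0
      (by simpa using hPx)
    exact congrArg Subtype.val h10

/-- If `v₀` is a linearly independent finite family depending polynomially on a parameter, then
it stays so over a basic open set. -/
theorem exists_linearIndependent {k : ℕ} (v : W → Fin k → U) (w₀ : W)
    (hv : ∀ i, IsPolyMap 𝕜 fun w => v w i)
    (h₀ : LinearIndependent 𝕜 (v w₀)) :
    ∃ δ ∈ polyFun 𝕜 W, δ w₀ ≠ 0 ∧ ∀ w, δ w ≠ 0 → LinearIndependent 𝕜 (v w) := by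
  obtain ⟨P, hP⟩ := (Fintype.linearCombination 𝕜 (v w₀)).exists_leftInverse_of_injective
    (linearIndependent_iff_injective_fintypeLinearCombination.1 h₀ |> LinearMap.ker_eq_bot.2)
  let D : Matrix (Fin k) (Fin k) (polyFun 𝕜 W) :=
    fun i j => ⟨fun w => P (v w j) i, hv j (LinearMap.proj i ∘ₗ P)⟩
  have hD : ∀ w, D.map (evalHom w) =
      LinearMap.toMatrix' (P ∘ₗ Fintype.linearCombination 𝕜 (v w)) := by
    intro w
    ext i j
    simp only [LinearMap.toMatrix'_apply, LinearMap.comp_apply,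
      Fintype.linearCombination_apply_single, one_smul]
    rfl
  have hdet : ∀ w, D.det.1 w =
      (LinearMap.toMatrix' (P ∘ₗ Fintype.linearCombination 𝕜 (v w))).det := by
    intro w
    rw [← hD, ← evalHom_apply, AlgHom.map_det]
    rfl
  refine ⟨_, D.det.2, ?_, fun w hw => ?_⟩
  · rw [hdet, hP]
    simp
  · rw [hdet] at hw
    rw [linearIndependent_iff_injective_fintypeLinearCombination]
    have hinj : Function.Injective (P ∘ₗ Fintype.linearCombination 𝕜 (v w)) :=
      (bijective_of_toMatrix'_det_ne_zero hw).1
    rw [LinearMap.coe_comp] at hinj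
    exact hinj.of_comp

end Zariski

/-! ### Generic points are regular. -/

section Regular

variable {𝕜 : Type*} [Field 𝕜] {q : Type*} [LieRing q] [LieAlgebra 𝕜 q]
  {W : Type*} [AddCommGroup W] [Module 𝕜 W] [LieRingModule q W] [LieModule 𝕜 q W]

/-- The orbit maps `x ↦ x · w` of a `𝔮`-module. -/
def orbitMap : W →ₗ[𝕜] q →ₗ[𝕜] W := (LieModule.toEnd 𝕜 q W : q →ₗ[𝕜] End 𝕜 W).flip

theorem ker_orbitMap (w : W) : LinearMap.ker (orbitMap (𝕜 := 𝕜) (q := q) w) = lieStab 𝕜 q w := by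
  ext x
  rfl

/-- The minimal stabiliser dimension is attained on a nonempty open set, which meets the open set of
the genericity condition, and conjugate stabilisers have equal dimension. -/
theorem IsGenericPoint.isRegularPoint [Infinite 𝕜] [FiniteDimensional 𝕜 q] {Q : Type*} [Group Q]
    {Ad : Representation 𝕜 Q q} {w : W} (h : IsGenericPoint 𝕜 Ad w) : IsRegularPoint 𝕜 q w := by
  obtain ⟨O, hO, hne, hconj⟩ := h
  obtain ⟨f, hf, ⟨u, hu⟩, hfO⟩ := hO.exists_basic hne
  obtain ⟨v, hv⟩ := Nat.sInf_mem (Set.range_nonempty fun w : W => finrank 𝕜 (lieStab 𝕜 q w))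
  obtain ⟨δ, hδ, hδv, hδle⟩ := exists_finrank_ker_le (orbitMap (𝕜 := 𝕜) (q := q) (W := W)) v
  obtain ⟨z, hz1, hz2⟩ := exists_ne_zero_of_polyFun hf hδ hu hδv
  obtain ⟨g, hg⟩ := hconj z (hfO z hz1)
  have h1 := hδle z hz2
  rw [ker_orbitMap, ker_orbitMap, ← hg] at h1
  have hinj : Function.Injective (Ad g) := by
    intro x y hxy
    have := congrArg (Ad g⁻¹) hxy
    simpa [← Module.End.mul_apply, ← map_mul] using this
  rw [(Submodule.equivMapOfInjective _ hinj (lieStab 𝕜 q w)).symm.finrank_eq] at h1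
  refine le_antisymm ?_ (ciInf_le (OrderBot.bddBelow _) w)
  refine h1.trans ?_
  exact hv.le

end Regular

end CentGen

namespace CentGen

/-! ### Stabilisers of linear forms on `𝔤_e` have dimension at least `dim V`. -/

section LowerBound

variable {𝕜 : Type*} [Field 𝕜] {V : Type*} [AddCommGroup V] [Module 𝕜 V]

/-- The commutator, as a bilinear map. -/
noncomputable def commMap (𝕜 V : Type*) [Field 𝕜] [AddCommGroup V] [Module 𝕜 V] :
    End 𝕜 V →ₗ[𝕜] End 𝕜 V →ₗ[𝕜] End 𝕜 V :=
  LinearMap.mul 𝕜 (End 𝕜 V) - (LinearMap.mul 𝕜 (End 𝕜 V)).flip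

@[simp]
theorem commMap_apply (x y : End 𝕜 V) : commMap 𝕜 V x y = x * y - y * x := rfl

/-- Powers of an endomorphism with `k` distinct eigenvalues. -/
theorem linearIndependent_pow_of_eigenvalues {k : ℕ} {x : End 𝕜 V} {c : Fin k → 𝕜}
    (hc : Function.Injective c) (h : ∀ i, x.HasEigenvalue (c i)) :
    LinearIndependent 𝕜 fun j : Fin k => x ^ (j : ℕ) := by
  rw [Fintype.linearIndependent_iff]
  intro g hg
  have h1 : g = 0 := by
    -- Evaluating the relation on eigenvectors gives a Vandermonde system.
    refine Matrix.eq_zero_of_forall_index_sum_pow_mul_eq_zero hc fun j => ?_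
    obtain ⟨v, hv⟩ := (h j).exists_hasEigenvector
    have h2 : (∑ i : Fin k, g i • x ^ (i : ℕ)) v = 0 := by rw [hg, LinearMap.zero_apply]
    rw [LinearMap.sum_apply] at h2
    simp only [LinearMap.smul_apply, hv.pow_apply, smul_smul, ← Finset.sum_smul] at h2
    have h3 := (smul_eq_zero.1 h2).resolve_right hv.2
    rw [← h3]
    exact Finset.sum_congr rfl fun i _ => mul_comm _ _
  exact fun i => congrFun h1 i

variable [FiniteDimensional 𝕜 V]

/-- A diagonal endomorphism with distinct eigenvalues serves; the infinite field supplies the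
eigenvalues. -/
theorem exists_linearIndependent_pow [Infinite 𝕜] :
    ∃ d : End 𝕜 V, LinearIndependent 𝕜 fun j : Fin (finrank 𝕜 V) => d ^ (j : ℕ) := by
  let b := finBasis 𝕜 V
  let c : Fin (finrank 𝕜 V) → 𝕜 := fun i => Infinite.natEmbedding 𝕜 i
  refine ⟨b.constr 𝕜 fun i => c i • b i, linearIndependent_pow_of_eigenvalues (c := c)
    (fun i j h => Fin.ext ((Infinite.natEmbedding 𝕜).injective h)) fun i => ?_⟩
  exact End.hasEigenvalue_of_hasEigenvector (x := b i)
    ⟨End.mem_eigenspace_iff.2 (b.constr_basis 𝕜 _ i), b.ne_zero i⟩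

/-- The centraliser of an endomorphism of `V` has dimension at least `dim V`. -/
theorem finrank_le_finrank_ker_commMap [Infinite 𝕜] (x : End 𝕜 V) :
    finrank 𝕜 V ≤ finrank 𝕜 (LinearMap.ker (commMap 𝕜 V x)) := by
  obtain ⟨d, hd⟩ := exists_linearIndependent_pow (𝕜 := 𝕜) (V := V)
  obtain ⟨δ, hδ, hδd, hδ'⟩ := exists_linearIndependent
    (fun (w : End 𝕜 V) (j : Fin (finrank 𝕜 V)) => w ^ (j : ℕ)) d
    (fun i => (IsPolyMap.linear LinearMap.id).pow i) hd
  obtain ⟨γ, hγ, hγx, hγ'⟩ := exists_finrank_ker_le (commMap 𝕜 V) x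
  -- The centraliser of this `w` contains `dim V` independent powers of `w`, and is no larger than
  -- the centraliser of `x`.
  obtain ⟨w, hw1, hw2⟩ := exists_ne_zero_of_polyFun hδ hγ hδd hγx
  refine le_trans ?_ (hγ' w hw2)
  have h1 := hδ' w hw1
  have h2 : LinearIndependent 𝕜 fun j : Fin (finrank 𝕜 V) =>
      (⟨w ^ (j : ℕ), by
        rw [LinearMap.mem_ker, commMap_apply, ← pow_succ, ← pow_succ', sub_self]⟩ :
        LinearMap.ker (commMap 𝕜 V w)) :=
    LinearIndependent.of_comp (LinearMap.ker (commMap 𝕜 V w)).subtype h1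
  simpa using h2.fintype_card_le_finrank

/-- Linear forms on `End V` are of the form `x ↦ tr (m x)`. -/
theorem exists_trace_mul (M : Dual 𝕜 (End 𝕜 V)) :
    ∃ m : End 𝕜 V, ∀ x, M x = LinearMap.trace 𝕜 V (m * x) := by
  let T : End 𝕜 V →ₗ[𝕜] Dual 𝕜 (End 𝕜 V) := (LinearMap.mul 𝕜 (End 𝕜 V)).compr₂
    (LinearMap.trace 𝕜 V)
  have hT : Function.Injective T := by
    rw [← LinearMap.ker_eq_bot, LinearMap.ker_eq_bot']
    intro m hm
    ext v
    refine (forall_dual_apply_eq_zero_iff 𝕜 (m v)).1 fun f => ?_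
    have h1 : LinearMap.trace 𝕜 V (m * f.smulRight v) = 0 := LinearMap.congr_fun hm _
    rw [show m * f.smulRight v = f.smulRight (m v) by ext; simp, LinearMap.trace_smulRight] at h1
    exact h1
  obtain ⟨m, hm⟩ := (LinearMap.injective_iff_surjective_of_finrank_eq_finrank
    (Subspace.dual_finrank_eq (K := 𝕜) (V := End 𝕜 V)).symm).1 hT M
  exact ⟨m, fun x => by rw [← hm]; rfl⟩

omit [FiniteDimensional 𝕜 V] in
/-- The stabiliser of a linear form `M` on the associative algebra of the endomorphisms that
commute with `e`. -/
def symStab (e : End 𝕜 V) (M : Dual 𝕜 (End 𝕜 V)) : Subalgebra 𝕜 (End 𝕜 V) where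
  carrier := {x | Commute x e ∧ ∀ y, Commute y e → M (x * y) = M (y * x)}
  mul_mem' := by
    rintro x z ⟨hx, hx'⟩ ⟨hz, hz'⟩
    refine ⟨hx.mul_left hz, fun y hy => ?_⟩
    rw [mul_assoc, hx' _ (hz.mul_left hy), mul_assoc, hz' _ (hy.mul_left hx), mul_assoc]
  add_mem' := by
    rintro x z ⟨hx, hx'⟩ ⟨hz, hz'⟩
    refine ⟨hx.add_left hz, fun y hy => ?_⟩
    rw [add_mul, mul_add, map_add, map_add, hx' y hy, hz' y hy]
  algebraMap_mem' := by
    intro r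
    exact ⟨Algebra.commutes r e, fun y _ => by rw [Algebra.commutes r y]⟩

omit [FiniteDimensional 𝕜 V] in
theorem mem_symStab {e x : End 𝕜 V} {M : Dual 𝕜 (End 𝕜 V)} :
    x ∈ symStab e M ↔ Commute x e ∧ ∀ y, Commute y e → M (x * y) = M (y * x) := Iff.rfl

/-- The stabilisers in `𝔤_e` of linear forms have dimension at least `dim V`. -/
theorem finrank_le_finrank_symStab [Infinite 𝕜] (e : End 𝕜 V) (M : Dual 𝕜 (End 𝕜 V)) :
    finrank 𝕜 V ≤ finrank 𝕜 (symStab e M) := by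
  obtain ⟨m, hm⟩ := exists_trace_mul M
  set E := LinearMap.ker (commMap 𝕜 V e) with hE
  obtain ⟨U, hU⟩ := E.exists_isCompl
  have hEmem : ∀ {y}, y ∈ E ↔ e * y = y * e := fun {y} => by
    rw [hE, LinearMap.mem_ker, commMap_apply, sub_eq_zero]
  let pE : (E × U) →ₗ[𝕜] End 𝕜 V := E.subtype ∘ₗ LinearMap.fst 𝕜 E U
  let pU : (E × U) →ₗ[𝕜] End 𝕜 V := U.subtype ∘ₗ LinearMap.snd 𝕜 E U
  -- For `x ∈ E` one has `[e + t m, x + t u] = t ([m, x] + [e, u]) + t² [m, u]`. Dividing by `t`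
  -- gives the pencil `F₀ + t F₁`, which has a meaning at `t = 0`; there the condition `[m, x] ∈ [e,
  -- U]` places `x` in the stabiliser of `M`.
  let F₀ : (E × U) →ₗ[𝕜] End 𝕜 V := commMap 𝕜 V m ∘ₗ pE + commMap 𝕜 V e ∘ₗ pU
  let F₁ : (E × U) →ₗ[𝕜] End 𝕜 V := commMap 𝕜 V m ∘ₗ pU
  let C : (𝕜 × 𝕜) →ₗ[𝕜] (E × U) →ₗ[𝕜] End 𝕜 V :=
    (LinearMap.fst 𝕜 𝕜 𝕜).smulRight F₀ + (LinearMap.snd 𝕜 𝕜 𝕜).smulRight F₁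
  have hC : ∀ (w : 𝕜 × 𝕜) p, C w p = w.1 • ((m * p.1 - p.1 * m) + (e * p.2 - p.2 * e)) +
      w.2 • (m * p.2 - p.2 * m) := fun w p => rfl
  have hdim : finrank 𝕜 (E × U) = finrank 𝕜 (End 𝕜 V) := by
    rw [finrank_prod, Submodule.finrank_add_eq_of_isCompl hU]
  -- the kernel at `(1, 0)`
  have h0 : finrank 𝕜 (LinearMap.ker (C (1, 0))) ≤ finrank 𝕜 (symStab e M) := by
    have hmem : ∀ p ∈ LinearMap.ker (C (1, 0)), (p.1 : End 𝕜 V) ∈ symStab e M := by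
      intro p hp
      rw [LinearMap.mem_ker, hC] at hp
      simp only [one_smul, zero_smul, add_zero] at hp
      refine ⟨(hEmem.1 p.1.2).symm, fun y hy => ?_⟩
      have h1 : m * p.1 * y - p.1 * m * y + (e * p.2 * y - p.2 * e * y) = 0 := by
        rw [← sub_mul, ← sub_mul, ← add_mul, hp, zero_mul]
      have h2 := congrArg (LinearMap.trace 𝕜 V) h1
      have h3 : LinearMap.trace 𝕜 V (p.1 * m * y) = LinearMap.trace 𝕜 V (m * y * p.1) := by
        rw [mul_assoc, LinearMap.trace_mul_comm]
      have h4 : LinearMap.trace 𝕜 V (e * p.2 * y) = LinearMap.trace 𝕜 V (p.2 * e * y) := by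
        rw [mul_assoc, LinearMap.trace_mul_comm, mul_assoc, mul_assoc, hy.eq]
      rw [map_add, map_sub, map_sub, h4, sub_self, add_zero, h3, map_zero, sub_eq_zero] at h2
      rw [hm, hm, ← mul_assoc, ← mul_assoc, h2]
    let f : LinearMap.ker (C (1, 0)) →ₗ[𝕜] (symStab e M).toSubmodule :=
      (pE ∘ₗ (LinearMap.ker (C (1, 0))).subtype).codRestrict (symStab e M).toSubmodule
        fun p => hmem p.1 p.2
    refine LinearMap.finrank_le_finrank_of_injective (f := f) ?_
    rintro ⟨⟨x, u⟩, hp⟩ ⟨⟨x', u'⟩, hp'⟩ hx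
    have hx0 : x = x' := by
      have h := congrArg Subtype.val hx
      exact Subtype.ext h
    subst hx0
    rw [LinearMap.mem_ker, hC] at hp hp'
    simp only [one_smul, zero_smul, add_zero] at hp hp'
    -- Two kernel elements with the same first component differ by an element of `U` that commutes
    -- with `e`, hence by an element of `U ⊓ E`.
    have h1 : e * (u - u' : U) = (u - u' : U) * e := by
      rw [← sub_eq_zero, AddSubgroupClass.coe_sub, mul_sub, sub_mul]
      have h := sub_eq_zero.2 (hp.trans hp'.symm)
      rw [← h]
      noncomm_ring
    have h2 := Submodule.disjoint_def.1 hU.disjoint _ (hEmem.2 h1) (u - u').2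
    have hu0 : u = u' := sub_eq_zero.1 (Subtype.ext h2)
    subst hu0
    rfl
  -- the kernel at a general point
  obtain ⟨δ, hδ, hδ1, hδ2⟩ := exists_finrank_ker_le C (1, 0)
  have hf : (fun w : 𝕜 × 𝕜 => w.1 * w.2) ∈ polyFun 𝕜 (𝕜 × 𝕜) :=
    (polyFun 𝕜 (𝕜 × 𝕜)).mul_mem (dual_mem_polyFun (LinearMap.fst 𝕜 𝕜 𝕜))
      (dual_mem_polyFun (LinearMap.snd 𝕜 𝕜 𝕜))
  obtain ⟨w, hw1, hw2⟩ := exists_ne_zero_of_polyFun hδ hf hδ1 (v := (1, 1)) (by simp)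
  have hw : w.2 ≠ 0 := right_ne_zero_of_mul hw2
  refine le_trans ?_ ((hδ2 w hw1).trans h0)
  -- With both coordinates nonzero the pencil is a rescaled commutator with `w.1 • e + w.2 • m`, so
  -- its rank is at most `dim (End V) - dim V`, while its source has the dimension of `End V`.
  have hle : LinearMap.range (C w) ≤ LinearMap.range (commMap 𝕜 V (w.1 • e + w.2 • m)) := by
    rintro _ ⟨p, rfl⟩
    refine ⟨(w.1 * w.2⁻¹) • (p.1 : End 𝕜 V) + p.2, ?_⟩
    have he := hEmem.1 p.1.2
    rw [hC, commMap_apply]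
    simp only [mul_add, add_mul, smul_mul_assoc, mul_smul_comm, he]
    match_scalars <;> field_simp
    ring
  have h1 := Submodule.finrank_mono hle
  have h2 := (C w).finrank_range_add_finrank_ker
  have h3 := (commMap 𝕜 V (w.1 • e + w.2 • m)).finrank_range_add_finrank_ker
  have h4 := finrank_le_finrank_ker_commMap (w.1 • e + w.2 • m)
  omega

end LowerBound

end CentGen

namespace CentGen

/-! ### Passing between the Lie algebra `𝔤_e` and associative stabilisers in `End V`. -/

section Extension

variable {𝕜 : Type*} [Field 𝕜] {V : Type*} [AddCommGroup V] [Module 𝕜 V]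

theorem exists_extend_gCent {e : End 𝕜 V} (β : Dual 𝕜 (gCent e)) :
    ∃ M : Dual 𝕜 (End 𝕜 V), ∀ y : gCent e, M y = β y := by
  obtain ⟨M, hM⟩ := LinearMap.exists_extend (p := (gCent e).toSubmodule) β
  exact ⟨M, fun y => LinearMap.congr_fun hM y⟩

theorem mem_lieStab_dual {L : Type*} [LieRing L] [LieAlgebra 𝕜 L] {β : Dual 𝕜 L} {x : L} :
    x ∈ lieStab 𝕜 L β ↔ ∀ y, β ⁅x, y⁆ = 0 := by
  change ⁅x, β⁆ = 0 ↔ _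
  rw [LinearMap.ext_iff]
  simp

/-- Only the values of `M` on the centraliser matter, so the choice of extension is immaterial. The
gain is that associative products can be used in the stabiliser. -/
theorem mem_lieStab_iff_symStab {e : End 𝕜 V} {β : Dual 𝕜 (gCent e)} {M : Dual 𝕜 (End 𝕜 V)}
    (hM : ∀ y : gCent e, M y = β y) {x : gCent e} :
    x ∈ lieStab 𝕜 (gCent e) β ↔ (x : End 𝕜 V) ∈ symStab e M := by
  rw [mem_lieStab_dual, mem_symStab]
  have h : ∀ y : gCent e, β ⁅x, y⁆ = M ((x : End 𝕜 V) * y) - M ((y : End 𝕜 V) * x) := by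
    intro y
    rw [← hM, ← map_sub]
    rfl
  simp only [h, sub_eq_zero]
  exact ⟨fun h => ⟨mem_gCent.1 x.2, fun y hy => h ⟨y, mem_gCent.2 hy⟩⟩,
    fun h y => h.2 y (mem_gCent.1 y.2)⟩

theorem finrank_lieStab_eq {e : End 𝕜 V} {β : Dual 𝕜 (gCent e)} {M : Dual 𝕜 (End 𝕜 V)}
    (hM : ∀ y : gCent e, M y = β y) :
    finrank 𝕜 (lieStab 𝕜 (gCent e) β) = finrank 𝕜 (symStab e M) := by
  have h : (lieStab 𝕜 (gCent e) β).map (gCent e).toSubmodule.subtype =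
      (symStab e M).toSubmodule := by
    ext x
    constructor
    · rintro ⟨y, hy, rfl⟩
      exact (mem_lieStab_iff_symStab hM).1 hy
    · intro hx
      exact ⟨⟨x, mem_gCent.2 (mem_symStab.1 hx).1⟩, (mem_lieStab_iff_symStab hM).2 hx, rfl⟩
  refine (Submodule.equivMapOfInjective _ (gCent e).toSubmodule.injective_subtype
    (lieStab 𝕜 (gCent e) β)).finrank_eq.trans ?_
  rw [h]
  rfl

theorem finrank_le_finrank_lieStab [Infinite 𝕜] [FiniteDimensional 𝕜 V] {e : End 𝕜 V}
    (β : Dual 𝕜 (gCent e)) : finrank 𝕜 V ≤ finrank 𝕜 (lieStab 𝕜 (gCent e) β) := by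
  obtain ⟨M, hM⟩ := exists_extend_gCent β
  rw [finrank_lieStab_eq hM]
  exact finrank_le_finrank_symStab e M

end Extension

/-! ### The diagonal algebra, and the stabiliser of `α`. -/

namespace JordanBasis

variable {𝕜 : Type*} [Field 𝕜] {V : Type*} [AddCommGroup V] [Module 𝕜 V] {e : End 𝕜 V}
  (b : JordanBasis e)

theorem ext_gen {x y : End 𝕜 V} (hx : Commute x e) (hy : Commute y e)
    (h : ∀ i, x (b.gen i) = y (b.gen i)) : x = y := by
  refine b.basis.ext fun p => ?_
  rw [b.basis_apply, ← Module.End.mul_apply, ← Module.End.mul_apply, (hx.pow_right _).eq,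
    (hy.pow_right _).eq, Module.End.mul_apply, Module.End.mul_apply, h]

/-- The coefficient of `e ^ s w_j`, zero if `s ≥ λ_j`. -/
noncomputable def coeff (j : Fin b.n) (s : ℕ) : Dual 𝕜 V :=
  if h : s < b.size j then b.basis.coord ⟨j, ⟨s, h⟩⟩ else 0

theorem coeff_basis (j : Fin b.n) (s : ℕ) (p : Σ i, Fin (b.size i)) :
    b.coeff j s (b.basis p) = if p.1 = j ∧ (p.2 : ℕ) = s then 1 else 0 := by
  obtain ⟨k, t⟩ := p
  unfold coeff
  split_ifs with h1 h2 h2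
  · obtain ⟨rfl, rfl⟩ := h2
    simp
  · rw [Basis.coord_apply, Basis.repr_self, Finsupp.single_apply, if_neg]
    intro h
    obtain ⟨rfl, h⟩ := Sigma.mk.inj_iff.1 h
    exact h2 ⟨rfl, congrArg Fin.val (eq_of_heq h)⟩
  · obtain ⟨rfl, rfl⟩ := h2
    exact absurd t.2 h1
  · rfl

theorem coeff_pow_gen (j : Fin b.n) (s : ℕ) (k : Fin b.n) (t : ℕ) :
    b.coeff j s ((e ^ t) (b.gen k)) = if k = j ∧ t = s ∧ s < b.size j then 1 else 0 := by
  rw [b.pow_gen]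
  split_ifs with h1 h2 h2
  · rw [coeff_basis, if_pos ⟨h2.1, h2.2.1⟩]
  · rw [coeff_basis, if_neg]
    rintro ⟨rfl, rfl⟩
    exact h2 ⟨rfl, rfl, h1⟩
  · obtain ⟨rfl, rfl, h⟩ := h2
    exact absurd h h1
  · rw [map_zero]

theorem coeff_pow_apply (j : Fin b.n) (s r : ℕ) (v : V) :
    b.coeff j s ((e ^ r) v) = if r ≤ s ∧ s < b.size j then b.coeff j (s - r) v else 0 := by
  have h : b.coeff j s ∘ₗ (e ^ r) =
      if r ≤ s ∧ s < b.size j then b.coeff j (s - r) else 0 := by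
    refine b.basis.ext fun p => ?_
    rw [LinearMap.comp_apply, b.basis_apply, ← Module.End.mul_apply, ← pow_add, coeff_pow_gen]
    split_ifs with h1 h2 h2
    · rw [coeff_pow_gen, if_pos (by omega)]
    · omega
    · rw [coeff_pow_gen, if_neg (by omega)]
    · rw [LinearMap.zero_apply]
  rw [← LinearMap.comp_apply, h]
  split_ifs <;> rfl

theorem coeff_of_le {j : Fin b.n} {s : ℕ} (h : b.size j ≤ s) : b.coeff j s = 0 :=
  dif_neg (not_lt.2 h)

theorem coeff_xiEnd {i j : Fin b.n} {r : ℕ} (h : b.size i ≤ r + b.size j) (k : Fin b.n) (t : ℕ)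
    (v : V) : b.coeff k t (b.xiEnd j i r v) =
      if k = i ∧ r ≤ t ∧ t < b.size i then b.coeff j (t - r) v else 0 := by
  have h' : b.coeff k t ∘ₗ b.xiEnd j i r =
      if k = i ∧ r ≤ t ∧ t < b.size i then b.coeff j (t - r) else 0 := by
    refine b.basis.ext fun p => ?_
    rw [LinearMap.comp_apply, b.basis_apply, b.xiEnd_gen _ _ _ _ _ h, apply_ite (b.coeff k t),
      coeff_pow_gen, map_zero]
    have hp := p.2.2
    by_cases hpj : p.1 = j
    · subst hpj
      by_cases hk : k = i
      · subst hk
        simp only [true_and, if_true]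
        split_ifs with h1 h2 h2
        · rw [coeff_pow_gen, if_pos (by omega)]
        · omega
        · rw [coeff_pow_gen, if_neg (by omega)]
        · rfl
      · rw [if_pos rfl, if_neg (fun h => hk h.1.symm), if_neg (fun h => hk h.1)]
        rfl
    · rw [if_neg hpj]
      split_ifs with h1
      · rw [coeff_pow_gen, if_neg (fun h => hpj h.1)]
      · rfl
  rw [← LinearMap.comp_apply, h']
  split_ifs <;> rfl

theorem sum_coeff_smul (v : V) :
    ∑ p : Σ i, Fin (b.size i), b.coeff p.1 p.2 v • (e ^ (p.2 : ℕ)) (b.gen p.1) = v := by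
  conv_rhs => rw [← b.basis.sum_repr v]
  refine Finset.sum_congr rfl fun p _ => ?_
  rw [b.basis_apply, coeff, dif_pos p.2.2]
  rfl

theorem ext_coeff {v w : V} (h : ∀ j s, b.coeff j s v = b.coeff j s w) : v = w := by
  rw [← b.sum_coeff_smul v, ← b.sum_coeff_smul w]
  simp only [h]

/-- The projection onto the `i`-th Jordan block. -/
noncomputable def blockProj (i : Fin b.n) : End 𝕜 V := b.xiEnd i i 0

theorem commute_blockProj (i : Fin b.n) : Commute (b.blockProj i) e :=
  mem_gCent.1 (b.xiEnd_mem i i 0 (by omega))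

theorem blockProj_gen (i k : Fin b.n) :
    b.blockProj i (b.gen k) = if k = i then b.gen i else 0 := by
  simpa [blockProj] using b.xiEnd_gen i i k 0 0 (by omega)

theorem coeff_blockProj (i k : Fin b.n) (t : ℕ) (v : V) :
    b.coeff k t (b.blockProj i v) = if k = i then b.coeff k t v else 0 := by
  rw [blockProj, b.coeff_xiEnd (by omega)]
  by_cases hk : k = i
  · subst hk
    by_cases ht : t < b.size k
    · simp [ht]
    · simp [b.coeff_of_le (not_lt.1 ht)]
  · simp [hk]

theorem blockProj_mul (i j : Fin b.n) :
    b.blockProj i * b.blockProj j = if i = j then b.blockProj i else 0 := by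
  refine b.ext_gen ((b.commute_blockProj i).mul_left (b.commute_blockProj j)) ?_ fun k => ?_
  · split_ifs
    exacts [b.commute_blockProj i, Commute.zero_left e]
  · rw [Module.End.mul_apply, blockProj_gen]
    by_cases hij : i = j
    · subst hij
      rw [if_pos rfl, blockProj_gen]
      split_ifs with h
      · rw [blockProj_gen, if_pos rfl]
      · rw [map_zero]
    · rw [if_neg hij, LinearMap.zero_apply]
      split_ifs with h
      · rw [blockProj_gen, if_neg (fun h => hij h.symm)]
      · rw [map_zero]

theorem sum_blockProj : ∑ i, b.blockProj i = 1 := by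
  refine b.ext_gen (Commute.sum_left _ _ _ fun i _ => b.commute_blockProj i)
    (Commute.one_left e) fun k => ?_
  simp [LinearMap.sum_apply, blockProj_gen]

/-- The algebra of the endomorphisms that commute with `e` and preserve the Jordan blocks. -/
noncomputable def diag : Subalgebra 𝕜 (End 𝕜 V) :=
  Subalgebra.centralizer 𝕜 (insert e (Set.range b.blockProj))

theorem mem_diag {x : End 𝕜 V} :
    x ∈ b.diag ↔ Commute x e ∧ ∀ i, Commute x (b.blockProj i) := by
  rw [diag, Subalgebra.mem_centralizer_iff]
  simp only [Set.mem_insert_iff, Set.mem_range, forall_eq_or_imp, forall_exists_index,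
    forall_apply_eq_imp_iff]
  exact and_congr eq_comm (forall_congr' fun i => eq_comm)

theorem blockProj_mem_diag (i : Fin b.n) : b.blockProj i ∈ b.diag := by
  refine b.mem_diag.2 ⟨b.commute_blockProj i, fun j => ?_⟩
  rw [commute_iff_eq, blockProj_mul, blockProj_mul]
  by_cases h : i = j
  · subst h
    rfl
  · rw [if_neg h, if_neg (Ne.symm h)]

theorem mem_diag_of_coeff {x : End 𝕜 V} (hx : Commute x e)
    (h : ∀ i j s, i ≠ j → b.coeff j s (x (b.gen i)) = 0) : x ∈ b.diag := by
  refine b.mem_diag.2 ⟨hx, fun i => b.ext_gen (hx.mul_left (b.commute_blockProj i))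
    ((b.commute_blockProj i).mul_left hx) fun k => b.ext_coeff fun j s => ?_⟩
  rw [Module.End.mul_apply, Module.End.mul_apply, blockProj_gen, coeff_blockProj]
  by_cases hki : k = i
  · subst hki
    rw [if_pos rfl]
    split_ifs with hj
    · rfl
    · exact h _ _ _ (Ne.symm hj)
  · rw [if_neg hki, map_zero, map_zero]
    split_ifs with hj
    · subst hj
      exact (h _ _ _ hki).symm
    · rfl

theorem coeff_diag {x : End 𝕜 V} (hx : x ∈ b.diag) {i j : Fin b.n} (hij : i ≠ j) (s : ℕ) :
    b.coeff j s (x (b.gen i)) = 0 := by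
  have h1 : x (b.gen i) = b.blockProj i (x (b.gen i)) := by
    rw [← Module.End.mul_apply, ← ((b.mem_diag.1 hx).2 i).eq, Module.End.mul_apply,
      blockProj_gen, if_pos rfl]
  rw [h1, coeff_blockProj, if_neg (Ne.symm hij)]

/-- A diagonal endomorphism acts on each block as a polynomial in `e`. -/
theorem exists_aeval_of_mem_diag {x : End 𝕜 V} (hx : x ∈ b.diag) (i : Fin b.n) :
    ∃ p : Polynomial 𝕜, x (b.gen i) = Polynomial.aeval e p (b.gen i) := by
  refine ⟨∑ s : Fin (b.size i), Polynomial.monomial s (b.coeff i s (x (b.gen i))), ?_⟩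
  conv_lhs => rw [← b.sum_coeff_smul (x (b.gen i)), Fintype.sum_sigma]
  rw [Finset.sum_eq_single i]
  · simp [Polynomial.aeval_monomial, LinearMap.sum_apply, Module.End.mul_apply]
  · intro j _ hj
    exact Finset.sum_eq_zero fun s _ => by
      rw [b.coeff_diag hx (Ne.symm hj), zero_smul]
  · intro h
    exact absurd (Finset.mem_univ i) h

theorem aeval_commute_apply {x : End 𝕜 V} (hx : Commute x e) (p : Polynomial 𝕜) (v : V) :
    x (Polynomial.aeval e p v) = Polynomial.aeval e p (x v) := by
  have h : Commute x (Polynomial.aeval e p) := by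
    induction p using Polynomial.induction_on' with
    | add p q hp hq => rw [map_add]; exact hp.add_right hq
    | monomial n a =>
      rw [Polynomial.aeval_monomial]
      exact Commute.mul_right (Algebra.commutes a x).symm (hx.pow_right n)
  exact LinearMap.congr_fun h.eq v

/-- On each block both elements act as polynomials in `e`. -/
theorem diag_comm {x y : End 𝕜 V} (hx : x ∈ b.diag) (hy : y ∈ b.diag) : x * y = y * x := by
  have hx' := (b.mem_diag.1 hx).1
  have hy' := (b.mem_diag.1 hy).1
  refine b.ext_gen (hx'.mul_left hy') (hy'.mul_left hx') fun i => ?_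
  obtain ⟨p, hp⟩ := b.exists_aeval_of_mem_diag hx i
  obtain ⟨q, hq⟩ := b.exists_aeval_of_mem_diag hy i
  rw [Module.End.mul_apply, Module.End.mul_apply, hq, aeval_commute_apply hx', hp,
    aeval_commute_apply hy', hq, ← Module.End.mul_apply, ← Module.End.mul_apply, ← map_mul,
    ← map_mul, mul_comm]

/-- The sum of the generators is a separating vector: the block projections recover the image of
each generator from the image of the sum. -/
theorem finrank_diag_le [FiniteDimensional 𝕜 V] : finrank 𝕜 b.diag ≤ finrank 𝕜 V := by
  let f : b.diag.toSubmodule →ₗ[𝕜] V :=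
    LinearMap.applyₗ (∑ i, b.gen i) ∘ₗ b.diag.toSubmodule.subtype
  refine LinearMap.finrank_le_finrank_of_injective (f := f) ?_
  rintro ⟨x, hx⟩ ⟨y, hy⟩ hxy
  have hxy' : x (∑ i, b.gen i) = y (∑ i, b.gen i) := hxy
  have hx' : x ∈ b.diag := hx
  have hy' : y ∈ b.diag := hy
  refine Subtype.ext (b.ext_gen (b.mem_diag.1 hx').1 (b.mem_diag.1 hy').1 fun i => ?_)
  have key : ∀ z ∈ b.diag, z (b.gen i) = b.blockProj i (z (∑ i, b.gen i)) := by
    intro z hz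
    rw [← Module.End.mul_apply, ← ((b.mem_diag.1 hz).2 i).eq, Module.End.mul_apply, map_sum]
    simp [blockProj_gen]
  rw [key x hx', key y hy', hxy']

/-- If the stabiliser of a linear form contains the block projections, it contains all diagonal
endomorphisms. -/
theorem diag_le_symStab {M : Dual 𝕜 (End 𝕜 V)} (h : ∀ i, b.blockProj i ∈ symStab e M) :
    b.diag ≤ symStab e M := by
  -- Moving an idempotent of the stabiliser cyclically inside `M` shows that `M` sees only the
  -- diagonal blocks.
  have hMsum : ∀ z : End 𝕜 V, Commute z e →
      M z = ∑ i, M (b.blockProj i * z * b.blockProj i) := by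
    intro z hz
    conv_lhs => rw [← one_mul z, ← b.sum_blockProj, Finset.sum_mul, map_sum]
    refine Finset.sum_congr rfl fun i _ => ?_
    have h1 := ((mem_symStab.1 (h i)).2 (b.blockProj i * z) ((b.commute_blockProj i).mul_left hz))
    rw [← h1, ← mul_assoc, blockProj_mul, if_pos rfl]
  intro x hx
  have hx' := b.mem_diag.1 hx
  refine ⟨hx'.1, fun y hy => ?_⟩
  rw [hMsum _ (hx'.1.mul_left hy), hMsum _ (hy.mul_left hx'.1)]
  refine Finset.sum_congr rfl fun i _ => ?_
  -- The diagonal blocks of `y` lie in the commutative algebra `diag`, so they commute with `x`.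
  have hd : b.blockProj i * y * b.blockProj i ∈ b.diag := by
    refine b.mem_diag.2 ⟨((b.commute_blockProj i).mul_left hy).mul_left (b.commute_blockProj i),
      fun j => ?_⟩
    rw [commute_iff_eq, mul_assoc, blockProj_mul, ← mul_assoc, ← mul_assoc, blockProj_mul]
    by_cases hij : i = j
    · subst hij
      simp
    · simp [hij, Ne.symm hij]
  have h1 := b.diag_comm hx hd
  congr 1
  calc b.blockProj i * (x * y) * b.blockProj i = x * (b.blockProj i * y * b.blockProj i) := by
        rw [← mul_assoc, ← (hx'.2 i).eq]; simp only [mul_assoc]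
    _ = b.blockProj i * y * b.blockProj i * x := h1
    _ = b.blockProj i * (y * x) * b.blockProj i := by
        rw [mul_assoc, ← (hx'.2 i).eq]; simp only [mul_assoc]

/-- The form `α` as a form on `End V`. -/
noncomputable def alphaEnd (a : Fin b.n → 𝕜) : Dual 𝕜 (End 𝕜 V) :=
  ∑ i, a i • (b.coeff i (b.size i - 1) ∘ₗ LinearMap.applyₗ (b.gen i))

theorem alphaEnd_apply (a : Fin b.n → 𝕜) (x : End 𝕜 V) :
    b.alphaEnd a x = ∑ i, a i * b.coeff i (b.size i - 1) (x (b.gen i)) := by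
  simp [alphaEnd, LinearMap.sum_apply]

theorem alphaEnd_coe (a : Fin b.n → 𝕜) (x : gCent e) : b.alphaEnd a x = b.alpha a x := by
  rw [alphaEnd_apply, alpha, LinearMap.sum_apply]
  refine Finset.sum_congr rfl fun i _ => ?_
  rw [coeff, dif_pos (Nat.sub_one_lt_of_lt (b.size_pos i))]
  rfl

/-- Let `c_s` be the coefficient of `e ^ s w_j` in `x w_i`. Testing against `ξ_j^{i,r}` gives `a_j
c_(λ_j - 1 - r) = a_i c_(λ_i - 1 - r)`, terms with `r` out of range being zero. For equal sizes `a_i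
≠ a_j` gives `c_s = 0`. For unequal sizes the coefficient of the larger block is nonzero and the
relation expresses `c_s` through some `c_(s')` with `s' < s`. -/
theorem symStab_alphaEnd_le {a : Fin b.n → 𝕜} (ha : Function.Injective a)
    (ha0 : ∀ i j, b.size j < b.size i → a i ≠ 0) : symStab e (b.alphaEnd a) ≤ b.diag := by
  intro x hx
  obtain ⟨hxe, hxs⟩ := mem_symStab.1 hx
  refine b.mem_diag_of_coeff hxe fun i j s hij => ?_
  have hxp : ∀ t : ℕ, x ((e ^ t) (b.gen i)) = (e ^ t) (x (b.gen i)) := fun t =>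
    LinearMap.congr_fun (hxe.pow_right t).eq _
  have hrel : ∀ r, b.size i ≤ r + b.size j →
      a j * (if r < b.size j then b.coeff j (b.size j - 1 - r) (x (b.gen i)) else 0) =
      a i * (if r < b.size i then b.coeff j (b.size i - 1 - r) (x (b.gen i)) else 0) := by
    intro r hr
    have h1 := hxs (b.xiEnd j i r) (mem_gCent.1 (b.xiEnd_mem j i r hr))
    rw [alphaEnd_apply, alphaEnd_apply, Finset.sum_eq_single j, Finset.sum_eq_single i] at h1
    · have h2 := b.xiEnd_gen j i j r 0 hr
      rw [pow_zero, Module.End.one_apply, if_pos rfl, zero_add] at h2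
      rw [Module.End.mul_apply, Module.End.mul_apply, h2, hxp, coeff_pow_apply,
        b.coeff_xiEnd hr] at h1
      have hi := b.size_pos i
      have hj := b.size_pos j
      convert h1 using 3
      · omega
      · exact ⟨fun h => ⟨rfl, by omega, by omega⟩, fun h => by omega⟩
    · intro k _ hk
      rw [Module.End.mul_apply, b.coeff_xiEnd hr, if_neg (fun h => hk h.1), mul_zero]
    · exact fun h => absurd (Finset.mem_univ _) h
    · intro k _ hk
      have h2 := b.xiEnd_gen j i k r 0 hr
      rw [pow_zero, Module.End.one_apply, if_neg hk] at h2
      rw [Module.End.mul_apply, h2, map_zero, map_zero, mul_zero]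
    · exact fun h => absurd (Finset.mem_univ _) h
  -- The lowest coefficients vanish since `e ^ λ_i` annihilates `x w_i`; this starts the induction
  -- when `λ_i < λ_j`.
  have hvan : ∀ s, s + b.size i < b.size j → b.coeff j s (x (b.gen i)) = 0 := by
    intro s hs
    have h1 : b.coeff j (s + b.size i) ((e ^ b.size i) (x (b.gen i))) = 0 := by
      rw [← hxp, b.pow_size, map_zero, map_zero]
    rwa [coeff_pow_apply, if_pos ⟨by omega, hs⟩, Nat.add_sub_cancel] at h1
  rcases lt_trichotomy (b.size i) (b.size j) with hlt | heq | hgt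
  · have haj := ha0 j i hlt
    induction s using Nat.strong_induction_on with
    | _ s ih =>
      by_cases hs1 : b.size j ≤ s
      · rw [b.coeff_of_le hs1, LinearMap.zero_apply]
      by_cases hs2 : s + b.size i < b.size j
      · exact hvan s hs2
      have h1 := hrel (b.size j - 1 - s) (by omega)
      rw [if_pos (by omega), if_pos (by omega), ih (b.size i - 1 - (b.size j - 1 - s)) (by omega),
        mul_zero, show b.size j - 1 - (b.size j - 1 - s) = s by omega] at h1
      exact (mul_eq_zero.1 h1).resolve_left haj
  · by_cases hs1 : b.size j ≤ s
    · rw [b.coeff_of_le hs1, LinearMap.zero_apply]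
    have h1 := hrel (b.size j - 1 - s) (by omega)
    rw [if_pos (by omega), if_pos (by omega), heq,
      show b.size j - 1 - (b.size j - 1 - s) = s by omega, ← sub_eq_zero, ← sub_mul] at h1
    exact (mul_eq_zero.1 h1).resolve_left (sub_ne_zero.2 fun h => hij (ha h).symm)
  · have hai := ha0 i j hgt
    induction s using Nat.strong_induction_on with
    | _ s ih =>
      by_cases hs1 : b.size j ≤ s
      · rw [b.coeff_of_le hs1, LinearMap.zero_apply]
      have h1 := hrel (b.size i - 1 - s) (by omega)
      have h2 : (if b.size i - 1 - s < b.size j then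
          b.coeff j (b.size j - 1 - (b.size i - 1 - s)) (x (b.gen i)) else 0) = 0 := by
        split_ifs with h
        · exact ih _ (by omega)
        · rfl
      rw [h2, if_pos (by omega), mul_zero,
        show b.size i - 1 - (b.size i - 1 - s) = s by omega] at h1
      exact (mul_eq_zero.1 h1.symm).resolve_left hai

/-- The reverse inclusion needs no computation: `dim diag ≤ dim V ≤ dim` of the stabiliser. -/
theorem symStab_alphaEnd [Infinite 𝕜] [FiniteDimensional 𝕜 V] {a : Fin b.n → 𝕜}
    (ha : Function.Injective a) (ha0 : ∀ i j, b.size j < b.size i → a i ≠ 0) :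
    symStab e (b.alphaEnd a) = b.diag :=
  Subalgebra.toSubmodule_injective <| Submodule.eq_of_le_of_finrank_le
    (b.symStab_alphaEnd_le ha ha0)
    (b.finrank_diag_le.trans (finrank_le_finrank_symStab e _))

theorem finrank_symStab_alphaEnd [Infinite 𝕜] [FiniteDimensional 𝕜 V] {a : Fin b.n → 𝕜}
    (ha : Function.Injective a) (ha0 : ∀ i j, b.size j < b.size i → a i ≠ 0) :
    finrank 𝕜 (symStab e (b.alphaEnd a)) = finrank 𝕜 V :=
  le_antisymm (b.symStab_alphaEnd ha ha0 ▸ b.finrank_diag_le) (finrank_le_finrank_symStab e _)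

theorem diag_eq_symStab [Infinite 𝕜] [FiniteDimensional 𝕜 V] {M : Dual 𝕜 (End 𝕜 V)}
    (h : ∀ i, b.blockProj i ∈ symStab e M) (hM : finrank 𝕜 (symStab e M) ≤ finrank 𝕜 b.diag) :
    b.diag = symStab e M :=
  Subalgebra.toSubmodule_injective <| Submodule.eq_of_le_of_finrank_le (b.diag_le_symStab h) hM

end JordanBasis

end CentGen

namespace CentGen

/-! ### Distinct eigenvalues and orthogonal idempotents. -/

section Eigen

variable {𝕜 : Type*} [Field 𝕜]

/-- A matrix `X` such that `χ' (X)` is invertible, for `χ` the characteristic polynomial, has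
distinct eigenvalues. -/
theorem exists_eigenbasis [IsAlgClosed 𝕜] {n : ℕ} (X : Matrix (Fin n) (Fin n) 𝕜)
    (hX : (Polynomial.aeval X X.charpoly.derivative).det ≠ 0) :
    ∃ (c : Fin n → 𝕜) (u : Fin n → Fin n → 𝕜), Function.Injective c ∧
      LinearIndependent 𝕜 u ∧ ∀ i, X.mulVec (u i) = c i • u i := by
  classical
  set f : End 𝕜 (Fin n → 𝕜) := Matrix.toLin' X with hf
  have hχ : f.charpoly = X.charpoly := Matrix.charpoly_toLin' X
  have hmonic := X.charpoly_monic
  have heig : ∀ c, X.charpoly.IsRoot c → f.HasEigenvalue c := fun c hc =>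
    (End.hasEigenvalue_iff_isRoot_charpoly f c).2 (hχ ▸ hc)
  have haev : Polynomial.aeval f X.charpoly.derivative =
      Matrix.toLin' (Polynomial.aeval X X.charpoly.derivative) :=
    Polynomial.aeval_algHom_apply (Matrix.toLinAlgEquiv' (R := 𝕜) (n := Fin n)).toAlgHom X _
  -- At a multiple root `c`, an eigenvector for `c` would be killed by the invertible `χ' (X)`.
  have hder : ∀ c, X.charpoly.IsRoot c → ¬ X.charpoly.derivative.IsRoot c := by
    intro c hc hc'
    obtain ⟨v, hv⟩ := (heig c hc).exists_hasEigenvector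
    have h1 := End.aeval_apply_of_hasEigenvector (p := X.charpoly.derivative) hv
    rw [hc'.eq_zero, zero_smul, haev] at h1
    have h2 : IsUnit (Polynomial.aeval X X.charpoly.derivative) :=
      (Matrix.isUnit_iff_isUnit_det _).2 (isUnit_iff_ne_zero.2 hX)
    have h3 := Matrix.mulVec_injective_of_isUnit h2
    refine hv.2 (h3 ?_)
    rw [Matrix.mulVec_zero, ← h1, Matrix.toLin'_apply]
  have hnodup : X.charpoly.roots.Nodup := by
    rw [Multiset.nodup_iff_count_le_one]
    intro c
    rw [Polynomial.count_roots]
    by_contra h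
    rw [not_le, Polynomial.one_lt_rootMultiplicity_iff_isRoot hmonic.ne_zero] at h
    exact hder c h.1 h.2
  have hcard : X.charpoly.roots.toFinset.card = n := by
    rw [Multiset.toFinset_card_of_nodup hnodup, ←
      (IsAlgClosed.splits X.charpoly).natDegree_eq_card_roots, X.charpoly_natDegree_eq_dim, Fintype.card_fin]
  let E := X.charpoly.roots.toFinset.equivFinOfCardEq hcard
  have hroot : ∀ i, X.charpoly.IsRoot (E.symm i) := fun i =>
    ((Polynomial.mem_roots hmonic.ne_zero).1 (Multiset.mem_toFinset.1 (E.symm i).2))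
  choose u hu using fun i => (heig _ (hroot i)).exists_hasEigenvector
  have hinj : Function.Injective fun i => ((E.symm i : X.charpoly.roots.toFinset) : 𝕜) :=
    Subtype.val_injective.comp E.symm.injective
  refine ⟨fun i => E.symm i, u, hinj, End.eigenvectors_linearIndependent' f _ hinj u hu,
    fun i => ?_⟩
  have := (hu i).apply_eq_smul
  rwa [hf, Matrix.toLin'_apply] at this

/-- Elements of the algebra generated by `x`, where `p (x)` is nilpotent for a polynomial `p` with
simple roots `c_i`, which form a complete system of orthogonal idempotents. -/
theorem exists_orthogonal_polynomials {ι : Type*} [Fintype ι] [DecidableEq ι] [Nonempty ι]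
    {A : Type*} [Ring A]
    [Algebra 𝕜 A] {c : ι → 𝕜} (hc : Function.Injective c) {x : A} {K : ℕ} (hK : K ≠ 0)
    (hx : (Polynomial.aeval x (∏ i, (Polynomial.X - Polynomial.C (c i)))) ^ K = 0) :
    ∃ F : ι → Polynomial 𝕜, (∀ i j, (F i).eval (c j) = if i = j then 1 else 0) ∧
      ∑ i, F i = 1 ∧ ∀ i j, i ≠ j → Polynomial.aeval x (F i * F j) = 0 := by
  let S : ι → Polynomial 𝕜 := fun i => (Polynomial.X - Polynomial.C (c i)) ^ K
  -- The `(X - c_i) ^ K` are pairwise coprime, so some combination of the products omitting one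
  -- factor is 1. Its terms are the `F i`.
  obtain ⟨μ, hμ⟩ := (exists_sum_eq_one_iff_pairwise_coprime (s := S)
    (Finset.univ_nonempty (α := ι))).2 (by
      intro i j hij
      exact (Polynomial.pairwise_coprime_X_sub_C hc (fun h => hij (Subtype.ext h))).pow)
  let F : ι → Polynomial 𝕜 := fun i => μ i * ∏ j ∈ Finset.univ \ {i}, S j
  have hdvd : ∀ i j, i ≠ j → S j ∣ F i := fun i j hij =>
    Dvd.dvd.mul_left (Finset.dvd_prod_of_mem S (by simpa using Ne.symm hij)) _
  have heval : ∀ i j, i ≠ j → (F i).eval (c j) = 0 := by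
    intro i j hij
    obtain ⟨q, hq⟩ := hdvd i j hij
    rw [hq, Polynomial.eval_mul]
    simp [S, hK]
  refine ⟨F, fun i j => ?_, hμ, fun i j hij => ?_⟩
  · split_ifs with h
    · subst h
      have h1 := congrArg (Polynomial.eval (c i)) hμ
      rw [Polynomial.eval_finsetSum, Finset.sum_eq_single i, Polynomial.eval_one] at h1
      · exact h1
      · exact fun j _ hj => heval j i hj
      · exact fun h => absurd (Finset.mem_univ i) h
    · exact heval i j h
  -- `F i` misses only the factor with index `i`, which `F j` supplies.
  · have h1 : (∏ k, (Polynomial.X - Polynomial.C (c k))) ^ K ∣ F i * F j := by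
      rw [← Finset.prod_pow, ← Finset.mul_prod_erase Finset.univ _ (Finset.mem_univ i), mul_comm]
      refine mul_dvd_mul ?_ (hdvd j i (Ne.symm hij))
      rw [Finset.erase_eq]
      exact Dvd.intro_left _ rfl
    obtain ⟨q, hq⟩ := h1
    rw [hq, map_mul, map_pow, hx, zero_mul]

end Eigen

/-! ### The action on `V / e V`, and uniqueness of the Jordan type. -/

namespace JordanBasis

variable {𝕜 : Type*} [Field 𝕜] {V : Type*} [AddCommGroup V] [Module 𝕜 V] {e : End 𝕜 V}
  (b : JordanBasis e)

/-- The identification of `V / e V` with `𝕜 ^ n`. -/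
noncomputable def head : V →ₗ[𝕜] (Fin b.n → 𝕜) := LinearMap.pi fun j => b.coeff j 0

@[simp]
theorem head_apply (v : V) (j : Fin b.n) : b.head v j = b.coeff j 0 v := rfl

theorem head_gen (i : Fin b.n) : b.head (b.gen i) = Pi.single i 1 := by
  funext j
  have h := b.coeff_pow_gen j 0 i 0
  rw [pow_zero, Module.End.one_apply] at h
  rw [head_apply, h, Pi.single_apply]
  simp [b.size_pos j, eq_comm]

theorem head_apply_e (v : V) : b.head (e v) = 0 := by
  funext j
  have h := b.coeff_pow_apply j 0 1 v
  rw [pow_one, if_neg (by omega)] at h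
  exact h

theorem exists_eq_of_head_eq_zero {v : V} (h : b.head v = 0) : ∃ u, v = e u := by
  suffices hv : v ∈ LinearMap.range e by
    obtain ⟨u, hu⟩ := hv
    exact ⟨u, hu.symm⟩
  rw [← b.sum_coeff_smul v]
  refine Submodule.sum_mem _ fun p _ => ?_
  by_cases hp : (p.2 : ℕ) = 0
  · have h1 : b.coeff p.1 0 v = 0 := congrFun h p.1
    rw [hp, h1, zero_smul]
    exact Submodule.zero_mem _
  · obtain ⟨k, hk⟩ := Nat.exists_eq_succ_of_ne_zero hp
    rw [hk, pow_succ', Module.End.mul_apply]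
    exact Submodule.smul_mem _ _ ⟨_, rfl⟩

/-- The matrix of an endomorphism that commutes with `e` on `V / e V`. -/
noncomputable def headMatrix : End 𝕜 V →ₗ[𝕜] Matrix (Fin b.n) (Fin b.n) 𝕜 where
  toFun x := Matrix.of fun j i => b.coeff j 0 (x (b.gen i))
  map_add' x y := by ext; simp
  map_smul' c x := by ext; simp

@[simp]
theorem headMatrix_apply (x : End 𝕜 V) (j i : Fin b.n) :
    b.headMatrix x j i = b.coeff j 0 (x (b.gen i)) := rfl

theorem headMatrix_mulVec_head {x : End 𝕜 V} (hx : Commute x e) (v : V) :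
    (b.headMatrix x).mulVec (b.head v) = b.head (x v) := by
  have h : (Matrix.toLin' (b.headMatrix x)) ∘ₗ b.head = b.head ∘ₗ x := by
    refine b.basis.ext fun p => ?_
    rw [b.basis_apply, LinearMap.comp_apply, LinearMap.comp_apply, Matrix.toLin'_apply]
    by_cases hp : (p.2 : ℕ) = 0
    · rw [hp, pow_zero, Module.End.one_apply, head_gen, Matrix.mulVec_single_one]
      rfl
    · obtain ⟨k, hk⟩ := Nat.exists_eq_succ_of_ne_zero hp
      rw [hk, pow_succ', Module.End.mul_apply, head_apply_e, Matrix.mulVec_zero,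
        ← Module.End.mul_apply x, hx.eq, Module.End.mul_apply, head_apply_e]
  rw [← Matrix.toLin'_apply, ← LinearMap.comp_apply, h, LinearMap.comp_apply]

theorem head_surjective : Function.Surjective b.head := by
  intro u
  refine ⟨∑ i, u i • b.gen i, ?_⟩
  simp only [map_sum, map_smul, head_gen]
  exact (pi_eq_sum_univ' u).symm

theorem aeval_head {x : End 𝕜 V} (hx : Commute x e) (q : Polynomial 𝕜) (v : V) :
    Polynomial.aeval (Matrix.toLin' (b.headMatrix x)) q (b.head v) =
      b.head (Polynomial.aeval x q v) := by
  induction q using Polynomial.induction_on' with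
  | add p q hp hq => simp only [map_add, LinearMap.add_apply, hp, hq]
  | monomial k a =>
    have h : ∀ k : ℕ, ((Matrix.toLin' (b.headMatrix x)) ^ k) (b.head v) = b.head ((x ^ k) v) := by
      intro k
      induction k with
      | zero => rfl
      | succ k ih =>
        rw [pow_succ', Module.End.mul_apply, ih, Matrix.toLin'_apply,
          b.headMatrix_mulVec_head hx, pow_succ', Module.End.mul_apply]
    simp only [Polynomial.aeval_monomial, Module.End.mul_apply, h, Module.algebraMap_end_apply,
      map_smul]

theorem finrank_range_pow (k : ℕ) :
    finrank 𝕜 (LinearMap.range (e ^ k)) =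
      (Finset.univ.filter fun p : Σ i, Fin (b.size i) => k ≤ (p.2 : ℕ)).card := by
  have h1 : LinearMap.range (e ^ k) =
      Submodule.span 𝕜 (Set.range fun p : {p : Σ i, Fin (b.size i) // k ≤ (p.2 : ℕ)} =>
        b.basis p) := by
    apply le_antisymm
    · rintro _ ⟨v, rfl⟩
      rw [← b.sum_coeff_smul v, map_sum]
      refine Submodule.sum_mem _ fun p _ => ?_
      rw [map_smul, ← Module.End.mul_apply, ← pow_add, b.pow_gen]
      refine Submodule.smul_mem _ _ ?_
      split_ifs with h
      · exact Submodule.subset_span ⟨⟨⟨p.1, ⟨_, h⟩⟩, Nat.le_add_right _ _⟩, rfl⟩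
      · exact Submodule.zero_mem _
    · rw [Submodule.span_le]
      rintro _ ⟨⟨p, hp⟩, rfl⟩
      refine ⟨(e ^ ((p.2 : ℕ) - k)) (b.gen p.1), ?_⟩
      rw [← Module.End.mul_apply, ← pow_add, Nat.add_sub_cancel' hp, ← b.basis_apply]
  rw [h1]
  exact (finrank_span_eq_card (b.basis.linearIndependent.comp _ Subtype.val_injective)).trans
    (Fintype.card_subtype _)

/-- The rank drop from `e ^ k` to `e ^ (k + 1)` counts the blocks of size greater than `k`, so these
numbers depend on `e` alone. -/
theorem card_lt_size (k : ℕ) :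
    finrank 𝕜 (LinearMap.range (e ^ k)) = finrank 𝕜 (LinearMap.range (e ^ (k + 1))) +
      (Finset.univ.filter fun i => k < b.size i).card := by
  rw [finrank_range_pow, finrank_range_pow, Finset.card_filter, Finset.card_filter,
    Finset.card_filter, Fintype.sum_sigma, Fintype.sum_sigma, ← Finset.sum_add_distrib]
  refine Finset.sum_congr rfl fun i _ => ?_
  have h1 : (if k < b.size i then 1 else 0) =
      ∑ s : Fin (b.size i), if (s : ℕ) = k then 1 else 0 := by
    split_ifs with h
    · rw [Finset.sum_eq_single ⟨k, h⟩]
      · simp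
      · intro s _ hs
        rw [if_neg fun h => hs (Fin.ext h)]
      · exact fun h => absurd (Finset.mem_univ _) h
    · exact (Finset.sum_eq_zero fun s _ => if_neg (by omega)).symm
  rw [h1, ← Finset.sum_add_distrib]
  refine Finset.sum_congr rfl fun s _ => ?_
  change (if k ≤ (s : ℕ) then 1 else 0) = (if k + 1 ≤ (s : ℕ) then 1 else 0) + _
  split_ifs <;> omega

/-- The sizes decrease, so the blocks of size greater than `k` form an initial segment and their
number determines them. -/
theorem lt_size_iff (i : Fin b.n) (k : ℕ) :
    k < b.size i ↔ (i : ℕ) < (Finset.univ.filter fun i => k < b.size i).card := by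
  set T := Finset.univ.filter fun i => k < b.size i with hT
  constructor
  · intro h
    have h1 : Finset.Iic i ⊆ T := fun j hj => by
      rw [hT, Finset.mem_filter]
      exact ⟨Finset.mem_univ _, h.trans_le (b.size_anti (Finset.mem_Iic.1 hj))⟩
    have h2 := Finset.card_le_card h1
    rw [Fin.card_Iic] at h2
    omega
  · intro h
    by_contra hi
    have h1 : T ⊆ Finset.Iio i := fun j hj => by
      rw [hT, Finset.mem_filter] at hj
      rw [Finset.mem_Iio]
      by_contra hij
      exact hi (hj.2.trans_le (b.size_anti (not_lt.1 hij)))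
    have h2 := Finset.card_le_card h1
    rw [Fin.card_Iio] at h2
    omega

/-- The Jordan type of `e` is unique. -/
theorem size_eq_size (b' : JordanBasis e) {i : Fin b.n} {i' : Fin b'.n}
    (h : (i : ℕ) = i') : b.size i = b'.size i' := by
  refine eq_of_forall_lt_iff fun k => ?_
  rw [lt_size_iff, lt_size_iff, h]
  have h1 := b.card_lt_size k
  have h2 := b'.card_lt_size k
  rw [h1] at h2
  rw [Nat.add_left_cancel h2]

end JordanBasis

end CentGen

namespace CentGen

/-! ### Conjugating idempotents to the block projections. -/

namespace JordanBasis

variable {𝕜 : Type*} [Field 𝕜] {V : Type*} [AddCommGroup V] [Module 𝕜 V] {e : End 𝕜 V}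

/-- Applying `e ^ (m - 1 - s)` to a relation isolates its `s`-th coefficient once the lower ones
vanish. For `m = 0` the family is empty, whence the guarded hypothesis. -/
theorem linearIndependent_pow_apply {v : V} {m : ℕ} (h0 : (e ^ m) v = 0)
    (h1 : m ≠ 0 → (e ^ (m - 1)) v ≠ 0) :
    LinearIndependent 𝕜 fun s : Fin m => (e ^ (s : ℕ)) v := by
  rw [Fintype.linearIndependent_iff]
  rintro g hg ⟨s, hs⟩
  have hbig : ∀ t, m ≤ t → (e ^ t) v = 0 := fun t ht => by
    rw [← Nat.sub_add_cancel ht, pow_add, Module.End.mul_apply, h0, map_zero]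
  induction s using Nat.strong_induction_on with
  | _ s ih =>
    have h2 := congrArg (e ^ (m - 1 - s)) hg
    rw [map_zero, map_sum, Finset.sum_eq_single ⟨s, hs⟩, map_smul, ← Module.End.mul_apply,
      ← pow_add] at h2
    · simp only [show m - 1 - s + s = m - 1 by omega] at h2
      exact (smul_eq_zero.1 h2).resolve_right (h1 (by omega))
    · rintro ⟨t, ht⟩ _ hts
      have hts' : t ≠ s := fun h => hts (Fin.ext h)
      rw [map_smul, ← Module.End.mul_apply, ← pow_add]
      rcases lt_or_gt_of_ne hts' with h | h
      · rw [ih t h ht, zero_smul]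
      · rw [hbig _ (by simp only; omega), smul_zero]
    · exact fun h => absurd (Finset.mem_univ _) h

/-- Cyclic vectors of complementary `e`-stable subspaces are, in a suitable order, annihilated by
the same powers of `e` as the generators of the Jordan blocks. -/
theorem exists_perm_pow_size_apply_eq_zero (b : JordanBasis e) (he : IsNilpotent e)
    {v : Fin b.n → V} {f : Fin b.n → End 𝕜 V} (hf : ∀ i, Commute (f i) e)
    (hfv : ∀ i j, f i (v j) = if j = i then v i else 0) (hv : ∀ i, v i ≠ 0)
    (hspan : ∀ S : Submodule 𝕜 V, (∀ i, v i ∈ S) → (∀ u ∈ S, e u ∈ S) → S = ⊤) :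
    ∃ σ : Equiv.Perm (Fin b.n), ∀ i, (e ^ b.size i) (v (σ i)) = 0 := by
  classical
  obtain ⟨K, hK⟩ := he
  have hex : ∀ i, ∃ m, (e ^ m) (v i) = 0 := fun i => ⟨K, by rw [hK, LinearMap.zero_apply]⟩
  let μ : Fin b.n → ℕ := fun i => Nat.find (hex i)
  have hμ : ∀ i, (e ^ μ i) (v i) = 0 := fun i => Nat.find_spec (hex i)
  have hμpos : ∀ i, 0 < μ i := fun i => by
    by_contra h
    have h1 := hμ i
    rw [Nat.eq_zero_of_not_pos h] at h1
    exact hv i h1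
  have hμmin : ∀ i, (e ^ (μ i - 1)) (v i) ≠ 0 := fun i =>
    Nat.find_min (hex i) (Nat.sub_one_lt_of_lt (hμpos i))
  -- Sorting in the dual order makes the exact annihilation orders `μ` decreasing, as a Jordan basis
  -- demands.
  let σ : Equiv.Perm (Fin b.n) := Tuple.sort (OrderDual.toDual ∘ μ)
  have hσ : Antitone fun i => μ (σ i) := fun i j hij =>
    Tuple.monotone_sort (OrderDual.toDual ∘ μ) hij
  have hli : LinearIndependent 𝕜 fun p : Σ i, Fin (μ (σ i)) => (e ^ (p.2 : ℕ)) (v (σ p.1)) := by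
    rw [Fintype.linearIndependent_iff]
    rintro g hg ⟨i, s⟩
    -- `f (σ i)` leaves only the part of the relation in the cyclic subspace of `v (σ i)`.
    have h1 := congrArg (f (σ i)) hg
    rw [Fintype.sum_sigma, map_zero, map_sum, Finset.sum_eq_single i, map_sum] at h1
    · refine Fintype.linearIndependent_iff.1 (linearIndependent_pow_apply (hμ (σ i))
        fun _ => hμmin (σ i)) (fun s => g ⟨i, s⟩) ?_ s
      rw [← h1]
      refine Finset.sum_congr rfl fun s _ => ?_
      rw [map_smul, ← Module.End.mul_apply, ((hf _).pow_right _).eq, Module.End.mul_apply, hfv,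
        if_pos rfl]
    · intro j _ hj
      rw [map_sum]
      refine Finset.sum_eq_zero fun s _ => ?_
      rw [map_smul, ← Module.End.mul_apply, ((hf _).pow_right _).eq, Module.End.mul_apply, hfv,
        if_neg fun h => hj (σ.injective h), map_zero, smul_zero]
    · exact fun h => absurd (Finset.mem_univ _) h
  have htop : ⊤ ≤ Submodule.span 𝕜
      (Set.range fun p : Σ i, Fin (μ (σ i)) => (e ^ (p.2 : ℕ)) (v (σ p.1))) := by
    set S := Submodule.span 𝕜
      (Set.range fun p : Σ i, Fin (μ (σ i)) => (e ^ (p.2 : ℕ)) (v (σ p.1))) with hS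
    have hmem : ∀ i s, (e ^ s) (v (σ i)) ∈ S := by
      intro i s
      by_cases hs : s < μ (σ i)
      · exact Submodule.subset_span ⟨⟨i, ⟨s, hs⟩⟩, rfl⟩
      · rw [← Nat.sub_add_cancel (not_lt.1 hs), pow_add, Module.End.mul_apply, hμ, map_zero]
        exact S.zero_mem
    refine (hspan S (fun i => ?_) fun u hu => ?_).ge
    · simpa using hmem (σ.symm i) 0
    · have h1 : S ≤ S.comap e := by
        conv_lhs => rw [hS]
        rw [Submodule.span_le]
        rintro _ ⟨p, rfl⟩
        change e ((e ^ (p.2 : ℕ)) (v (σ p.1))) ∈ S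
        rw [← Module.End.mul_apply, ← pow_succ']
        exact hmem _ _
      exact h1 hu
  -- The cyclic vectors are the generators of a second Jordan basis; its sizes must agree with those
  -- of `b`.
  let b' : JordanBasis e :=
    { n := b.n
      size := fun i => μ (σ i)
      size_pos := fun i => hμpos _
      size_anti := hσ
      gen := fun i => v (σ i)
      pow_size := fun i => hμ _
      basis := Basis.mk hli htop
      basis_apply := fun p => Basis.mk_apply hli htop p }
  refine ⟨σ, fun i => ?_⟩
  rw [b.size_eq_size b' (i := i) (i' := i) rfl]
  exact hμ (σ i)

/-- The assignment `w_i ↦ v_i` extends to an endomorphism commuting with `e` because `e ^ λ_i` kills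
`v_i`. It is surjective as the `v_i` generate, hence invertible. -/
theorem exists_gCent_gen [FiniteDimensional 𝕜 V] (b : JordanBasis e) {v : Fin b.n → V}
    (hv : ∀ i, (e ^ b.size i) (v i) = 0)
    (hspan : ∀ S : Submodule 𝕜 V, (∀ i, v i ∈ S) → (∀ u ∈ S, e u ∈ S) → S = ⊤) :
    ∃ g : GCent e, ∀ i, (g.1 : End 𝕜 V) (b.gen i) = v i := by
  let g : End 𝕜 V := b.basis.constr 𝕜 fun p => (e ^ (p.2 : ℕ)) (v p.1)
  have hg : ∀ i s, g ((e ^ s) (b.gen i)) = (e ^ s) (v i) := by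
    intro i s
    rw [b.pow_gen]
    split_ifs with h
    · rw [b.basis.constr_basis]
    · rw [map_zero, ← Nat.sub_add_cancel (not_lt.1 h), pow_add, Module.End.mul_apply, hv,
        map_zero]
  have hgi : ∀ i, g (b.gen i) = v i := fun i => by simpa using hg i 0
  have hge : g * e = e * g := by
    refine b.basis.ext fun p => ?_
    rw [b.basis_apply, Module.End.mul_apply, Module.End.mul_apply, ← Module.End.mul_apply e,
      ← pow_succ', hg, hg, pow_succ', Module.End.mul_apply]
  have hsurj : LinearMap.range g = ⊤ := by
    refine hspan _ (fun i => ⟨_, hgi i⟩) ?_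
    rintro _ ⟨u, rfl⟩
    exact ⟨e u, LinearMap.congr_fun hge u⟩
  have hunit : IsUnit g := (Module.End.isUnit_iff g).2
    ⟨LinearMap.injective_iff_surjective.2 (LinearMap.range_eq_top.1 hsurj),
      LinearMap.range_eq_top.1 hsurj⟩
  obtain ⟨γ, hγ⟩ := hunit
  exact ⟨⟨γ, mem_GCent.2 (by rw [hγ]; exact hge)⟩, fun i => by
    change (γ : End 𝕜 V) _ = _
    rw [hγ, hgi]⟩

/-- Nakayama's lemma: vectors that span `V / e V` generate `V`. -/
theorem eq_top_of_head (b : JordanBasis e) (he : IsNilpotent e) {v : Fin b.n → V}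
    (hv : LinearIndependent 𝕜 fun i => b.head (v i)) (S : Submodule 𝕜 V) (hvS : ∀ i, v i ∈ S)
    (heS : ∀ u ∈ S, e u ∈ S) : S = ⊤ := by
  have htop := hv.span_eq_top_of_card_eq_finrank' (by simp)
  have h1 : ∀ u, ∃ s ∈ S, ∃ u', u = s + e u' := by
    intro u
    have hu : b.head u ∈ Submodule.span 𝕜 (Set.range fun i => b.head (v i)) :=
      htop ▸ Submodule.mem_top
    obtain ⟨c, hc⟩ := (Submodule.mem_span_range_iff_exists_fun 𝕜).1 hu
    obtain ⟨u', hu'⟩ := b.exists_eq_of_head_eq_zero (v := u - ∑ i, c i • v i) (by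
      rw [map_sub, map_sum, sub_eq_zero, ← hc]
      simp only [map_smul])
    exact ⟨∑ i, c i • v i, S.sum_mem fun i _ => S.smul_mem _ (hvS i), u', by rw [← hu']; abel⟩
  -- Iterating `V = S + e V` gives `V = S + e ^ k V`, and `e` is nilpotent.
  have h2 : ∀ k u, ∃ s ∈ S, ∃ u', u = s + (e ^ k) u' := by
    intro k
    induction k with
    | zero => exact fun u => ⟨0, S.zero_mem, u, by simp⟩
    | succ k ih =>
      intro u
      obtain ⟨s, hs, u', hu'⟩ := h1 u
      obtain ⟨t, ht, u'', hu''⟩ := ih u'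
      refine ⟨s + e t, S.add_mem hs (heS t ht), u'', ?_⟩
      rw [hu', hu'', map_add, pow_succ', Module.End.mul_apply, add_assoc]
  obtain ⟨K, hK⟩ := he
  rw [eq_top_iff]
  intro u _
  obtain ⟨s, hs, u', hu'⟩ := h2 K u
  rw [hu', hK, LinearMap.zero_apply, add_zero]
  exact hs

/-- Since `y V ⊆ e V` and `y` commutes with `e`, also `y ^ k V ⊆ e ^ k V`. -/
theorem isNilpotent_of_head_eq_zero (b : JordanBasis e) (he : IsNilpotent e) {y : End 𝕜 V}
    (hy : Commute y e) (h : ∀ v, b.head (y v) = 0) : ∃ K, K ≠ 0 ∧ y ^ K = 0 := by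
  have h1 : ∀ k v, ∃ u, (y ^ k) v = (e ^ k) u := by
    intro k
    induction k with
    | zero => exact fun v => ⟨v, rfl⟩
    | succ k ih =>
      intro v
      obtain ⟨u, hu⟩ := ih v
      obtain ⟨u', hu'⟩ := b.exists_eq_of_head_eq_zero (h u)
      refine ⟨u', ?_⟩
      rw [pow_succ', Module.End.mul_apply, hu, ← Module.End.mul_apply, (hy.pow_right k).eq,
        Module.End.mul_apply, hu', pow_succ, Module.End.mul_apply]
  obtain ⟨K, hK⟩ := he
  refine ⟨K + 1, Nat.succ_ne_zero K, ?_⟩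
  ext v
  obtain ⟨u, hu⟩ := h1 (K + 1) v
  rw [hu, pow_succ, hK, zero_mul, LinearMap.zero_apply, LinearMap.zero_apply]

/-- If `x` commutes with `e` and has distinct eigenvalues on `V / e V`, then the algebra generated
by `x` contains a conjugate of the system of block projections under the centraliser of `e`. -/
theorem exists_conj_blockProj_mem_adjoin [IsAlgClosed 𝕜] [FiniteDimensional 𝕜 V]
    (b : JordanBasis e) (he : IsNilpotent e) {x : End 𝕜 V} (hx : Commute x e)
    (hdet : (Polynomial.aeval (b.headMatrix x) (b.headMatrix x).charpoly.derivative).det ≠ 0) :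
    ∃ g : GCent e, ∀ i, (g.1 : End 𝕜 V) * b.blockProj i *
      ((g.1⁻¹ : LinearMap.GeneralLinearGroup 𝕜 V) : End 𝕜 V) ∈ Algebra.adjoin 𝕜 {x} := by
  rcases isEmpty_or_nonempty (Fin b.n) with hn | hn
  · exact ⟨1, fun i => hn.elim i⟩
  obtain ⟨c, u, hc, hu, hcu⟩ := exists_eigenbasis (b.headMatrix x) hdet
  have hcomm : ∀ q : Polynomial 𝕜, Commute (Polynomial.aeval x q) e := fun q =>
    Algebra.commute_of_mem_adjoin_singleton_of_commute (Polynomial.aeval_mem_adjoin_singleton 𝕜 x)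
      hx.symm |>.symm
  choose u' hu' using fun i => b.head_surjective (u i)
  have hu0 : ∀ i, u i ≠ 0 := fun i => hu.ne_zero i
  have heig : ∀ i, End.HasEigenvector (Matrix.toLin' (b.headMatrix x)) (c i) (u i) := fun i =>
    ⟨End.mem_eigenspace_iff.2 (by rw [Matrix.toLin'_apply, hcu]), hu0 i⟩
  have haev : ∀ (q : Polynomial 𝕜) i, b.head (Polynomial.aeval x q (u' i)) = q.eval (c i) • u i :=
    fun q i => by
      rw [← b.aeval_head hx, hu', End.aeval_apply_of_hasEigenvector (heig i)]
  -- the product of the `x - c_i` is nilpotent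
  have htop := hu.span_eq_top_of_card_eq_finrank' (by simp)
  obtain ⟨K, hK0, hK⟩ := b.isNilpotent_of_head_eq_zero he
    (hcomm (∏ i, (Polynomial.X - Polynomial.C (c i)))) (by
      intro v
      rw [← b.aeval_head hx]
      have h1 : Polynomial.aeval (Matrix.toLin' (b.headMatrix x))
          (∏ i, (Polynomial.X - Polynomial.C (c i))) = 0 := by
        refine LinearMap.ext_on htop ?_
        rintro _ ⟨i, rfl⟩
        rw [End.aeval_apply_of_hasEigenvector (heig i), Polynomial.eval_prod,
          Finset.prod_eq_zero (Finset.mem_univ i) (by simp), zero_smul, LinearMap.zero_apply]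
      rw [h1, LinearMap.zero_apply])
  obtain ⟨F, hF1, hF2, hF3⟩ := exists_orthogonal_polynomials hc hK0 hK
  -- These are orthogonal idempotents with sum 1; on `V / e V` they are the projections to the
  -- eigenlines.
  let f : Fin b.n → End 𝕜 V := fun i => Polynomial.aeval x (F i)
  have hfi : ∀ i, f i * f i = f i := by
    intro i
    have h1 : f i * ∑ j, f j = f i := by
      rw [← map_sum, hF2, map_one, mul_one]
    rw [Finset.mul_sum, Finset.sum_eq_single i] at h1
    · exact h1
    · intro j _ hj
      rw [← map_mul]
      exact hF3 i j (Ne.symm hj)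
    · exact fun h => absurd (Finset.mem_univ _) h
  -- `v i` lifts the eigenvector `u i` and lies in the range of `f i`. By Nakayama the `v i`
  -- generate `V`.
  let v : Fin b.n → V := fun i => f i (u' i)
  have hheadv : ∀ i, b.head (v i) = u i := fun i => by
    rw [haev, hF1, if_pos rfl, one_smul]
  have hfv : ∀ i j, f i (v j) = if j = i then v i else 0 := by
    intro i j
    change f i (f j (u' j)) = _
    rw [← Module.End.mul_apply]
    split_ifs with h
    · subst h
      rw [hfi]
    · rw [← map_mul, hF3 i j (Ne.symm h), LinearMap.zero_apply]
  have hspan := b.eq_top_of_head he (v := v) (by simpa only [hheadv] using hu)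
  obtain ⟨σ, hσ⟩ := b.exists_perm_pow_size_apply_eq_zero he (fun i => hcomm (F i)) hfv
    (fun i h => hu0 i (by rw [← hheadv, h, map_zero])) hspan
  obtain ⟨g, hg⟩ := b.exists_gCent_gen hσ fun S hS => hspan S fun i => by
    simpa using hS (σ.symm i)
  refine ⟨g, fun i => ?_⟩
  have hge : Commute (g.1 : End 𝕜 V) e := mem_GCent.1 g.2
  -- As `g` sends `w_i` to `v (σ i)`, it conjugates the block projection to `f (σ i)`, a polynomial
  -- in `x`.
  have h1 : (g.1 : End 𝕜 V) * b.blockProj i = f (σ i) * g.1 := by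
    refine b.ext_gen (hge.mul_left (b.commute_blockProj i)) ((hcomm _).mul_left hge) fun k => ?_
    rw [Module.End.mul_apply, Module.End.mul_apply, hg, hfv, blockProj_gen]
    by_cases hk : k = i
    · subst hk
      rw [if_pos rfl, if_pos rfl, hg]
    · rw [if_neg hk, if_neg fun h => hk (σ.injective h), map_zero]
  rw [h1, mul_assoc, Units.mul_inv, mul_one]
  exact Polynomial.aeval_mem_adjoin_singleton 𝕜 x

end JordanBasis

end CentGen

namespace CentGen

/-! ### A polynomial condition for distinct eigenvalues. -/

section Discriminant

variable {𝕜 : Type*} [Field 𝕜] {W : Type*} [AddCommGroup W] [Module 𝕜 W]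

/-- `det χ' (X)` plays the part of the discriminant. It is formed once over the ring of polynomial
functions and then specialised by `evalHom`. -/
theorem IsPolyMap.det_aeval_charpoly_derivative {n : ℕ} {X : W → Matrix (Fin n) (Fin n) 𝕜}
    (hX : IsPolyMap 𝕜 X) :
    (fun w => (Polynomial.aeval (X w) (X w).charpoly.derivative).det) ∈ polyFun 𝕜 W := by
  let Y : Matrix (Fin n) (Fin n) (polyFun 𝕜 W) := fun i j =>
    ⟨fun w => X w i j, hX (Matrix.entryLinearMap 𝕜 𝕜 i j)⟩
  have h : (fun w => (Polynomial.aeval (X w) (X w).charpoly.derivative).det) =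
      (Polynomial.aeval Y Y.charpoly.derivative).det.1 := by
    funext w
    let φ : polyFun 𝕜 W →+* 𝕜 := (evalHom w : polyFun 𝕜 W →ₐ[𝕜] 𝕜)
    have hY : X w = φ.mapMatrix Y := rfl
    change _ = φ (Polynomial.aeval Y Y.charpoly.derivative).det
    rw [RingHom.map_det, Polynomial.map_aeval_eq_aeval_map (φ := φ), hY, ← Polynomial.derivative_map,
      RingHom.mapMatrix_apply, Matrix.charpoly_map]
    ext r i j
    simp [Matrix.algebraMap_matrix_apply, apply_ite φ]
  rw [h]
  exact Subtype.property _

/-- The determinant is the product of the `χ' (c_i)`, which are nonzero because `χ` is separable. -/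
theorem det_aeval_charpoly_derivative_diagonal_ne_zero {n : ℕ} {c : Fin n → 𝕜}
    (hc : Function.Injective c) : (Polynomial.aeval (Matrix.diagonal c)
      (Matrix.diagonal c).charpoly.derivative).det ≠ 0 := by
  have h1 : ∀ p : Polynomial 𝕜, Polynomial.aeval (Matrix.diagonal c) p =
      Matrix.diagonal fun i => p.eval (c i) := by
    intro p
    have h2 := Polynomial.aeval_algHom_apply (Matrix.diagonalAlgHom (n := Fin n) (α := 𝕜) 𝕜) c p
    rw [Matrix.diagonalAlgHom_apply, Matrix.diagonalAlgHom_apply] at h2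
    rw [h2]
    congr 1
    funext i
    have h3 := Polynomial.aeval_algHom_apply (Pi.evalAlgHom 𝕜 (fun _ : Fin n => 𝕜) i) c p
    exact h3.symm
  rw [h1, Matrix.det_diagonal, Finset.prod_ne_zero_iff]
  intro i _
  rw [Matrix.charpoly_diagonal]
  have hsep : (∏ i, (Polynomial.X - Polynomial.C (c i))).Separable :=
    Polynomial.separable_prod_X_sub_C_iff.2 hc
  have := hsep.eval₂_derivative_ne_zero (RingHom.id 𝕜) (x := c i) (by
    rw [Polynomial.eval₂_id, Polynomial.eval_prod]
    exact Finset.prod_eq_zero (Finset.mem_univ i) (by simp))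
  rwa [Polynomial.eval₂_id] at this

end Discriminant

/-! ### Conjugacy of stabilisers near `α`, and genericity for `G_e`. -/

namespace JordanBasis

variable {𝕜 : Type*} [Field 𝕜] {V : Type*} [AddCommGroup V] [Module 𝕜 V] {e : End 𝕜 V}
  (b : JordanBasis e)

/-- The endomorphism that acts on the `i`-th Jordan block as the scalar `c i`. -/
noncomputable def diagElt (c : Fin b.n → 𝕜) : End 𝕜 V := ∑ i, c i • b.blockProj i

theorem diagElt_mem_diag (c : Fin b.n → 𝕜) : b.diagElt c ∈ b.diag :=
  b.diag.sum_mem fun i _ => b.diag.smul_mem (b.blockProj_mem_diag i) _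

theorem diagElt_gen (c : Fin b.n → 𝕜) (i : Fin b.n) : b.diagElt c (b.gen i) = c i • b.gen i := by
  simp [diagElt, LinearMap.sum_apply, blockProj_gen]

theorem headMatrix_diagElt (c : Fin b.n → 𝕜) :
    b.headMatrix (b.diagElt c) = Matrix.diagonal c := by
  ext j i
  have h := congrFun (b.head_gen i) j
  rw [head_apply] at h
  rw [headMatrix_apply, diagElt_gen, map_smul, h, Matrix.diagonal_apply, Pi.single_apply]
  by_cases hij : j = i
  · subst hij
    simp
  · simp [hij]

/-- The conjugate of the diagonal algebra by an element of the centraliser. -/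
theorem mem_symStab_iff_conj_mem_diag [Infinite 𝕜] [FiniteDimensional 𝕜 V]
    {M : Dual 𝕜 (End 𝕜 V)} {g : GCent e}
    (hdim : finrank 𝕜 (symStab e M) ≤ finrank 𝕜 b.diag)
    (hg : ∀ i, (g.1 : End 𝕜 V) * b.blockProj i *
      ((g.1⁻¹ : LinearMap.GeneralLinearGroup 𝕜 V) : End 𝕜 V) ∈ symStab e M) (x : End 𝕜 V) :
    x ∈ symStab e M ↔
      ((g.1⁻¹ : LinearMap.GeneralLinearGroup 𝕜 V) : End 𝕜 V) * x * g.1 ∈ b.diag := by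
  set γ : End 𝕜 V := g.1.val with hγ
  set γ' : End 𝕜 V := ((g.1⁻¹ : LinearMap.GeneralLinearGroup 𝕜 V) : End 𝕜 V) with hγ'
  have h1 : γ * γ' = 1 := Units.mul_inv _
  have h2 : γ' * γ = 1 := Units.inv_mul _
  have hγe : Commute γ e := mem_GCent.1 g.2
  have hγe' : Commute γ' e := mem_GCent.1 (inv_mem g.2)
  let conj : End 𝕜 V →ₗ[𝕜] End 𝕜 V :=
    LinearMap.mulLeft 𝕜 γ ∘ₗ LinearMap.mulRight 𝕜 γ'
  have hconj : ∀ z, conj z = γ * (z * γ') := fun z => rfl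
  have hmul : ∀ y z, conj y * conj z = conj (y * z) := by
    intro y z
    simp only [hconj]
    calc γ * (y * γ') * (γ * (z * γ')) = γ * y * (γ' * γ) * z * γ' := by simp only [mul_assoc]
      _ = γ * (y * z * γ') := by rw [h2]; simp only [mul_assoc, mul_one]
  have hce : ∀ z, Commute z e → Commute (conj z) e := fun z hz =>
    hγe.mul_left (hz.mul_left hγe')
  have hback : ∀ z, conj (γ' * z * γ) = z := by
    intro z
    rw [hconj]
    calc γ * (γ' * z * γ * γ') = (γ * γ') * z * (γ * γ') := by simp only [mul_assoc]
      _ = z := by rw [h1, one_mul, mul_one]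
  have hback' : ∀ z, γ' * conj z * γ = z := by
    intro z
    rw [hconj]
    calc γ' * (γ * (z * γ')) * γ = (γ' * γ) * z * (γ' * γ) := by simp only [mul_assoc]
      _ = z := by rw [h2, one_mul, mul_one]
  -- Conjugation carries the stabiliser of `N` to that of `M`, so the stabiliser of `N` contains the
  -- block projections themselves and `diag_eq_symStab` applies.
  let N : Dual 𝕜 (End 𝕜 V) := M ∘ₗ conj
  have hN : ∀ z, N z = M (conj z) := fun z => rfl
  have hmem : ∀ z, z ∈ symStab e N ↔ conj z ∈ symStab e M := by
    intro z
    constructor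
    · rintro ⟨hz, hz'⟩
      refine ⟨hce z hz, fun y hy => ?_⟩
      have h3 := hz' (γ' * y * γ) ((hγe'.mul_left hy).mul_left hγe)
      rw [hN, hN, ← hmul z, ← hmul _ z, hback] at h3
      exact h3
    · rintro ⟨hz, hz'⟩
      refine ⟨?_, fun y hy => ?_⟩
      · rw [← hback' z]
        exact (hγe'.mul_left hz).mul_left hγe
      · rw [hN, hN, ← hmul, ← hmul]
        exact hz' _ (hce y hy)
  have hle : finrank 𝕜 (symStab e N) ≤ finrank 𝕜 (symStab e M) := by
    let f : (symStab e N).toSubmodule →ₗ[𝕜] (symStab e M).toSubmodule :=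
      (conj ∘ₗ (symStab e N).toSubmodule.subtype).codRestrict (symStab e M).toSubmodule
        fun z => (hmem z.1).1 z.2
    refine LinearMap.finrank_le_finrank_of_injective (f := f) fun y z hyz => ?_
    have h3 : conj y.1 = conj z.1 := congrArg Subtype.val hyz
    exact Subtype.ext (by rw [← hback' y.1, h3, hback'])
  have hdiag : b.diag = symStab e N := b.diag_eq_symStab (fun i => by
    rw [hmem, hconj, ← mul_assoc]
    exact hg i) (hle.trans hdim)
  rw [hdiag, hmem, hback]

section Family

variable [IsAlgClosed 𝕜] [FiniteDimensional 𝕜 V] {a : Fin b.n → 𝕜}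
  {W : Type*} [AddCommGroup W] [Module 𝕜 W] (ι : W →ₗ[𝕜] Dual 𝕜 (gCent e)) {w₀ : W}

/-- In a linear family of forms on `𝔤_e` which contains `α`, the elements of the stabiliser of `α`
extend locally to polynomial sections of the stabilisers. -/
theorem exists_symStab_section (ha : Function.Injective a)
    (ha0 : ∀ i j, b.size j < b.size i → a i ≠ 0) (hw₀ : ι w₀ = b.alpha a) {u : End 𝕜 V}
    (hu : u ∈ b.diag) :
    ∃ δ ∈ polyFun 𝕜 W, ∃ x : W → End 𝕜 V, IsPolyMap 𝕜 x ∧ δ w₀ ≠ 0 ∧ x w₀ = u ∧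
      ∀ w, δ w ≠ 0 → ∀ M : Dual 𝕜 (End 𝕜 V), (∀ y : gCent e, M y = ι w y) →
        x w ∈ symStab e M := by
  have : Infinite 𝕜 := IsAlgClosed.instInfinite
  let C : W →ₗ[𝕜] gCent e →ₗ[𝕜] Dual 𝕜 (gCent e) := orbitMap ∘ₗ ι
  have hC : ∀ w, LinearMap.ker (C w) = lieStab 𝕜 (gCent e) (ι w) := fun w => ker_orbitMap _
  have hα : ∀ y : gCent e, b.alphaEnd a y = ι w₀ y := fun y => by rw [hw₀, alphaEnd_coe]
  have hue : u ∈ gCent e := mem_gCent.2 (b.mem_diag.1 hu).1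
  have hu0 : C w₀ ⟨u, hue⟩ = 0 := by
    have h1 : (⟨u, hue⟩ : gCent e) ∈ lieStab 𝕜 (gCent e) (ι w₀) := by
      rw [mem_lieStab_iff_symStab hα, b.symStab_alphaEnd ha ha0]
      exact hu
    rw [← hC] at h1
    exact h1
  -- The kernel at `w₀` has dimension `dim V`, the lower bound for all stabilisers, hence it is
  -- minimal.
  obtain ⟨δ, hδ, x, hx, h1, h2, h3⟩ := exists_ker_section C w₀ (fun w => by
    rw [hC, hC, finrank_lieStab_eq hα, b.finrank_symStab_alphaEnd ha ha0]
    exact finrank_le_finrank_lieStab _) ⟨u, hue⟩ hu0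
  refine ⟨δ, hδ, fun w => x w, hx.linear_comp (gCent e).toSubmodule.subtype, h1, ?_,
    fun w hw M hM => ?_⟩
  · change ((x w₀ : gCent e) : End 𝕜 V) = u
    rw [h2]
  · rw [← mem_lieStab_iff_symStab hM, ← hC]
    exact h3 w hw

/-- In a linear family of forms on `𝔤_e` which contains `α`, the stabilisers are conjugate to that
of `α` near `α`. -/
theorem exists_conj_symStab (he : IsNilpotent e) (ha : Function.Injective a)
    (ha0 : ∀ i j, b.size j < b.size i → a i ≠ 0) (hw₀ : ι w₀ = b.alpha a) :
    ∃ δ ∈ polyFun 𝕜 W, δ w₀ ≠ 0 ∧ ∀ w, δ w ≠ 0 → ∀ M : Dual 𝕜 (End 𝕜 V),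
      (∀ y : gCent e, M y = ι w y) → ∃ g : GCent e, ∀ x : End 𝕜 V, x ∈ symStab e M ↔
        ((g.1⁻¹ : LinearMap.GeneralLinearGroup 𝕜 V) : End 𝕜 V) * x * g.1 ∈ b.diag := by
  have : Infinite 𝕜 := IsAlgClosed.instInfinite
  have hα : ∀ y : gCent e, b.alphaEnd a y = ι w₀ y := fun y => by rw [hw₀, alphaEnd_coe]
  let C : W →ₗ[𝕜] gCent e →ₗ[𝕜] Dual 𝕜 (gCent e) := orbitMap ∘ₗ ι
  have hC : ∀ w, LinearMap.ker (C w) = lieStab 𝕜 (gCent e) (ι w) := fun w => ker_orbitMap _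
  obtain ⟨δ₁, hδ₁, h₁, hle⟩ := exists_finrank_ker_le C w₀
  -- Distinct block scalars make `diagElt c` an element of the stabiliser of `α` with distinct
  -- eigenvalues on `V / e V`.
  let c : Fin b.n → 𝕜 := fun i => Infinite.natEmbedding 𝕜 i
  have hc : Function.Injective c := fun i j h =>
    Fin.ext ((Infinite.natEmbedding 𝕜).injective h)
  obtain ⟨δ₂, hδ₂, x, hx, h₂, hxw₀, hxmem⟩ :=
    b.exists_symStab_section ι ha ha0 hw₀ (b.diagElt_mem_diag c)
  have hδ₃ := (hx.linear_comp b.headMatrix).det_aeval_charpoly_derivative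
  -- The three factors bound the dimension of the stabiliser, keep the section inside it, and keep
  -- its eigenvalues on `V / e V` distinct.
  refine ⟨_, (polyFun 𝕜 W).mul_mem ((polyFun 𝕜 W).mul_mem hδ₁ hδ₂) hδ₃, ?_, fun w hw M hM => ?_⟩
  · refine mul_ne_zero (mul_ne_zero h₁ h₂) ?_
    change (Polynomial.aeval (b.headMatrix (x w₀)) (b.headMatrix (x w₀)).charpoly.derivative).det ≠ 0
    rw [hxw₀, headMatrix_diagElt]
    exact det_aeval_charpoly_derivative_diagonal_ne_zero hc
  · have hw₃ := right_ne_zero_of_mul hw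
    have hw₁ := left_ne_zero_of_mul (left_ne_zero_of_mul hw)
    have hw₂ := right_ne_zero_of_mul (left_ne_zero_of_mul hw)
    have hxM := hxmem w hw₂ M hM
    obtain ⟨g, hg⟩ := b.exists_conj_blockProj_mem_adjoin he (mem_symStab.1 hxM).1 hw₃
    refine ⟨g, b.mem_symStab_iff_conj_mem_diag ?_ fun i => ?_⟩
    · have h4 := hle w hw₁
      rwa [hC, hC, finrank_lieStab_eq hM, finrank_lieStab_eq hα, b.symStab_alphaEnd ha ha0] at h4
    · exact Algebra.adjoin_le (S := symStab e M) (by simpa using hxM) (hg i)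

end Family

/-- `α` is a generic point for the coadjoint action of `G_e`. -/
theorem isGenericPoint_alpha [IsAlgClosed 𝕜] [FiniteDimensional 𝕜 V] {a : Fin b.n → 𝕜}
    (he : IsNilpotent e) (ha : Function.Injective a)
    (ha0 : ∀ i j, b.size j < b.size i → a i ≠ 0) : IsGenericPoint 𝕜 (AdG e) (b.alpha a) := by
  have : Infinite 𝕜 := IsAlgClosed.instInfinite
  obtain ⟨δ, hδ, h1, h2⟩ := b.exists_conj_symStab (w₀ := b.alpha a) LinearMap.id he ha ha0 rfl
  refine ⟨_, isZariskiOpen_ne hδ, ⟨_, h1⟩, fun β hβ => ?_⟩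
  obtain ⟨M, hM⟩ := exists_extend_gCent β
  obtain ⟨g, hg⟩ := h2 β hβ M hM
  refine ⟨g, ?_⟩
  have key : ∀ x : gCent e, x ∈ lieStab 𝕜 (gCent e) β ↔
      AdG e g⁻¹ x ∈ lieStab 𝕜 (gCent e) (b.alpha a) := by
    intro x
    rw [mem_lieStab_iff_symStab hM, hg, mem_lieStab_iff_symStab (b.alphaEnd_coe a),
      b.symStab_alphaEnd ha ha0]
    have h3 : ((AdG e g⁻¹ x : gCent e) : End 𝕜 V) =
        ((g.1⁻¹ : LinearMap.GeneralLinearGroup 𝕜 V) : End 𝕜 V) * x * g.1 := by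
      change ((g⁻¹).1 : End 𝕜 V) * x.1 *
        (((g⁻¹).1⁻¹ : LinearMap.GeneralLinearGroup 𝕜 V) : End 𝕜 V) = _
      simp
    rw [h3]
  ext x
  rw [key]
  constructor
  · rintro ⟨y, hy, rfl⟩
    rw [← Module.End.mul_apply, ← map_mul, inv_mul_cancel, map_one, Module.End.one_apply]
    exact hy
  · intro hx
    refine ⟨_, hx, ?_⟩
    rw [← Module.End.mul_apply, ← map_mul, mul_inv_cancel, map_one, Module.End.one_apply]

end JordanBasis

end CentGen

namespace CentGen

/-! ### Adjoints for a nondegenerate form. -/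

section Adjoint

variable {𝕜 : Type*} [Field 𝕜] {V : Type*} [AddCommGroup V] [Module 𝕜 V]
  [FiniteDimensional 𝕜 V] {B : LinearMap.BilinForm 𝕜 V} (hB : B.Nondegenerate)

include hB in
omit [FiniteDimensional 𝕜 V] in
theorem ext_bilin {x y : End 𝕜 V} (h : ∀ u v, B (x u) v = B (y u) v) : x = y := by
  ext u
  refine sub_eq_zero.1 (hB.1 _ fun v => ?_)
  rw [map_sub, LinearMap.sub_apply, h, sub_self]

/-- The adjoint of an endomorphism for a nondegenerate bilinear form. -/
noncomputable def adj : End 𝕜 V →ₗ[𝕜] End 𝕜 V where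
  toFun x := B.leftAdjointOfNondegenerate hB x
  map_add' x y := ext_bilin hB fun u v => by
    rw [B.isAdjointPairLeftAdjointOfNondegenerate hB (x + y) u v, LinearMap.add_apply, map_add,
      LinearMap.add_apply, map_add, LinearMap.add_apply,
      B.isAdjointPairLeftAdjointOfNondegenerate hB x u v,
      B.isAdjointPairLeftAdjointOfNondegenerate hB y u v]
  map_smul' c x := ext_bilin hB fun u v => by
    rw [B.isAdjointPairLeftAdjointOfNondegenerate hB (c • x) u v]
    have h := B.isAdjointPairLeftAdjointOfNondegenerate hB x u v
    simp only [LinearMap.smul_apply, map_smul, RingHom.id_apply, h]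

theorem adj_left (x : End 𝕜 V) (u v : V) : B (adj hB x u) v = B u (x v) :=
  B.isAdjointPairLeftAdjointOfNondegenerate hB x u v

theorem adj_eq {x y : End 𝕜 V} (h : ∀ u v, B (y u) v = B u (x v)) : adj hB x = y :=
  ext_bilin hB fun u v => by rw [adj_left, h]

@[simp]
theorem adj_one : adj hB 1 = 1 := adj_eq hB fun _ _ => rfl

theorem adj_mul (x y : End 𝕜 V) : adj hB (x * y) = adj hB y * adj hB x :=
  adj_eq hB fun u v => by
    rw [Module.End.mul_apply, Module.End.mul_apply, adj_left, adj_left]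

theorem adj_pow (x : End 𝕜 V) (k : ℕ) : adj hB (x ^ k) = adj hB x ^ k := by
  induction k with
  | zero => simp
  | succ k ih => rw [pow_succ', adj_mul, ih, pow_succ]

variable {ε : 𝕜} (hε : ε * ε = 1) (hsym : ∀ u v, B u v = ε * B v u)

include hε hsym

theorem adj_right (x : End 𝕜 V) (u v : V) : B u (adj hB x v) = B (x u) v := by
  rw [hsym, adj_left, hsym v, ← mul_assoc, hε, one_mul]

@[simp]
theorem adj_adj (x : End 𝕜 V) : adj hB (adj hB x) = x :=
  adj_eq hB fun u v => (adj_right hB hε hsym x u v).symm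

omit hε hsym

variable {e : End 𝕜 V} (he : LinearMap.IsSkewAdjoint B e)

include he

theorem adj_e : adj hB e = -e := adj_eq hB fun u v => by
  have h := he u v
  rw [LinearMap.neg_apply, map_neg, LinearMap.neg_apply, h]
  simp

omit [FiniteDimensional 𝕜 V] in
theorem apply_pow_skew (k : ℕ) (u v : V) : B ((e ^ k) u) v = (-1) ^ k * B u ((e ^ k) v) := by
  induction k generalizing u v with
  | zero => simp
  | succ k ih =>
    have h := he u ((e ^ k) v)
    rw [pow_succ, Module.End.mul_apply, ih, h, Pi.neg_apply, map_neg, ← Module.End.mul_apply e,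
      ← pow_succ', ← pow_succ e k]
    ring

theorem adj_commute {x : End 𝕜 V} (hx : Commute x e) : Commute (adj hB x) e := by
  have h := congrArg (adj hB) hx.eq
  rw [adj_mul, adj_mul, adj_e hB he, neg_mul, mul_neg, neg_inj] at h
  exact h.symm

end Adjoint

/-! ### Characters of the diagonal algebra, and adjunctions that preserve it. -/

namespace JordanBasis

variable {𝕜 : Type*} [Field 𝕜] {V : Type*} [AddCommGroup V] [Module 𝕜 V] {e : End 𝕜 V}
  (b : JordanBasis e)

/-- The scalar by which a diagonal endomorphism acts on the `j`-th block modulo nilpotents. -/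
noncomputable def blockScalar (j : Fin b.n) : End 𝕜 V →ₗ[𝕜] 𝕜 :=
  b.coeff j 0 ∘ₗ LinearMap.applyₗ (b.gen j)

theorem blockScalar_apply (j : Fin b.n) (x : End 𝕜 V) :
    b.blockScalar j x = b.coeff j 0 (x (b.gen j)) := rfl

theorem headMatrix_diag {x : End 𝕜 V} (hx : x ∈ b.diag) :
    b.headMatrix x = Matrix.diagonal fun j => b.blockScalar j x := by
  ext j i
  rw [headMatrix_apply, Matrix.diagonal_apply]
  split_ifs with h
  · subst h
    rfl
  · exact b.coeff_diag hx (Ne.symm h) 0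

theorem head_diag {x : End 𝕜 V} (hx : x ∈ b.diag) (v : V) (j : Fin b.n) :
    b.head (x v) j = b.blockScalar j x * b.head v j := by
  rw [← b.headMatrix_mulVec_head (b.mem_diag.1 hx).1, b.headMatrix_diag hx,
    Matrix.mulVec_diagonal]

/-- Diagonal endomorphisms act on `V / e V` by diagonal matrices, so the block scalars are
characters of `diag`; their common kernel consists of nilpotents. -/
theorem blockScalar_mul (j : Fin b.n) {x y : End 𝕜 V} (hx : x ∈ b.diag) :
    b.blockScalar j (x * y) = b.blockScalar j x * b.blockScalar j y := by
  have := b.head_diag hx (y (b.gen j)) j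
  exact this

theorem blockScalar_one (j : Fin b.n) : b.blockScalar j 1 = 1 := by
  have h := congrFun (b.head_gen j) j
  rw [Pi.single_eq_same] at h
  exact h

theorem blockScalar_pow (j : Fin b.n) {x : End 𝕜 V} (hx : x ∈ b.diag) (k : ℕ) :
    b.blockScalar j (x ^ k) = b.blockScalar j x ^ k := by
  induction k with
  | zero => rw [pow_zero, pow_zero, blockScalar_one]
  | succ k ih => rw [pow_succ', pow_succ', b.blockScalar_mul j hx, ih]

theorem blockScalar_blockProj (i j : Fin b.n) :
    b.blockScalar j (b.blockProj i) = if j = i then 1 else 0 := by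
  rw [blockScalar_apply, blockProj_gen]
  split_ifs with h
  · subst h
    exact b.blockScalar_one j
  · rw [map_zero]

theorem isNilpotent_of_blockScalar_eq_zero (he : IsNilpotent e) {x : End 𝕜 V} (hx : x ∈ b.diag)
    (h : ∀ j, b.blockScalar j x = 0) : ∃ K, K ≠ 0 ∧ x ^ K = 0 :=
  b.isNilpotent_of_head_eq_zero he (b.mem_diag.1 hx).1 fun v => by
    funext j
    rw [b.head_diag hx, h, zero_mul, Pi.zero_apply]

/-- Idempotents of the diagonal algebra are determined by their block scalars. -/
theorem idempotent_ext (he : IsNilpotent e) {x y : End 𝕜 V} (hx : x ∈ b.diag) (hy : y ∈ b.diag)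
    (hx2 : IsIdempotentElem x) (hy2 : IsIdempotentElem y)
    (h : ∀ j, b.blockScalar j x = b.blockScalar j y) : x = y := by
  have key : ∀ x y : End 𝕜 V, x ∈ b.diag → y ∈ b.diag → IsIdempotentElem x →
      IsIdempotentElem y → (∀ j, b.blockScalar j x = b.blockScalar j y) → x = x * y := by
    intro x y hx hy hx2 hy2 h
    have hcomm : Commute x y := b.diag_comm hx hy
    -- This idempotent has zero block scalars, so it is nilpotent and therefore zero.
    have hid : IsIdempotentElem (x * (1 - y)) :=
      IsIdempotentElem.mul_of_commute ((Commute.one_right x).sub_right hcomm) hx2 hy2.one_sub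
    obtain ⟨K, hK0, hK⟩ := b.isNilpotent_of_blockScalar_eq_zero he
      (b.diag.mul_mem hx (b.diag.sub_mem b.diag.one_mem hy)) (fun j => by
        rw [b.blockScalar_mul j hx, map_sub, blockScalar_one, ← h]
        have h1 := b.blockScalar_mul j (y := x) hx
        rw [hx2.eq] at h1
        linear_combination h1)
    obtain ⟨m, rfl⟩ := Nat.exists_eq_succ_of_ne_zero hK0
    rw [hid.pow_succ_eq] at hK
    rw [mul_sub, mul_one, sub_eq_zero] at hK
    exact hK
  rw [key x y hx hy hx2 hy2 h, b.diag_comm hx hy]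
  exact (key y x hy hx hy2 hx2 fun j => (h j).symm).symm

/-- An algebraic expression of the block size, to which the adjunction can be applied. -/
theorem pow_mul_blockProj_eq_zero_iff (i : Fin b.n) (s : ℕ) :
    e ^ s * b.blockProj i = 0 ↔ b.size i ≤ s := by
  constructor
  · intro h
    have h1 := LinearMap.congr_fun h (b.gen i)
    rw [Module.End.mul_apply, blockProj_gen, if_pos rfl, b.pow_gen, LinearMap.zero_apply] at h1
    by_contra hs
    rw [dif_pos (not_le.1 hs)] at h1
    exact b.basis.ne_zero _ h1
  · intro h
    have h0 : Commute (0 : End 𝕜 V) e := Commute.zero_left e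
    have h1 : Commute (e ^ s) e := (Commute.refl e).pow_left s
    refine b.ext_gen (h1.mul_left (b.commute_blockProj i)) h0 fun k => ?_
    rw [Module.End.mul_apply, blockProj_gen, LinearMap.zero_apply]
    split_ifs
    · rw [b.pow_gen, dif_neg (not_lt.2 h)]
    · rw [map_zero]

section Perm

variable [FiniteDimensional 𝕜 V] {B : LinearMap.BilinForm 𝕜 V} (hB : B.Nondegenerate) {ε : 𝕜}
  (hε : ε * ε = 1) (hsym : ∀ u v, B u v = ε * B v u) (hskew : LinearMap.IsSkewAdjoint B e)
  (he : IsNilpotent e)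

include hε hsym he in
/-- If the diagonal algebra is stable under taking adjoints, then the adjunction permutes the
block projections. -/
theorem exists_adj_blockProj (hdiag : ∀ x ∈ b.diag, adj hB x ∈ b.diag) :
    ∃ π : Equiv.Perm (Fin b.n), (∀ i, π (π i) = i) ∧
      ∀ i, adj hB (b.blockProj i) = b.blockProj (π i) := by
  have hbid : ∀ i, IsIdempotentElem (b.blockProj i) := fun i => by
    rw [IsIdempotentElem, blockProj_mul, if_pos rfl]
  let f : Fin b.n → End 𝕜 V := fun i => adj hB (b.blockProj i)
  have hfd : ∀ i, f i ∈ b.diag := fun i => hdiag _ (b.blockProj_mem_diag i)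
  have hfid : ∀ i, IsIdempotentElem (f i) := fun i => by
    rw [IsIdempotentElem, ← adj_mul, hbid]
  have hforth : ∀ i j, i ≠ j → f i * f j = 0 := fun i j hij => by
    rw [← adj_mul, blockProj_mul, if_neg (Ne.symm hij), map_zero]
  have hfsum : ∑ i, f i = 1 := by rw [← map_sum, sum_blockProj, adj_one]
  have h01 : ∀ i j, b.blockScalar j (f i) = 0 ∨ b.blockScalar j (f i) = 1 := fun i j => by
    have h1 := b.blockScalar_mul j (y := f i) (hfd i)
    rw [(hfid i).eq] at h1
    have h2 : b.blockScalar j (f i) * (b.blockScalar j (f i) - 1) = 0 := by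
      linear_combination -h1
    rcases mul_eq_zero.1 h2 with h | h
    · exact Or.inl h
    · exact Or.inr (sub_eq_zero.1 h)
  have hgen : ∀ i, b.gen i ≠ 0 := fun i h => by
    have h1 := b.blockScalar_one i
    rw [blockScalar_apply, h, map_zero, map_zero] at h1
    exact zero_ne_one h1
  have hbne : ∀ i, b.blockProj i ≠ 0 := fun i h => by
    have h1 := b.blockProj_gen i i
    rw [h, if_pos rfl] at h1
    exact hgen i h1.symm
  have hfne : ∀ i, f i ≠ 0 := fun i h => hbne i (by
    rw [← adj_adj hB hε hsym (b.blockProj i)]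
    change adj hB (f i) = 0
    rw [h, map_zero])
  -- Otherwise the nonzero idempotent `f i` would be nilpotent.
  have hex : ∀ i, ∃ j, b.blockScalar j (f i) = 1 := by
    intro i
    by_contra! hne
    obtain ⟨K, hK0, hK⟩ := b.isNilpotent_of_blockScalar_eq_zero he (hfd i)
      fun j => (h01 i j).resolve_right (hne j)
    obtain ⟨m, rfl⟩ := Nat.exists_eq_succ_of_ne_zero hK0
    rw [(hfid i).pow_succ_eq] at hK
    exact hfne i hK
  choose π hπ using hex
  -- Orthogonal idempotents cannot both have scalar 1 on the same block. By counting, every `f i`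
  -- has scalar 1 on exactly one block.
  have huniq : ∀ i i' j, b.blockScalar j (f i) = 1 → b.blockScalar j (f i') = 1 → i = i' := by
    intro i i' j h h'
    by_contra hne
    have h1 := b.blockScalar_mul j (y := f i') (hfd i)
    rw [hforth i i' hne, map_zero, h, h', mul_one] at h1
    exact zero_ne_one h1
  have hinj : Function.Injective π := fun i i' h => huniq i i' (π i) (hπ i) (h ▸ hπ i')
  have hsurj : Function.Surjective π := Finite.surjective_of_injective hinj
  have hadj : ∀ i, adj hB (b.blockProj i) = b.blockProj (π i) := by
    intro i
    refine b.idempotent_ext he (hfd i) (b.blockProj_mem_diag _) (hfid i) (hbid _) fun j => ?_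
    rw [blockScalar_blockProj]
    obtain ⟨i', rfl⟩ := hsurj j
    split_ifs with h
    · rw [hinj h]
      exact hπ i
    · exact (h01 i (π i')).resolve_right fun h1 => h (congrArg π (huniq _ _ _ (hπ i') h1))
  have hinvol : ∀ i, π (π i) = i := by
    intro i
    have h1 := adj_adj hB hε hsym (b.blockProj i)
    rw [hadj, hadj] at h1
    have h2 := b.blockScalar_blockProj (π (π i)) (π (π i))
    rw [h1, blockScalar_blockProj, if_pos rfl] at h2
    by_contra hne
    rw [if_neg hne] at h2
    exact zero_ne_one h2
  exact ⟨⟨π, π, hinvol, hinvol⟩, hinvol, hadj⟩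

variable {π : Equiv.Perm (Fin b.n)} (hπ : ∀ i, adj hB (b.blockProj i) = b.blockProj (π i))

-- The adjoint of `e ^ s * p_i = 0` is, up to sign, `e ^ s * p_(π i) = 0`.
include hπ hskew in
theorem size_le_of_adj (i : Fin b.n) : b.size (π i) ≤ b.size i := by
  rw [← b.pow_mul_blockProj_eq_zero_iff]
  have h1 := (b.pow_mul_blockProj_eq_zero_iff i (b.size i)).2 le_rfl
  have h2 := congrArg (adj hB) h1
  rw [adj_mul, adj_pow, hπ, adj_e hB hskew, map_zero, ((b.commute_blockProj _).neg_right.pow_right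
    _).eq, neg_pow, mul_assoc] at h2
  have h3 : IsUnit ((-1 : End 𝕜 V) ^ b.size i) := (IsUnit.neg isUnit_one).pow _
  exact (h3.mul_right_eq_zero).1 h2

include hπ hskew in
theorem size_adj_eq (hinv : ∀ i, π (π i) = i) (i : Fin b.n) : b.size (π i) = b.size i :=
  le_antisymm (b.size_le_of_adj hB hskew hπ i) (by
    have h := b.size_le_of_adj hB hskew hπ (π i)
    rwa [hinv] at h)

include hsym hskew hπ in
/-- The parity of the size of a block which is orthogonal to all others. -/
theorem parity_of_adj_blockProj {i : Fin b.n} (hi : π i = i) : ε * (-1) ^ b.size i = -1 := by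
  have hpos := b.size_pos i
  obtain ⟨m, hm⟩ := Nat.exists_eq_succ_of_ne_zero hpos.ne'
  have hne : (e ^ m) (b.gen i) ≠ 0 := by
    rw [b.pow_gen, dif_pos (by omega)]
    exact b.basis.ne_zero _
  -- The vector `e ^ m w_i` is orthogonal to the other blocks and to `e ^ s w_i` for `s > 0`, since
  -- `e ^ (m + s) w_i = 0`. Nondegeneracy leaves only the pairing with `w_i`.
  have hκ : B ((e ^ m) (b.gen i)) (b.gen i) ≠ 0 := by
    intro h0
    apply hne
    refine hB.1 _ fun v => ?_
    have hzero : B ((e ^ m) (b.gen i)) = 0 := by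
      refine b.basis.ext ?_
      rintro ⟨k, s⟩
      rw [b.basis_apply, LinearMap.zero_apply]
      by_cases hp : k = i
      · subst hp
        by_cases hs : (s : ℕ) = 0
        · dsimp only
          rw [hs]
          exact h0
        · have h1 := apply_pow_skew hskew s ((e ^ m) (b.gen k)) (b.gen k)
          rw [← Module.End.mul_apply, ← pow_add, b.pow_gen, dif_neg (by omega), map_zero,
            LinearMap.zero_apply] at h1
          exact (mul_eq_zero.1 h1.symm).resolve_left (pow_ne_zero _ (neg_ne_zero.2 one_ne_zero))
      · have h1 : b.blockProj i ((e ^ m) (b.gen i)) = (e ^ m) (b.gen i) := by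
          rw [← Module.End.mul_apply, ((b.commute_blockProj i).pow_right m).eq,
            Module.End.mul_apply, blockProj_gen, if_pos rfl]
        have h2 := adj_left hB (b.blockProj i) ((e ^ m) (b.gen i)) ((e ^ (s : ℕ)) (b.gen k))
        rw [hπ, hi, h1, ← Module.End.mul_apply (b.blockProj i),
          ((b.commute_blockProj i).pow_right _).eq, Module.End.mul_apply, blockProj_gen, if_neg hp,
          map_zero, map_zero] at h2
        exact h2
    rw [hzero, LinearMap.zero_apply]
  -- Skewness and symmetry multiply the nonzero pairing by `ε (-1) ^ m`, which must be 1.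
  have h1 := apply_pow_skew hskew m (b.gen i) (b.gen i)
  rw [hsym (b.gen i)] at h1
  have h2 : (1 - (-1) ^ m * ε) * B ((e ^ m) (b.gen i)) (b.gen i) = 0 := by
    linear_combination h1
  have h3 := (mul_eq_zero.1 h2).resolve_right hκ
  rw [hm, pow_succ]
  linear_combination h3

include he hπ in
/-- The block scalars of a self-adjoint diagonal endomorphism are invariant under the
permutation of the blocks. -/
theorem blockScalar_perm {z : End 𝕜 V} (hz : z ∈ b.diag)
    (hzadj : adj hB z = z) (j : Fin b.n) : b.blockScalar (π j) z = b.blockScalar j z := by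
  set c := b.blockScalar j z with hc
  have hzc : z - c • (1 : End 𝕜 V) ∈ b.diag :=
    b.diag.sub_mem hz (b.diag.smul_mem b.diag.one_mem c)
  have hadj : adj hB (z - c • (1 : End 𝕜 V)) = z - c • (1 : End 𝕜 V) := by
    rw [map_sub, hzadj, map_smul, adj_one]
  have hmem := b.diag.mul_mem hzc (b.blockProj_mem_diag j)
  -- `(z - c) p_j` is nilpotent, hence so is its adjoint `p_(π j) (z - c)`, whose scalar on block `π
  -- j` is the difference of the two scalars.
  obtain ⟨K, hK0, hK⟩ := b.isNilpotent_of_blockScalar_eq_zero he hmem (fun k => by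
    rw [b.blockScalar_mul k hzc, blockScalar_blockProj]
    split_ifs with h
    · subst h
      rw [map_sub, map_smul, blockScalar_one, hc]
      simp
    · rw [mul_zero])
  have h1 := congrArg (adj hB) hK
  rw [adj_pow, adj_mul, hπ, hadj, map_zero] at h1
  have h2 := b.blockScalar_pow (π j) (b.diag.mul_mem (b.blockProj_mem_diag (π j)) hzc) K
  rw [h1, map_zero, b.blockScalar_mul _ (b.blockProj_mem_diag _), blockScalar_blockProj,
    if_pos rfl, one_mul, map_sub, map_smul, blockScalar_one] at h2
  have h3 := pow_eq_zero_iff hK0 |>.1 h2.symm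
  simpa [sub_eq_zero] using h3

end Perm

end JordanBasis

end CentGen

namespace CentGen

/-! ### Orbits and conjugacy of involutions. -/

section Combinatorics

/-- The two numbers count the orbits and the two-element orbits: `τ` exchanges the smaller and the
larger members of the latter. -/
theorem card_le_apply_add_card_lt_apply {n : ℕ} {τ : Fin n → Fin n} (hτ : ∀ i, τ (τ i) = i) :
    (Finset.univ.filter fun i => i ≤ τ i).card + (Finset.univ.filter fun i => i < τ i).card = n := by
  have h1 : (Finset.univ.filter fun i => i < τ i).card =
      (Finset.univ.filter fun i => ¬ i ≤ τ i).card := by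
    refine Finset.card_bij (fun i _ => τ i) (fun i hi => ?_) (fun i _ j _ h => ?_) fun j hj => ?_
    · simp only [Finset.mem_filter, Finset.mem_univ, true_and, not_le, hτ] at hi ⊢
      exact hi
    · rw [← hτ i, h, hτ]
    · refine ⟨τ j, ?_, hτ j⟩
      simp only [Finset.mem_filter, Finset.mem_univ, true_and, not_le, hτ] at hj ⊢
      exact hj
  rw [h1, Finset.card_filter_add_card_filter_not, Finset.card_univ, Fintype.card_fin]

theorem card_le_apply_eq {n : ℕ} (τ : Fin n → Fin n) :
    (Finset.univ.filter fun i => i ≤ τ i).card =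
      (Finset.univ.filter fun i => i < τ i).card + (Finset.univ.filter fun i => τ i = i).card := by
  rw [← Finset.card_union_of_disjoint]
  · congr 1
    ext i
    simp [le_iff_lt_or_eq, eq_comm]
  · rw [Finset.disjoint_filter]
    intro i _ h1 h2
    exact h1.ne' h2

/-- An involution with at least as many orbits as a second one, and no more fixed points, has the
same fixed points. -/
theorem fixed_iff_of_card_le {n : ℕ} {τ π : Fin n → Fin n} (hτ : ∀ i, τ (τ i) = i)
    (hπ : ∀ i, π (π i) = i) (hfix : ∀ i, π i = i → τ i = i)
    (hcard : (Finset.univ.filter fun i => i ≤ τ i).card ≤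
      (Finset.univ.filter fun i => i ≤ π i).card) (i : Fin n) : τ i = i ↔ π i = i := by
  have h1 := card_le_apply_add_card_lt_apply hτ
  have h2 := card_le_apply_add_card_lt_apply hπ
  have h3 := card_le_apply_eq τ
  have h4 := card_le_apply_eq π
  have hsub : (Finset.univ.filter fun i => π i = i) ⊆ Finset.univ.filter fun i => τ i = i := by
    intro i hi
    simp only [Finset.mem_filter, Finset.mem_univ, true_and] at hi ⊢
    exact hfix i hi
  -- Twice the number of orbits is `n` plus the number of fixed points, so `τ` has at most as many
  -- fixed points as `π`.
  have h5 := Finset.eq_of_subset_of_card_le hsub (by omega)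
  have h6 := Finset.ext_iff.1 h5 i
  simp only [Finset.mem_filter, Finset.mem_univ, true_and] at h6
  exact h6.symm

/-- Two involutions with equally many fixed points are conjugate. -/
theorem isConj_of_involutions {X : Type*} [Fintype X] [DecidableEq X] {τ π : Equiv.Perm X}
    (hτ : τ ^ 2 = 1) (hπ : π ^ 2 = 1) (hfix : ∀ x, τ x = x ↔ π x = x) : IsConj τ π := by
  have h1 : ∀ σ : Equiv.Perm X, σ ^ 2 = 1 →
      σ.cycleType = Multiset.replicate (σ.support.card / 2) 2 := by
    intro σ hσ
    have h2 := Multiset.eq_replicate_card.2 (Equiv.Perm.pow_prime_eq_one_iff.1 hσ)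
    have h3 := σ.sum_cycleType
    rw [h2, Multiset.sum_replicate, smul_eq_mul] at h3
    rw [← h3, Nat.mul_div_cancel _ (by norm_num)]
    exact h2
  have h4 : τ.support = π.support := by
    ext x
    rw [Equiv.Perm.mem_support, Equiv.Perm.mem_support, not_iff_not]
    exact hfix x
  rw [Equiv.Perm.isConj_iff_cycleType_eq, h1 τ hτ, h1 π hπ, h4]

/-- Two involutions with the same fixed points, which preserve a function, are conjugate by a
permutation which preserves the function. -/
theorem exists_conj_of_involutions {X : Type*} [Fintype X] {κ : X → ℕ} {τ π : Equiv.Perm X}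
    (hτ : ∀ x, τ (τ x) = x) (hπ : ∀ x, π (π x) = x) (hτκ : ∀ x, κ (τ x) = κ x)
    (hπκ : ∀ x, κ (π x) = κ x) (hfix : ∀ x, τ x = x ↔ π x = x) :
    ∃ σ : Equiv.Perm X, (∀ x, κ (σ x) = κ x) ∧ ∀ x, σ (τ x) = π (σ x) := by
  classical
  -- The conjugating permutation is built on each fibre of `κ` and then glued.
  let τ' : ∀ k, Equiv.Perm {x // κ x = k} := fun k => τ.subtypePerm fun x => by rw [hτκ]
  let π' : ∀ k, Equiv.Perm {x // κ x = k} := fun k => π.subtypePerm fun x => by rw [hπκ]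
  have hconj : ∀ k, IsConj (τ' k) (π' k) := fun k => by
    refine isConj_of_involutions ?_ ?_ ?_
    · ext x
      simp [τ', pow_two, hτ]
    · ext x
      simp [π', pow_two, hπ]
    · intro x
      simp [τ', π', Subtype.ext_iff, hfix]
  choose σ' hσ' using fun k => isConj_iff.1 (hconj k)
  let σ : Equiv.Perm X := Equiv.ofFiberEquiv (f := κ) (g := κ) σ'
  have hσ : ∀ k (x : {x // κ x = k}), σ x = σ' k x := by
    rintro _ ⟨x, rfl⟩
    rfl
  refine ⟨σ, fun x => Equiv.ofFiberEquiv_map σ' x, fun x => ?_⟩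
  have h1 := hσ (κ x) ⟨x, rfl⟩
  have h2 := hσ (κ x) ⟨τ x, hτκ x⟩
  have h3 := Equiv.congr_fun (mul_inv_eq_iff_eq_mul.1 (hσ' (κ x))) ⟨x, rfl⟩
  simp only at h1 h2
  rw [h1, h2]
  exact congrArg Subtype.val h3

end Combinatorics

/-! ### Square roots in commutative algebras. -/

section SquareRoot

variable {𝕜 : Type*} [Field 𝕜] [IsAlgClosed 𝕜]

/-- Away from characteristic two, an invertible element of a finite-dimensional commutative
algebra over an algebraically closed field is a square. -/
theorem exists_mul_self_eq_of_isUnit {S : Type*} [CommRing S] [Algebra 𝕜 S] [FiniteDimensional 𝕜 S]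
    (h2 : (2 : 𝕜) ≠ 0) {z : S} (hz : IsUnit z) : ∃ p : S, p * p = z := by
  classical
  rcases subsingleton_or_nontrivial S with hS | hS
  · exact ⟨0, Subsingleton.elim _ _⟩
  have hint : IsIntegral 𝕜 z := IsIntegral.of_finite 𝕜 z
  set m := minpoly 𝕜 z with hm
  choose r hr using fun c : 𝕜 => IsAlgClosed.exists_pow_nat_eq c (n := 2) (by norm_num)
  -- `q` takes a square root at each root of the minimal polynomial, so `q(z)² - z` is nilpotent.
  let q : Polynomial 𝕜 := Lagrange.interpolate m.roots.toFinset id r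
  have hq : ∀ c ∈ m.roots, q.eval c = r c := fun c hc =>
    Lagrange.eval_interpolate_at_node r (v := id) (Set.injOn_id _) (Multiset.mem_toFinset.2 hc)
  have hdvd : m ∣ (q ^ 2 - Polynomial.X) ^ (Multiset.card m.roots) := by
    have hsplit : m = (m.roots.map fun c => Polynomial.X - Polynomial.C c).prod := by
      have h3 := (IsAlgClosed.splits m).eq_prod_roots
      rwa [(minpoly.monic hint).leadingCoeff, Polynomial.C_1, one_mul] at h3
    conv_lhs => rw [hsplit]
    rw [← Multiset.prod_replicate, ← Multiset.map_const']
    refine Multiset.prod_dvd_prod_of_dvd _ _ fun c hc => ?_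
    rw [Polynomial.dvd_iff_isRoot, Polynomial.IsRoot, Polynomial.eval_sub, Polynomial.eval_pow,
      hq c hc, hr, Polynomial.eval_X, sub_self]
  set x := Polynomial.aeval z q with hx
  have hnil : IsNilpotent (x ^ 2 - z) := by
    refine ⟨Multiset.card m.roots, ?_⟩
    obtain ⟨t, ht⟩ := hdvd
    have h3 := congrArg (Polynomial.aeval z) ht
    rw [map_mul, minpoly.aeval, zero_mul, map_pow, map_sub, map_pow, Polynomial.aeval_X] at h3
    exact h3
  have hxu : IsUnit x := by
    have h3 : IsUnit (x ^ 2) := by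
      have := hnil.isUnit_add_left_of_commute hz (Commute.all _ _)
      rwa [add_sub_cancel] at this
    exact (isUnit_pow_iff two_ne_zero).1 h3
  have h2u : IsUnit (2 : S) := by
    have := (isUnit_iff_ne_zero.2 h2).map (algebraMap 𝕜 S)
    rwa [map_ofNat] at this
  -- Newton's method lifts the approximate root to an exact one; the derivative `2 x` is invertible
  -- as the characteristic is not two.
  obtain ⟨p, ⟨_, hp⟩, _⟩ := Polynomial.existsUnique_nilpotent_sub_and_aeval_eq_zero
    (R := S) (S := S) (P := Polynomial.X ^ 2 - Polynomial.C z) (x := x)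
    (by simpa using hnil) (by simpa [one_add_one_eq_two] using h2u.mul hxu)
  refine ⟨p, ?_⟩
  rw [map_sub, map_pow, Polynomial.aeval_X, Polynomial.aeval_C, sub_eq_zero] at hp
  rw [← pow_two, hp]
  rfl

/-- The root is a polynomial in `z`, so it inherits self-adjointness and membership in `diag` from
`z`. -/
theorem exists_sqrt_mem_adjoin {V : Type*} [AddCommGroup V] [Module 𝕜 V] [FiniteDimensional 𝕜 V]
    (h2 : (2 : 𝕜) ≠ 0) {z : End 𝕜 V} (hz : IsUnit z) :
    ∃ p ∈ Algebra.adjoin 𝕜 {z}, p * p = z ∧ IsUnit p := by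
  let S := Algebra.adjoin 𝕜 {z}
  have _ : IsMulCommutative S := Algebra.isMulCommutative_adjoin 𝕜 (by
    rintro a rfl c rfl
    rfl)
  have hzS : z ∈ S := Algebra.self_mem_adjoin_singleton 𝕜 z
  have hart : IsArtinianRing S := IsArtinianRing.of_finite 𝕜 S
  have hzu : IsUnit (⟨z, hzS⟩ : S) := by
    -- Invertibility of `z` in `End V` has to be transferred to the subalgebra.
    refine IsArtinianRing.isUnit_of_mem_nonZeroDivisors ?_
    rw [mem_nonZeroDivisors_iff_right]
    intro y hy
    have h3 : (y : End 𝕜 V) * z = 0 := congrArg Subtype.val hy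
    exact Subtype.ext ((hz.mul_left_eq_zero).1 h3)
  obtain ⟨p, hp⟩ := exists_mul_self_eq_of_isUnit (𝕜 := 𝕜) h2 hzu
  refine ⟨p, p.2, congrArg Subtype.val hp, ?_⟩
  have hpu : IsUnit p := isUnit_of_mul_isUnit_left (hp ▸ hzu)
  exact hpu.map S.val

end SquareRoot

end CentGen

namespace CentGen

/-! ### Transport of the form, and stability of stabilisers under the adjunction. -/

section Isometry

variable {𝕜 : Type*} [Field 𝕜] {V : Type*} [AddCommGroup V] [Module 𝕜 V]
  [FiniteDimensional 𝕜 V] {B : LinearMap.BilinForm 𝕜 V} {e : End 𝕜 V}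

/-- The transport of a bilinear form along an endomorphism. -/
def pullForm (B : LinearMap.BilinForm 𝕜 V) (g : End 𝕜 V) : LinearMap.BilinForm 𝕜 V :=
  B.compl₁₂ g g

omit [FiniteDimensional 𝕜 V] in
@[simp]
theorem pullForm_apply (g : End 𝕜 V) (u v : V) : pullForm B g u v = B (g u) (g v) := rfl

omit [FiniteDimensional 𝕜 V] in
theorem pullForm_nondegenerate (hB : B.Nondegenerate) (g : LinearMap.GeneralLinearGroup 𝕜 V) :
    (pullForm B (g : End 𝕜 V)).Nondegenerate := by
  have h1 : ∀ v, (g : End 𝕜 V) (((g⁻¹ : LinearMap.GeneralLinearGroup 𝕜 V) : End 𝕜 V) v) = v :=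
    fun v => by rw [← Module.End.mul_apply, Units.mul_inv, Module.End.one_apply]
  have h2 : ∀ v, ((g⁻¹ : LinearMap.GeneralLinearGroup 𝕜 V) : End 𝕜 V) ((g : End 𝕜 V) v) = v :=
    fun v => by rw [← Module.End.mul_apply, Units.inv_mul, Module.End.one_apply]
  constructor
  · intro u hu
    have h3 := hB.1 ((g : End 𝕜 V) u) fun v => by
      have := hu (((g⁻¹ : LinearMap.GeneralLinearGroup 𝕜 V) : End 𝕜 V) v)
      rwa [pullForm_apply, h1] at this
    rw [← h2 u, h3, map_zero]
  · intro u hu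
    have h3 := hB.2 ((g : End 𝕜 V) u) fun v => by
      have := hu (((g⁻¹ : LinearMap.GeneralLinearGroup 𝕜 V) : End 𝕜 V) v)
      rwa [pullForm_apply, h1] at this
    rw [← h2 u, h3, map_zero]

omit [FiniteDimensional 𝕜 V] in
theorem pullForm_isSkewAdjoint (hskew : LinearMap.IsSkewAdjoint B e) {g : End 𝕜 V}
    (hg : Commute g e) : LinearMap.IsSkewAdjoint (pullForm B g) e := by
  intro u v
  have h1 := hskew (g u) (g v)
  have h2 : ∀ u, g (e u) = e (g u) := fun u => LinearMap.congr_fun hg.eq u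
  rw [pullForm_apply, h2, h1, Pi.neg_apply, Pi.neg_apply, pullForm_apply, map_neg g, h2]

/-- Conjugating by `g` while transporting the form intertwines the two adjunctions; a self-adjoint
subalgebra stays so for the transported form. -/
theorem adj_pullForm (hB : B.Nondegenerate) (g : LinearMap.GeneralLinearGroup 𝕜 V)
    (x : End 𝕜 V) : adj (pullForm_nondegenerate hB g) x =
      ((g⁻¹ : LinearMap.GeneralLinearGroup 𝕜 V) : End 𝕜 V) *
        adj hB ((g : End 𝕜 V) * x * ((g⁻¹ : LinearMap.GeneralLinearGroup 𝕜 V) : End 𝕜 V)) * g := by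
  refine adj_eq _ fun u v => ?_
  have h1 : ∀ v, (g : End 𝕜 V) (((g⁻¹ : LinearMap.GeneralLinearGroup 𝕜 V) : End 𝕜 V) v) = v :=
    fun v => by rw [← Module.End.mul_apply, Units.mul_inv, Module.End.one_apply]
  have h2 : ∀ v, ((g⁻¹ : LinearMap.GeneralLinearGroup 𝕜 V) : End 𝕜 V) ((g : End 𝕜 V) v) = v :=
    fun v => by rw [← Module.End.mul_apply, Units.inv_mul, Module.End.one_apply]
  simp only [pullForm_apply, Module.End.mul_apply, h1, adj_left, h2]

/-- The stabiliser of a linear form which is symmetric or skew-symmetric with respect to the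
adjunction is stable under the adjunction. -/
theorem adj_mem_symStab (hB : B.Nondegenerate) {ε : 𝕜} (hε : ε * ε = 1)
    (hsym : ∀ u v, B u v = ε * B v u) (hskew : LinearMap.IsSkewAdjoint B e)
    {M : Dual 𝕜 (End 𝕜 V)} (hM : ∀ x, Commute x e → M (adj hB x) = ε * M x) {x : End 𝕜 V}
    (hx : x ∈ symStab e M) : adj hB x ∈ symStab e M := by
  obtain ⟨hxe, hxM⟩ := hx
  refine ⟨adj_commute hB hskew hxe, fun y hy => ?_⟩
  have hy' := adj_commute hB hskew hy
  have h1 := hM _ (hy'.mul_left hxe)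
  have h2 := hM _ (hxe.mul_left hy')
  rw [adj_mul, adj_adj hB hε hsym] at h1 h2
  rw [h1, h2, hxM _ hy']

end Isometry

/-! ### Normalised Jordan bases, and the symmetry of `α`. -/

namespace JordanBasis

variable {𝕜 : Type*} [Field 𝕜] {V : Type*} [AddCommGroup V] [Module 𝕜 V]
  [FiniteDimensional 𝕜 V] {e : End 𝕜 V} {b : JordanBasis e}
  {B : LinearMap.BilinForm 𝕜 V} {ε : ℤ} {inv : Fin b.n → Fin b.n}

namespace IsNormalised

variable (hN : b.IsNormalised B ε inv) (hB : B.Nondegenerate)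

include hN

/-- The form pairs the `i`-th block with the `i'`-th block only. -/
theorem adj_blockProj (i : Fin b.n) : adj hB (b.blockProj i) = b.blockProj (inv i) := by
  refine adj_eq hB fun u v => ?_
  have h : B ∘ₗ b.blockProj (inv i) = (B.compl₂ (b.blockProj i)) := by
    refine b.basis.ext fun p => b.basis.ext fun q => ?_
    rw [b.basis_apply, b.basis_apply, LinearMap.comp_apply, LinearMap.compl₂_apply]
    have hproj : ∀ (j k : Fin b.n) (s : ℕ), b.blockProj j ((e ^ s) (b.gen k)) =
        if k = j then (e ^ s) (b.gen k) else 0 := by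
      intro j k s
      rw [← Module.End.mul_apply, ((b.commute_blockProj j).pow_right s).eq, Module.End.mul_apply,
        blockProj_gen]
      split_ifs with h
      · rw [h]
      · rw [map_zero]
    rw [hproj, hproj]
    by_cases h1 : p.1 = inv i
    · by_cases h2 : q.1 = i
      · rw [if_pos h1, if_pos h2]
      · rw [if_pos h1, if_neg h2, map_zero]
        refine hN.orthogonal _ _ _ _ p.2.2 q.2.2 fun h => h2 ?_
        rw [h.1, h1, hN.involutive]
    · by_cases h2 : q.1 = i
      · rw [if_neg h1, if_pos h2, map_zero, LinearMap.zero_apply]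
        refine (hN.orthogonal _ _ _ _ p.2.2 q.2.2 fun h => h1 ?_).symm
        rw [← h2, h.1, hN.involutive]
      · rw [if_neg h1, if_neg h2, map_zero, map_zero, LinearMap.zero_apply]
  exact LinearMap.congr_fun (LinearMap.congr_fun h u) v

omit [FiniteDimensional 𝕜 V] in
/-- The pairing with `w_{i'}` is a multiple of the coefficient of `e ^ (λ_i - 1) w_i`. -/
theorem apply_gen_inv (i : Fin b.n) (v : V) :
    B (b.gen (inv i)) v = B (b.gen (inv i)) ((e ^ (b.size i - 1)) (b.gen i)) *
      b.coeff i (b.size i - 1) v := by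
  have hpos := b.size_pos i
  have h : B (b.gen (inv i)) = B (b.gen (inv i)) ((e ^ (b.size i - 1)) (b.gen i)) •
      b.coeff i (b.size i - 1) := by
    refine b.basis.ext ?_
    rintro ⟨k, t⟩
    rw [b.basis_apply, LinearMap.smul_apply, coeff_pow_gen, smul_eq_mul]
    dsimp only
    split_ifs with h1
    · obtain ⟨rfl, h1, -⟩ := h1
      rw [h1, mul_one]
    · rw [mul_zero]
      have h2 := hN.orthogonal (inv i) k 0 t (b.size_pos _) t.2 (by
        rw [hN.involutive, hN.size_inv]
        rintro ⟨rfl, h3⟩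
        exact h1 ⟨rfl, by omega, by omega⟩)
      rwa [pow_zero, Module.End.one_apply] at h2
  conv_lhs => rw [h]
  rfl

-- Exchanging the arguments costs `ε (-1) ^ (λ_i - 1)`, and this is `-1` because `i' ≠ i` forces `ε
-- (-1) ^ λ_i = 1`.
omit [FiniteDimensional 𝕜 V] in
theorem pairing_inv (hε : ε = 1 ∨ ε = -1) (hsym : ∀ u v, B u v = (ε : 𝕜) * B v u)
    (hskew : LinearMap.IsSkewAdjoint B e) {i : Fin b.n} (hi : inv i ≠ i) :
    B (b.gen (inv (inv i))) ((e ^ (b.size (inv i) - 1)) (b.gen (inv i))) =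
      - B (b.gen (inv i)) ((e ^ (b.size i - 1)) (b.gen i)) := by
  have hpar : ε * (-1) ^ b.size i = 1 := by
    have h1 := mt (hN.inv_eq_iff i).2 hi
    rcases hε with rfl | rfl <;> rcases neg_one_pow_eq_or ℤ (b.size i) with h | h <;>
      simp_all
  have hpar' : (ε : 𝕜) * (-1) ^ b.size i = 1 := by exact_mod_cast congrArg (Int.cast (R := 𝕜)) hpar
  obtain ⟨m, hm⟩ := Nat.exists_eq_succ_of_ne_zero (b.size_pos i).ne'
  rw [hN.involutive, hN.size_inv, hm, Nat.succ_sub_one, hsym, apply_pow_skew hskew, ← mul_assoc]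
  rw [hm, pow_succ] at hpar'
  linear_combination (-B (b.gen (inv i)) ((e ^ m) (b.gen i))) * hpar'

-- The pairing is 1 when `i' ≤ i`, by normalisation, and `-1` otherwise, by `pairing_inv`.
omit [FiniteDimensional 𝕜 V] in
theorem pairing_mul_self (hε : ε = 1 ∨ ε = -1) (hsym : ∀ u v, B u v = (ε : 𝕜) * B v u)
    (hskew : LinearMap.IsSkewAdjoint B e) (i : Fin b.n) :
    B (b.gen (inv i)) ((e ^ (b.size i - 1)) (b.gen i)) *
      B (b.gen (inv i)) ((e ^ (b.size i - 1)) (b.gen i)) = 1 := by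
  have key : ∀ i, inv i ≤ i → B (b.gen (inv i)) ((e ^ (b.size i - 1)) (b.gen i)) = 1 := by
    intro i hi
    have h := hN.normal (inv i) (by rwa [hN.involutive])
    rwa [hN.involutive, hN.size_inv] at h
  rcases le_total (inv i) i with h | h
  · rw [key i h, one_mul]
  · by_cases hi : inv i = i
    · rw [key i hi.le, one_mul]
    · have h1 := hN.pairing_inv hε hsym hskew hi
      rw [key (inv i) (by rwa [hN.involutive])] at h1
      linear_combination (B (b.gen (inv i)) ((e ^ (b.size i - 1)) (b.gen i)) - 1) * h1

/-- The symmetry of `α` with respect to the adjunction. -/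
theorem alphaEnd_adj (hε : ε = 1 ∨ ε = -1) (hsym : ∀ u v, B u v = (ε : 𝕜) * B v u)
    (hskew : LinearMap.IsSkewAdjoint B e) {a : Fin b.n → 𝕜}
    (ha : ∀ i, inv i ≠ i → a (inv i) = - a i) (x : End 𝕜 V) :
    b.alphaEnd a (adj hB x) = ε * b.alphaEnd a x := by
  set κ : Fin b.n → 𝕜 := fun i => B (b.gen (inv i)) ((e ^ (b.size i - 1)) (b.gen i)) with hκ
  have h1 : ∀ x : End 𝕜 V, b.alphaEnd a x =
      ∑ i, a i * κ i * B (b.gen (inv i)) (x (b.gen i)) := by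
    intro x
    rw [alphaEnd_apply]
    refine Finset.sum_congr rfl fun i _ => ?_
    rw [hN.apply_gen_inv i (x (b.gen i))]
    have := hN.pairing_mul_self hε hsym hskew i
    linear_combination (-a i * b.coeff i (b.size i - 1) (x (b.gen i))) * this
  -- On a two-element orbit both `a` and `κ` change sign; this is where `a_{i'} = -a_i` enters.
  have h2 : ∀ i, a (inv i) * κ (inv i) = a i * κ i := by
    intro i
    by_cases hi : inv i = i
    · rw [hi]
    · have h3 : κ (inv i) = -κ i := hN.pairing_inv hε hsym hskew hi
      rw [h3, ha i hi]
      ring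
  have hεε : (ε : 𝕜) * ε = 1 := by rcases hε with rfl | rfl <;> simp
  rw [h1, h1, Finset.mul_sum, ← Equiv.sum_comp (Function.Involutive.toPerm inv hN.involutive)]
  refine Finset.sum_congr rfl fun i _ => ?_
  rw [Function.Involutive.coe_toPerm, h2, hN.involutive, adj_right hB hεε hsym,
    hsym (x (b.gen i))]
  ring

end IsNormalised

end JordanBasis

end CentGen

namespace CentGen

/-! ### Correcting the conjugating element to an isometry. -/

namespace JordanBasis

section Orbits

variable {𝕜 : Type*} [Field 𝕜] {V : Type*} [AddCommGroup V] [Module 𝕜 V] {e : End 𝕜 V}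
  (b : JordanBasis e)

theorem blockScalar_aeval (j : Fin b.n) {z : End 𝕜 V} (hz : z ∈ b.diag) (p : Polynomial 𝕜) :
    b.blockScalar j (Polynomial.aeval z p) = p.eval (b.blockScalar j z) := by
  induction p using Polynomial.induction_on' with
  | add p q hp hq => rw [map_add, map_add, hp, hq, Polynomial.eval_add]
  | monomial k c =>
    rw [Polynomial.aeval_monomial, ← Algebra.smul_def, map_smul, b.blockScalar_pow j hz,
      Polynomial.eval_monomial, smul_eq_mul]

theorem mul_aeval_of_mul_eq {g y z : End 𝕜 V} (h : g * z = y * g) (p : Polynomial 𝕜) :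
    g * Polynomial.aeval z p = Polynomial.aeval y p * g := by
  induction p using Polynomial.induction_on' with
  | add p q hp hq => rw [map_add, map_add, mul_add, add_mul, hp, hq]
  | monomial k c =>
    have h1 : g * z ^ k = y ^ k * g := SemiconjBy.pow_right (show SemiconjBy g z y from h) k
    rw [Polynomial.aeval_monomial, Polynomial.aeval_monomial, ← Algebra.smul_def,
      ← Algebra.smul_def, mul_smul_comm, smul_mul_assoc, h1]

/-- The block scalars of `z` take at most one value per orbit of `π`. The polynomial with these
simple roots annihilates the action on `V / e V` of the conjugate `y`, so at most that many powers
of it are independent. -/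
theorem card_le_of_blockScalar_invariant {π : Fin b.n → Fin b.n} (hπ : ∀ i, π (π i) = i)
    {y z : End 𝕜 V} (hz : z ∈ b.diag) (hzπ : ∀ j, b.blockScalar (π j) z = b.blockScalar j z)
    (hy : Commute y e) {g : LinearMap.GeneralLinearGroup 𝕜 V} (hge : Commute (g : End 𝕜 V) e)
    (hgz : (g : End 𝕜 V) * z = y * g) {k : ℕ}
    (hli : LinearIndependent 𝕜 fun j : Fin k =>
      (Matrix.toLin' (b.headMatrix y) : End 𝕜 (Fin b.n → 𝕜)) ^ (j : ℕ)) :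
    k ≤ (Finset.univ.filter fun i => i ≤ π i).card := by
  classical
  set T := Finset.univ.filter fun i => i ≤ π i with hT
  set d : Fin b.n → 𝕜 := fun j => b.blockScalar j z with hd
  set p : Polynomial 𝕜 := ∏ c ∈ T.image d, (Polynomial.X - Polynomial.C c) with hp
  have hdeg : p.natDegree = (T.image d).card := Polynomial.natDegree_finsetProd_X_sub_C_eq_card _ _
  have hmonic : p.Monic := Polynomial.monic_prod_of_monic _ _ fun c _ => Polynomial.monic_X_sub_C c
  have hroot : ∀ j, p.eval (d j) = 0 := by
    intro j
    have hmem : d j ∈ T.image d := by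
      by_cases hj : j ≤ π j
      · exact Finset.mem_image_of_mem _ (by simpa [hT] using hj)
      · rw [show d j = d (π j) from (hzπ j).symm]
        exact Finset.mem_image_of_mem _ (by simpa [hT, hπ] using (not_le.1 hj).le)
    rw [hp, Polynomial.eval_prod]
    exact Finset.prod_eq_zero hmem (by simp)
  have hpz : Polynomial.aeval z p ∈ b.diag :=
    Algebra.adjoin_le (S := b.diag) (by simpa using hz) (Polynomial.aeval_mem_adjoin_singleton 𝕜 z)
  have hpy : ∀ v, b.head (Polynomial.aeval y p v) = 0 := by
    intro v
    have h1 := mul_aeval_of_mul_eq hgz p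
    have h2 : Polynomial.aeval y p v = (g : End 𝕜 V) (Polynomial.aeval z p
        (((g⁻¹ : LinearMap.GeneralLinearGroup 𝕜 V) : End 𝕜 V) v)) := by
      rw [← Module.End.mul_apply, ← Module.End.mul_apply, h1, mul_assoc, Units.mul_inv, mul_one]
    obtain ⟨u, hu⟩ := b.exists_eq_of_head_eq_zero
      (v := Polynomial.aeval z p (((g⁻¹ : LinearMap.GeneralLinearGroup 𝕜 V) : End 𝕜 V) v)) (by
        funext j
        rw [b.head_diag hpz, b.blockScalar_aeval j hz, hroot, zero_mul, Pi.zero_apply])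
    rw [h2, hu, ← Module.End.mul_apply, hge.eq, Module.End.mul_apply, head_apply_e]
  have hzero : Polynomial.aeval (Matrix.toLin' (b.headMatrix y) : End 𝕜 (Fin b.n → 𝕜)) p = 0 := by
    ext1 j
    refine LinearMap.ext fun c => ?_
    obtain ⟨v, hv⟩ := b.head_surjective (Pi.single j c)
    rw [LinearMap.comp_apply, LinearMap.comp_apply, LinearMap.coe_single, ← hv, b.aeval_head hy,
      hpy, LinearMap.zero_apply]
  refine le_trans ?_ (Finset.card_image_le (s := T) (f := d))
  rw [← hdeg]
  by_contra hlt
  rw [not_le] at hlt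
  rw [Polynomial.aeval_eq_sum_range' hlt, Finset.sum_range] at hzero
  have h3 := Fintype.linearIndependent_iff.1 hli (fun i => p.coeff i) hzero ⟨p.natDegree, hlt⟩
  exact one_ne_zero (hmonic.coeff_natDegree.symm.trans h3)

end Orbits

namespace IsNormalised

variable {𝕜 : Type*} [Field 𝕜] {V : Type*} [AddCommGroup V] [Module 𝕜 V]
  [FiniteDimensional 𝕜 V] {e : End 𝕜 V} {b : JordanBasis e}
  {B : LinearMap.BilinForm 𝕜 V} {ε : ℤ} {inv : Fin b.n → Fin b.n}
  (hN : b.IsNormalised B ε inv) (hB : B.Nondegenerate) (he : IsNilpotent e) (h2 : (2 : 𝕜) ≠ 0)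
  (hε : ε = 1 ∨ ε = -1) (hsym : ∀ u v, B u v = (ε : 𝕜) * B v u)
  (hskew : LinearMap.IsSkewAdjoint B e)

-- The parity condition found in `𝕜` is read back in `ℤ`, which requires `1 ≠ -1` in `𝕜`.
omit [FiniteDimensional 𝕜 V] in
include hN h2 hε in
theorem inv_eq_of_parity {i : Fin b.n} (h : (ε : 𝕜) * (-1) ^ b.size i = -1) : inv i = i := by
  rw [hN.inv_eq_iff]
  by_contra hne
  have h1 : ε * (-1) ^ b.size i = 1 := by
    rcases hε with rfl | rfl <;> rcases neg_one_pow_eq_or ℤ (b.size i) with h | h <;> simp_all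
  have h3 : (ε : 𝕜) * (-1) ^ b.size i = 1 := by exact_mod_cast congrArg (Int.cast (R := 𝕜)) h1
  rw [h3] at h
  apply h2
  linear_combination h

include hN hB he h2 hε hsym hskew in
/-- An element of the centraliser which conjugates the diagonal algebra to a self-adjoint algebra
may be modified so that the adjunction permutes the images of the block projections by the
given involution. -/
theorem exists_adj_pullForm_blockProj {S : Subalgebra 𝕜 (End 𝕜 V)}
    (hS : ∀ x ∈ S, adj hB x ∈ S) (hSe : ∀ x ∈ S, Commute x e) {g : GCent e}
    (hg : ∀ x : End 𝕜 V, x ∈ S ↔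
      ((g.1⁻¹ : LinearMap.GeneralLinearGroup 𝕜 V) : End 𝕜 V) * x * g.1 ∈ b.diag)
    {y : End 𝕜 V} (hyS : y ∈ S) (hyadj : adj hB y = y)
    (hli : LinearIndependent 𝕜 fun j : Fin (Finset.univ.filter fun i => i ≤ inv i).card =>
      (Matrix.toLin' (b.headMatrix y) : End 𝕜 (Fin b.n → 𝕜)) ^ (j : ℕ)) :
    ∃ g : GCent e, (∀ x : End 𝕜 V, x ∈ S ↔
      ((g.1⁻¹ : LinearMap.GeneralLinearGroup 𝕜 V) : End 𝕜 V) * x * g.1 ∈ b.diag) ∧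
      ∀ i, adj (pullForm_nondegenerate hB g.1) (b.blockProj i) = b.blockProj (inv i) := by
  have hεε : (ε : 𝕜) * ε = 1 := by rcases hε with rfl | rfl <;> simp
  have hge : Commute (g.1 : End 𝕜 V) e := mem_GCent.1 g.2
  have hgg : (g.1 : End 𝕜 V) * ((g.1⁻¹ : LinearMap.GeneralLinearGroup 𝕜 V) : End 𝕜 V) = 1 :=
    Units.mul_inv _
  have hgg' : ((g.1⁻¹ : LinearMap.GeneralLinearGroup 𝕜 V) : End 𝕜 V) * (g.1 : End 𝕜 V) = 1 :=
    Units.inv_mul _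
  have hB' := pullForm_nondegenerate hB g.1
  have hsym' : ∀ u v, pullForm B (g.1 : End 𝕜 V) u v = ε * pullForm B (g.1 : End 𝕜 V) v u :=
    fun u v => hsym _ _
  have hskew' : LinearMap.IsSkewAdjoint (pullForm B (g.1 : End 𝕜 V)) e :=
    pullForm_isSkewAdjoint hskew hge
  have hdiag : ∀ x ∈ b.diag, adj hB' x ∈ b.diag := by
    intro x hx
    rw [adj_pullForm hB, ← hg]
    refine hS _ ((hg _).2 ?_)
    have h3 : ((g.1⁻¹ : LinearMap.GeneralLinearGroup 𝕜 V) : End 𝕜 V) *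
        ((g.1 : End 𝕜 V) * x * ((g.1⁻¹ : LinearMap.GeneralLinearGroup 𝕜 V) : End 𝕜 V)) *
          (g.1 : End 𝕜 V) = x := by
      rw [mul_assoc, mul_assoc, mul_assoc, hgg', mul_one, ← mul_assoc, hgg', one_mul]
    rw [h3]
    exact hx
  obtain ⟨π, hπ2, hπ⟩ := b.exists_adj_blockProj hB' hεε hsym' he hdiag
  have hπsize := b.size_adj_eq hB' hskew' hπ hπ2
  have hfix : ∀ i, π i = i → inv i = i := fun i hi =>
    hN.inv_eq_of_parity h2 hε (b.parity_of_adj_blockProj hB' hsym' hskew' hπ hi)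
  -- the block scalars of the image of `y`
  set z : End 𝕜 V := ((g.1⁻¹ : LinearMap.GeneralLinearGroup 𝕜 V) : End 𝕜 V) * y * g.1 with hz
  have hzd : z ∈ b.diag := (hg y).1 hyS
  have hgz : (g.1 : End 𝕜 V) * z = y * g.1 := by
    rw [hz, ← mul_assoc, ← mul_assoc, hgg, one_mul]
  have hzadj : adj hB' z = z := by
    rw [adj_pullForm hB, hgz, mul_assoc y, hgg, mul_one, hyadj]
  -- Self-adjointness makes the block scalars of `z` invariant under `π`, so `π` has at least as
  -- many orbits as `inv`. Together with `hfix` this gives equal fixed points.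
  have hcard := b.card_le_of_blockScalar_invariant hπ2 hzd
    (b.blockScalar_perm hB' he hπ hzd hzadj) (hSe y hyS) hge hgz hli
  have hfix' := fixed_iff_of_card_le hN.involutive hπ2 hfix hcard
  obtain ⟨σ, hσsize, hσ⟩ := exists_conj_of_involutions (κ := b.size)
    (τ := Function.Involutive.toPerm inv hN.involutive) (π := π) hN.involutive hπ2
    hN.size_inv hπsize hfix'
  -- the permutation of the blocks
  obtain ⟨τ, hτ⟩ := b.exists_gCent_gen (v := fun i => b.gen (σ i))
    (fun i => by rw [← hσsize i, b.pow_size]) (fun S hS heS => by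
      have hall : ∀ i s, (e ^ s) (b.gen i) ∈ S := by
        intro i s
        induction s with
        | zero => simpa using hS (σ.symm i)
        | succ s ih =>
          rw [pow_succ', Module.End.mul_apply]
          exact heS _ ih
      rw [eq_top_iff, ← b.basis.span_eq, Submodule.span_le]
      rintro _ ⟨p, rfl⟩
      rw [b.basis_apply]
      exact hall _ _)
  have hτe : Commute (τ.1 : End 𝕜 V) e := mem_GCent.1 τ.2
  have hττ : (τ.1 : End 𝕜 V) * ((τ.1⁻¹ : LinearMap.GeneralLinearGroup 𝕜 V) : End 𝕜 V) = 1 :=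
    Units.mul_inv _
  have hττ' : ((τ.1⁻¹ : LinearMap.GeneralLinearGroup 𝕜 V) : End 𝕜 V) * (τ.1 : End 𝕜 V) = 1 :=
    Units.inv_mul _
  have hτe' : Commute ((τ.1⁻¹ : LinearMap.GeneralLinearGroup 𝕜 V) : End 𝕜 V) e :=
    mem_GCent.1 (inv_mem τ.2)
  have hτproj : ∀ i, (τ.1 : End 𝕜 V) * b.blockProj i = b.blockProj (σ i) * τ.1 := by
    intro i
    refine b.ext_gen (hτe.mul_left (b.commute_blockProj i))
      ((b.commute_blockProj _).mul_left hτe) fun k => ?_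
    rw [Module.End.mul_apply, Module.End.mul_apply, hτ, blockProj_gen, blockProj_gen]
    by_cases hk : k = i
    · subst hk
      rw [if_pos rfl, if_pos rfl, hτ]
    · rw [if_neg hk, if_neg fun h => hk (σ.injective h), map_zero]
  have hτproj' : ∀ i, ((τ.1⁻¹ : LinearMap.GeneralLinearGroup 𝕜 V) : End 𝕜 V) *
      b.blockProj (σ i) * τ.1 = b.blockProj i := by
    intro i
    rw [mul_assoc, ← hτproj, ← mul_assoc, hττ', one_mul]
  have hτdiag : ∀ x, x ∈ b.diag ↔
      ((τ.1⁻¹ : LinearMap.GeneralLinearGroup 𝕜 V) : End 𝕜 V) * x * τ.1 ∈ b.diag := by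
    intro x
    have h3 : (τ.1 : End 𝕜 V) * (((τ.1⁻¹ : LinearMap.GeneralLinearGroup 𝕜 V) : End 𝕜 V) * x *
        τ.1) = x * τ.1 := by
      rw [← mul_assoc, ← mul_assoc, hττ, one_mul]
    constructor
    · intro hx
      obtain ⟨hxe, hxp⟩ := b.mem_diag.1 hx
      refine b.mem_diag.2 ⟨(hτe'.mul_left hxe).mul_left hτe, fun i => ?_⟩
      have h4 := (hxp (σ i)).eq
      rw [commute_iff_eq]
      calc _ = ((τ.1⁻¹ : LinearMap.GeneralLinearGroup 𝕜 V) : End 𝕜 V) * (x * b.blockProj (σ i)) *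
            τ.1 := by
            rw [mul_assoc _ (τ.1 : End 𝕜 V), hτproj]
            simp only [mul_assoc]
        _ = b.blockProj i * (((τ.1⁻¹ : LinearMap.GeneralLinearGroup 𝕜 V) : End 𝕜 V) * x *
            τ.1) := by
            rw [h4, ← hτproj' i]
            simp only [mul_assoc]
            rw [← mul_assoc (τ.1 : End 𝕜 V) _ (x * _), hττ, one_mul]
    · intro hx
      obtain ⟨hxe, hxp⟩ := b.mem_diag.1 hx
      set x' := ((τ.1⁻¹ : LinearMap.GeneralLinearGroup 𝕜 V) : End 𝕜 V) * x * τ.1 with hx'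
      have h5 : x = (τ.1 : End 𝕜 V) * x' *
          ((τ.1⁻¹ : LinearMap.GeneralLinearGroup 𝕜 V) : End 𝕜 V) := by
        rw [h3, mul_assoc, hττ, mul_one]
      rw [h5]
      refine b.mem_diag.2 ⟨(hτe.mul_left hxe).mul_left hτe', fun i => ?_⟩
      obtain ⟨j, rfl⟩ := σ.surjective i
      have h6 : ((τ.1⁻¹ : LinearMap.GeneralLinearGroup 𝕜 V) : End 𝕜 V) * b.blockProj (σ j) =
          b.blockProj j * ((τ.1⁻¹ : LinearMap.GeneralLinearGroup 𝕜 V) : End 𝕜 V) := by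
        rw [← hτproj' j, mul_assoc _ (τ.1 : End 𝕜 V), hττ, mul_one]
      rw [commute_iff_eq, mul_assoc, h6, ← mul_assoc, mul_assoc (τ.1 : End 𝕜 V), (hxp j).eq,
        ← mul_assoc, hτproj]
      simp only [mul_assoc]
  have hinvmul : (((g * τ).1⁻¹ : LinearMap.GeneralLinearGroup 𝕜 V) : End 𝕜 V) =
      ((τ.1⁻¹ : LinearMap.GeneralLinearGroup 𝕜 V) : End 𝕜 V) *
        ((g.1⁻¹ : LinearMap.GeneralLinearGroup 𝕜 V) : End 𝕜 V) := by
    rw [Subgroup.coe_mul, mul_inv_rev, Units.val_mul]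
  refine ⟨g * τ, fun x => ?_, fun i => ?_⟩
  · rw [hg, hτdiag, hinvmul, Subgroup.coe_mul, Units.val_mul]
    simp only [mul_assoc]
  · rw [← hτproj' i, ← hτproj' (inv i)]
    refine adj_eq _ fun u v => ?_
    have h7 := adj_left hB' (b.blockProj (σ i)) ((τ.1 : End 𝕜 V) u) ((τ.1 : End 𝕜 V) v)
    have h8 : σ (inv i) = π (σ i) := hσ i
    rw [hπ] at h7
    have h9 : ∀ u, (τ.1 : End 𝕜 V) (((τ.1⁻¹ : LinearMap.GeneralLinearGroup 𝕜 V) : End 𝕜 V) u) = u :=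
      fun u => LinearMap.congr_fun hττ u
    simp only [pullForm_apply, Subgroup.coe_mul, Units.val_mul, Module.End.mul_apply, h8, h9]
      at h7 ⊢
    exact h7

include hN hB h2 hε hsym hskew in
/-- Correction of an element of the centraliser to an isometry, by a polar decomposition. -/
theorem exists_isometry [IsAlgClosed 𝕜] {S : Subalgebra 𝕜 (End 𝕜 V)} {g : GCent e}
    (hg : ∀ x : End 𝕜 V, x ∈ S ↔
      ((g.1⁻¹ : LinearMap.GeneralLinearGroup 𝕜 V) : End 𝕜 V) * x * g.1 ∈ b.diag)
    (hadj : ∀ i, adj (pullForm_nondegenerate hB g.1) (b.blockProj i) = b.blockProj (inv i)) :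
    ∃ g : KCent B e, ∀ x : End 𝕜 V, x ∈ S ↔
      ((g.1.1⁻¹ : LinearMap.GeneralLinearGroup 𝕜 V) : End 𝕜 V) * x * g.1.1 ∈ b.diag := by
  have hεε : (ε : 𝕜) * ε = 1 := by rcases hε with rfl | rfl <;> simp
  have hge : Commute (g.1 : End 𝕜 V) e := mem_GCent.1 g.2
  obtain ⟨z, hz⟩ : ∃ z : End 𝕜 V, z = adj hB (g.1 : End 𝕜 V) * g.1 := ⟨_, rfl⟩
  have hBz : ∀ u v, B ((g.1 : End 𝕜 V) u) ((g.1 : End 𝕜 V) v) = B u (z v) := by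
    intro u v
    rw [hz, Module.End.mul_apply, adj_right hB hεε hsym]
  have hzadj : adj hB z = z := by rw [hz, adj_mul, adj_adj hB hεε hsym]
  have hze : Commute z e := hz ▸ (adj_commute hB hskew hge).mul_left hge
  -- The original and the transported form give the block projections the same adjoints, and they
  -- differ by `z`; so `z` commutes with the projections.
  have hzd : z ∈ b.diag := by
    refine b.mem_diag.2 ⟨hze, fun i => ?_⟩
    have h3 : adj hB (z * b.blockProj i) = adj hB (b.blockProj i * z) := by
      refine ext_bilin hB fun u v => ?_
      rw [adj_left, adj_left, Module.End.mul_apply, Module.End.mul_apply, ← hBz]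
      have h4 := adj_left (pullForm_nondegenerate hB g.1) (b.blockProj i) u v
      have h5 := adj_left hB (b.blockProj i) u (z v)
      rw [hadj, pullForm_apply, pullForm_apply] at h4
      rw [hN.adj_blockProj hB, ← hBz] at h5
      rw [← h4, h5]
    have h6 := congrArg (adj hB) h3
    rwa [adj_adj hB hεε hsym, adj_adj hB hεε hsym] at h6
  have hzu : IsUnit z := by
    have h3 : IsUnit (adj hB (g.1 : End 𝕜 V)) := by
      refine ⟨⟨adj hB (g.1 : End 𝕜 V),
        adj hB ((g.1⁻¹ : LinearMap.GeneralLinearGroup 𝕜 V) : End 𝕜 V), ?_, ?_⟩, rfl⟩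
      · rw [← adj_mul, Units.inv_mul, adj_one]
      · rw [← adj_mul, Units.mul_inv, adj_one]
    exact hz ▸ h3.mul g.1.isUnit
  obtain ⟨p, hpz, hpp, hpu⟩ := exists_sqrt_mem_adjoin h2 hzu
  have hpd : p ∈ b.diag := Algebra.adjoin_le (S := b.diag) (by simpa using hzd) hpz
  have hpadj : adj hB p = p := by
    have hq : ∀ q : Polynomial 𝕜, adj hB (Polynomial.aeval z q) = Polynomial.aeval z q := by
      intro q
      induction q using Polynomial.induction_on' with
      | add p q hp hq => rw [map_add, map_add, hp, hq]
      | monomial k c =>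
        rw [Polynomial.aeval_monomial, ← Algebra.smul_def, map_smul, adj_pow, hzadj]
    rw [Algebra.adjoin_singleton_eq_range_aeval] at hpz
    obtain ⟨q, rfl⟩ := hpz
    exact hq q
  obtain ⟨ρ, hρ⟩ := hpu
  have hρd : ((ρ⁻¹ : LinearMap.GeneralLinearGroup 𝕜 V) : End 𝕜 V) ∈ b.diag := by
    obtain ⟨hpe, hpp'⟩ := b.mem_diag.1 hpd
    rw [← hρ] at hpe hpp'
    exact b.mem_diag.2 ⟨hpe.units_inv_left, fun i => (hpp' i).units_inv_left⟩
  have hρG : ρ ∈ GCent e := mem_GCent.2 (by rw [hρ]; exact (b.mem_diag.1 hpd).1)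
  have hρinv : ∀ v, p (((ρ⁻¹ : LinearMap.GeneralLinearGroup 𝕜 V) : End 𝕜 V) v) = v := by
    intro v
    rw [← hρ, ← Module.End.mul_apply, Units.mul_inv, Module.End.one_apply]
  -- Here `ρ` is the self-adjoint root `p` of `g* g`, so `g ρ⁻¹` preserves the form; conjugation by
  -- `ρ ∈ diag` preserves `diag`.
  refine ⟨⟨g * (⟨ρ, hρG⟩ : GCent e)⁻¹, fun u v => ?_⟩, fun x => ?_⟩
  · change B ((g.1 : End 𝕜 V) (((ρ⁻¹ : LinearMap.GeneralLinearGroup 𝕜 V) : End 𝕜 V) u))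
      ((g.1 : End 𝕜 V) (((ρ⁻¹ : LinearMap.GeneralLinearGroup 𝕜 V) : End 𝕜 V) v)) = B u v
    rw [hBz, ← hpp, Module.End.mul_apply, hρinv, ← adj_left hB, hpadj, hρinv]
  · have h3 : (((g * (⟨ρ, hρG⟩ : GCent e)⁻¹).1⁻¹ : LinearMap.GeneralLinearGroup 𝕜 V) :
        End 𝕜 V) = p * ((g.1⁻¹ : LinearMap.GeneralLinearGroup 𝕜 V) : End 𝕜 V) := by
      rw [← hρ, ← Units.val_mul]
      congr 1
    have h4 : (((g * (⟨ρ, hρG⟩ : GCent e)⁻¹).1 : LinearMap.GeneralLinearGroup 𝕜 V) :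
        End 𝕜 V) = g.1 * ((ρ⁻¹ : LinearMap.GeneralLinearGroup 𝕜 V) : End 𝕜 V) := rfl
    rw [hg, h3, h4]
    set y := ((g.1⁻¹ : LinearMap.GeneralLinearGroup 𝕜 V) : End 𝕜 V) * x * g.1 with hy
    have h5 : p * ((g.1⁻¹ : LinearMap.GeneralLinearGroup 𝕜 V) : End 𝕜 V) * x *
        (g.1 * ((ρ⁻¹ : LinearMap.GeneralLinearGroup 𝕜 V) : End 𝕜 V)) =
        p * y * ((ρ⁻¹ : LinearMap.GeneralLinearGroup 𝕜 V) : End 𝕜 V) := by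
      rw [hy]
      simp only [mul_assoc]
    rw [h5]
    constructor
    · intro h
      exact b.diag.mul_mem (b.diag.mul_mem hpd h) hρd
    · intro h
      have h6 := b.diag.mul_mem (b.diag.mul_mem hρd h) hpd
      rw [← hρ] at h6
      rwa [mul_assoc, mul_assoc, Units.inv_mul, mul_one, ← mul_assoc, Units.inv_mul, one_mul] at h6

end IsNormalised

end JordanBasis

end CentGen

namespace CentGen

/-! ### Conjugacy by isometries, and genericity for `K_e`. -/

namespace JordanBasis

namespace IsNormalised

variable {𝕜 : Type*} [Field 𝕜] {V : Type*} [AddCommGroup V] [Module 𝕜 V]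
  [FiniteDimensional 𝕜 V] {e : End 𝕜 V} {b : JordanBasis e}
  {B : LinearMap.BilinForm 𝕜 V} {ε : ℤ} {inv : Fin b.n → Fin b.n}
  (hN : b.IsNormalised B ε inv) (hB : B.Nondegenerate) (he : IsNilpotent e) (h2 : (2 : 𝕜) ≠ 0)
  (hε : ε = 1 ∨ ε = -1) (hsym : ∀ u v, B u v = (ε : 𝕜) * B v u)
  (hskew : LinearMap.IsSkewAdjoint B e)

include hN in
theorem adj_diagElt {d : Fin b.n → 𝕜} (hd : ∀ i, d (inv i) = d i) :
    adj hB (b.diagElt d) = b.diagElt d := by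
  rw [diagElt, map_sum, ← Equiv.sum_comp (Function.Involutive.toPerm inv hN.involutive)
    fun i => d i • b.blockProj i]
  refine Finset.sum_congr rfl fun i _ => ?_
  rw [map_smul, hN.adj_blockProj hB, Function.Involutive.coe_toPerm, hd]

include hN hB he h2 hε hsym hskew in
/-- In a linear family of forms on `𝔤_e` which contains `α` and in which all forms have the symmetry
of `α` under the adjunction, the stabilisers are conjugate to that of `α` near `α` by isometries. -/
theorem exists_isometry_conj_symStab [IsAlgClosed 𝕜] {a : Fin b.n → 𝕜}
    {W : Type*} [AddCommGroup W] [Module 𝕜 W] (ι : W →ₗ[𝕜] Dual 𝕜 (gCent e)) {w₀ : W}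
    (hι : ∀ w (M : Dual 𝕜 (End 𝕜 V)), (∀ y : gCent e, M y = ι w y) →
      ∀ x, Commute x e → M (adj hB x) = ε * M x)
    (ha : Function.Injective a)
    (ha0 : ∀ i j, b.size j < b.size i → a i ≠ 0) (hw₀ : ι w₀ = b.alpha a) :
    ∃ δ ∈ polyFun 𝕜 W, δ w₀ ≠ 0 ∧ ∀ w, δ w ≠ 0 → ∀ M : Dual 𝕜 (End 𝕜 V),
      (∀ y : gCent e, M y = ι w y) → ∃ g : KCent B e, ∀ x : End 𝕜 V, x ∈ symStab e M ↔
        ((g.1.1⁻¹ : LinearMap.GeneralLinearGroup 𝕜 V) : End 𝕜 V) * x * g.1.1 ∈ b.diag := by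
  have : Infinite 𝕜 := IsAlgClosed.instInfinite
  have hεε : (ε : 𝕜) * ε = 1 := by rcases hε with rfl | rfl <;> simp
  obtain ⟨δ₁, hδ₁, h₁, hconj⟩ := b.exists_conj_symStab ι he ha ha0 hw₀
  set θ := Infinite.natEmbedding 𝕜
  -- Labelling by the least member of the orbit gives scalars constant on orbits and distinct on
  -- different orbits.
  let d : Fin b.n → 𝕜 := fun i => θ (min i (inv i) : Fin b.n)
  have hd : ∀ i, d (inv i) = d i := fun i => by
    simp only [d, hN.involutive i, min_comm]
  obtain ⟨δ₂, hδ₂, x, hx, h₂, hxw₀, hxmem⟩ :=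
    b.exists_symStab_section ι ha ha0 hw₀ (b.diagElt_mem_diag d)
  -- Symmetrising the section gives a self-adjoint one with value `2 • diagElt d` at `w₀`; it has
  -- one eigenvalue per orbit of `inv` on `V / e V`.
  let y : W → End 𝕜 V := fun w => x w + adj hB (x w)
  have hy : IsPolyMap 𝕜 y := hx.add (hx.linear_comp (adj hB))
  have hyadj : ∀ w, adj hB (y w) = y w := fun w => by
    simp only [y, map_add, adj_adj hB hεε hsym, add_comm]
  let f : End 𝕜 V →ₗ[𝕜] End 𝕜 (Fin b.n → 𝕜) := Matrix.toLin'.toLinearMap ∘ₗ b.headMatrix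
  have hf : ∀ z, f z = Matrix.toLin' (b.headMatrix z) := fun z => rfl
  set T := Finset.univ.filter fun i => i ≤ inv i with hT
  let c : Fin T.card → 𝕜 := fun j => 2 * d (T.orderEmbOfFin rfl j)
  have hTmem : ∀ j, T.orderEmbOfFin rfl j ≤ inv (T.orderEmbOfFin rfl j) := fun j =>
    (Finset.mem_filter.1 (T.orderEmbOfFin_mem rfl j)).2
  have hc : Function.Injective c := by
    intro i j h
    have h3 := θ.injective (mul_left_cancel₀ h2 h)
    rw [min_eq_left (hTmem i), min_eq_left (hTmem j)] at h3
    exact (T.orderEmbOfFin rfl).injective (Fin.ext h3)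
  have hli : LinearIndependent 𝕜 fun j : Fin T.card => f (y w₀) ^ (j : ℕ) := by
    refine linearIndependent_pow_of_eigenvalues hc fun j => ?_
    have h3 : y w₀ = (2 : 𝕜) • b.diagElt d := by
      simp only [y, hxw₀, hN.adj_diagElt hB hd, two_smul]
    rw [h3, map_smul, hf, headMatrix_diagElt]
    refine Module.End.hasEigenvalue_of_hasEigenvector
      (x := Pi.single (T.orderEmbOfFin rfl j) 1) ⟨Module.End.mem_eigenspace_iff.2 ?_, ?_⟩
    · rw [LinearMap.smul_apply, Matrix.toLin'_apply, Matrix.diagonal_mulVec_single, mul_one,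
        ← Pi.single_smul, ← Pi.single_smul, smul_eq_mul, smul_eq_mul, mul_one]
    · intro h
      simpa using congrFun h (T.orderEmbOfFin rfl j)
  obtain ⟨δ₃, hδ₃, h₃, hli₃⟩ := exists_linearIndependent
    (fun w (j : Fin T.card) => f (y w) ^ (j : ℕ)) w₀ (fun j => (hy.linear_comp f).pow j) hli
  refine ⟨_, (polyFun 𝕜 W).mul_mem ((polyFun 𝕜 W).mul_mem hδ₁ hδ₂) hδ₃,
    mul_ne_zero (mul_ne_zero h₁ h₂) h₃, fun w hw M hM => ?_⟩
  have hw₃ := right_ne_zero_of_mul hw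
  have hw₁ := left_ne_zero_of_mul (left_ne_zero_of_mul hw)
  have hw₂ := right_ne_zero_of_mul (left_ne_zero_of_mul hw)
  obtain ⟨g, hg⟩ := hconj w hw₁ M hM
  have hS : ∀ x ∈ symStab e M, adj hB x ∈ symStab e M := fun x hx =>
    adj_mem_symStab hB hεε hsym hskew (hι w M hM) hx
  have hxM := hxmem w hw₂ M hM
  obtain ⟨g', hg', hadj⟩ := hN.exists_adj_pullForm_blockProj hB he h2 hε hsym hskew hS
    (fun x hx => (mem_symStab.1 hx).1) hg ((symStab e M).add_mem hxM (hS _ hxM)) (hyadj w)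
    (hli₃ w hw₃)
  exact hN.exists_isometry hB h2 hε hsym hskew hg' hadj

include hN hB he h2 hε hsym hskew in
/-- Genericity of the restriction of `α` to a quotient of `𝔤_e` as a `𝔨_e`-module on which the
adjunction acts by `± 1`. -/
theorem isGenericPoint_of_proj [IsAlgClosed 𝕜] {a : Fin b.n → 𝕜}
    {U : Type*} [AddCommGroup U] [Module 𝕜 U] [LieRingModule (kCent B e) U]
    [LieModule 𝕜 (kCent B e) U] (P : gCent e →ₗ[𝕜] U) (hP : Function.Surjective P)
    (hPlie : ∀ (x : kCent B e) (y : gCent e), P ⁅(x : gCent e), y⁆ = ⁅x, P y⁆)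
    (hPadj : ∀ x y : gCent e, adj hB x = y → P y = (ε : 𝕜) • P x)
    (ha : Function.Injective a) (ha0 : ∀ i j, b.size j < b.size i → a i ≠ 0)
    {φ₀ : Dual 𝕜 U} (hφ₀ : φ₀ ∘ₗ P = b.alpha a) : IsGenericPoint 𝕜 (AdK B e) φ₀ := by
  have : Infinite 𝕜 := IsAlgClosed.instInfinite
  let ι : Dual 𝕜 U →ₗ[𝕜] Dual 𝕜 (gCent e) := P.dualMap
  have hι : ∀ w (M : Dual 𝕜 (End 𝕜 V)), (∀ y : gCent e, M y = ι w y) →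
      ∀ x, Commute x e → M (adj hB x) = ε * M x := by
    intro w M hM x hx
    have h3 := hM ⟨x, mem_gCent.2 hx.eq⟩
    have h4 := hM ⟨adj hB x, mem_gCent.2 (adj_commute hB hskew hx).eq⟩
    change M x = w (P _) at h3
    change M (adj hB x) = w (P _) at h4
    rw [h3, h4, hPadj ⟨x, mem_gCent.2 hx.eq⟩ _ rfl, map_smul, smul_eq_mul]
  obtain ⟨δ, hδ, h1, h3⟩ := hN.exists_isometry_conj_symStab hB he h2 hε hsym hskew ι hι ha ha0 hφ₀
  -- As `P` is equivariant and surjective, the stabiliser of `φ` in `𝔨_e` is `𝔨_e` intersected with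
  -- the stabiliser of `φ ∘ P` in `𝔤_e`.
  have hstab : ∀ (φ : Dual 𝕜 U) (x : kCent B e),
      x ∈ lieStab 𝕜 (kCent B e) φ ↔ (x : gCent e) ∈ lieStab 𝕜 (gCent e) (ι φ) := by
    intro φ x
    have h4 : ∀ y : gCent e, ⁅x, φ⁆ (P y) = ⁅(x : gCent e), ι φ⁆ y := by
      intro y
      rw [Module.Dual.lie_apply, Module.Dual.lie_apply, ← hPlie]
      rfl
    constructor
    · intro hx
      have hx' : ⁅x, φ⁆ = 0 := hx
      change ⁅(x : gCent e), ι φ⁆ = 0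
      refine LinearMap.ext fun y => ?_
      rw [← h4, hx', LinearMap.zero_apply, LinearMap.zero_apply]
    · intro hx
      have hx' : ⁅(x : gCent e), ι φ⁆ = 0 := hx
      change ⁅x, φ⁆ = 0
      refine LinearMap.ext fun u => ?_
      obtain ⟨y, rfl⟩ := hP u
      rw [h4, hx', LinearMap.zero_apply, LinearMap.zero_apply]
  refine ⟨_, isZariskiOpen_ne hδ, ⟨_, h1⟩, fun φ hφ => ?_⟩
  obtain ⟨M, hM⟩ := exists_extend_gCent (ι φ)
  obtain ⟨g, hg⟩ := h3 φ hφ M hM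
  refine ⟨g, ?_⟩
  have key : ∀ x : kCent B e, x ∈ lieStab 𝕜 (kCent B e) φ ↔
      AdK B e g⁻¹ x ∈ lieStab 𝕜 (kCent B e) φ₀ := by
    intro x
    rw [hstab, hstab, show ι φ₀ = b.alpha a from hφ₀, mem_lieStab_iff_symStab hM, hg,
      mem_lieStab_iff_symStab (b.alphaEnd_coe a), b.symStab_alphaEnd ha ha0]
    have h4 : (((AdK B e g⁻¹ x : kCent B e) : gCent e) : End 𝕜 V) =
        ((g.1.1⁻¹ : LinearMap.GeneralLinearGroup 𝕜 V) : End 𝕜 V) * x.1.1 * g.1.1 := by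
      change ((g⁻¹).1.1 : End 𝕜 V) * x.1.1 *
        (((g⁻¹).1.1⁻¹ : LinearMap.GeneralLinearGroup 𝕜 V) : End 𝕜 V) = _
      simp
    rw [h4]
  ext x
  rw [key]
  constructor
  · rintro ⟨y, hy, rfl⟩
    rw [← Module.End.mul_apply, ← map_mul, inv_mul_cancel, map_one, Module.End.one_apply]
    exact hy
  · intro hx
    refine ⟨_, hx, ?_⟩
    rw [← Module.End.mul_apply, ← map_mul, mul_inv_cancel, map_one, Module.End.one_apply]

end IsNormalised

end JordanBasis

end CentGen

namespace CentGen

/-! ### The decomposition of `𝔤_e` into `𝔨_e` and `𝔭_e`. -/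

section SymmetricPair

variable {𝕜 : Type*} [Field 𝕜] {V : Type*} [AddCommGroup V] [Module 𝕜 V]
  [FiniteDimensional 𝕜 V] {e : End 𝕜 V} {B : LinearMap.BilinForm 𝕜 V} (hB : B.Nondegenerate)

theorem mem_kCent_iff_adj {x : gCent e} : x ∈ kCent B e ↔ adj hB (x : End 𝕜 V) = -x := by
  rw [mem_kCent]
  constructor
  · intro h
    refine adj_eq hB fun u v => ?_
    rw [LinearMap.neg_apply, map_neg, LinearMap.neg_apply, h, neg_neg]
  · intro h u v
    rw [← adj_left hB, h, LinearMap.neg_apply, map_neg, LinearMap.neg_apply, neg_neg]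

theorem mem_pCent_iff_adj {x : gCent e} : x ∈ pCent B e ↔ adj hB (x : End 𝕜 V) = x := by
  constructor
  · intro h
    exact adj_eq hB h
  · intro h u v
    rw [← adj_left hB, h]

variable (hskew : LinearMap.IsSkewAdjoint B e)

/-- The adjunction on the centraliser `𝔤_e`. -/
noncomputable def adjCent : gCent e →ₗ[𝕜] gCent e :=
  (adj hB ∘ₗ (gCent e).toSubmodule.subtype).codRestrict (gCent e).toSubmodule fun x =>
    mem_gCent.2 (adj_commute hB hskew (mem_gCent.1 x.2)).eq

theorem adjCent_lie {x : gCent e} (hx : x ∈ kCent B e) (y : gCent e) :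
    adjCent hB hskew ⁅x, y⁆ = ⁅x, adjCent hB hskew y⁆ := by
  apply Subtype.ext
  change adj hB ((x : End 𝕜 V) * y - y * x) = (x : End 𝕜 V) * adj hB y - adj hB y * x
  rw [map_sub, adj_mul, adj_mul, (mem_kCent_iff_adj hB).1 hx, mul_neg, neg_mul]
  abel

variable {ε : 𝕜} (hε : ε * ε = 1) (hsym : ∀ u v, B u v = ε * B v u)

include hε hsym in
theorem adjCent_adjCent (x : gCent e) : adjCent hB hskew (adjCent hB hskew x) = x :=
  Subtype.ext (adj_adj hB hε hsym _)

/-- The projection of `𝔤_e` onto `𝔨_e` along `𝔭_e`. -/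
noncomputable def kProj : gCent e →ₗ[𝕜] kCent B e :=
  ((2⁻¹ : 𝕜) • (LinearMap.id - adjCent hB hskew)).codRestrict (kCent B e).toSubmodule fun x => by
    change _ ∈ kCent B e
    rw [mem_kCent_iff_adj hB]
    change adj hB ((2⁻¹ : 𝕜) • ((x : End 𝕜 V) - adj hB x)) = -((2⁻¹ : 𝕜) • ((x : End 𝕜 V) - adj hB x))
    rw [map_smul, map_sub, adj_adj hB hε hsym, ← smul_neg, neg_sub]

theorem coe_kProj (x : gCent e) :
    (kProj hB hskew hε hsym x : gCent e) = (2⁻¹ : 𝕜) • (x - adjCent hB hskew x) := rfl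

/-- The projection of `𝔤_e` onto `𝔭_e` along `𝔨_e`. -/
noncomputable def pProj : gCent e →ₗ[𝕜] pCent B e :=
  ((2⁻¹ : 𝕜) • (LinearMap.id + adjCent hB hskew)).codRestrict (pCent B e).toSubmodule fun x => by
    change _ ∈ pCent B e
    rw [mem_pCent_iff_adj hB]
    change adj hB ((2⁻¹ : 𝕜) • ((x : End 𝕜 V) + adj hB x)) = (2⁻¹ : 𝕜) • ((x : End 𝕜 V) + adj hB x)
    rw [map_smul, map_add, adj_adj hB hε hsym, add_comm]

theorem coe_pProj (x : gCent e) :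
    (pProj hB hskew hε hsym x : gCent e) = (2⁻¹ : 𝕜) • (x + adjCent hB hskew x) := rfl

theorem kProj_surjective (h2 : (2 : 𝕜) ≠ 0) : Function.Surjective (kProj hB hskew hε hsym) := by
  intro x
  refine ⟨x, Subtype.ext ?_⟩
  have h : adjCent hB hskew (x : gCent e) = -(x : gCent e) :=
    Subtype.ext ((mem_kCent_iff_adj hB).1 x.2)
  rw [coe_kProj, h, sub_neg_eq_add, ← two_smul 𝕜, inv_smul_smul₀ h2]

theorem pProj_surjective (h2 : (2 : 𝕜) ≠ 0) : Function.Surjective (pProj hB hskew hε hsym) := by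
  intro x
  refine ⟨x, Subtype.ext ?_⟩
  have h : adjCent hB hskew (x : gCent e) = (x : gCent e) :=
    Subtype.ext ((mem_pCent_iff_adj hB).1 x.2)
  rw [coe_pProj, h, ← two_smul 𝕜, inv_smul_smul₀ h2]

theorem kProj_lie (x : kCent B e) (y : gCent e) :
    kProj hB hskew hε hsym ⁅(x : gCent e), y⁆ = ⁅x, kProj hB hskew hε hsym y⁆ := by
  apply Subtype.ext
  rw [LieSubalgebra.coe_bracket, coe_kProj, coe_kProj, adjCent_lie hB hskew x.2, lie_smul, lie_sub]

theorem pProj_lie (x : kCent B e) (y : gCent e) :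
    pProj hB hskew hε hsym ⁅(x : gCent e), y⁆ = ⁅x, pProj hB hskew hε hsym y⁆ := by
  apply Subtype.ext
  rw [LieSubmodule.coe_bracket, coe_pProj, coe_pProj, adjCent_lie hB hskew x.2, lie_smul, lie_add]
  rfl

theorem kProj_adjCent (x : gCent e) :
    kProj hB hskew hε hsym (adjCent hB hskew x) = -kProj hB hskew hε hsym x := by
  apply Subtype.ext
  rw [coe_kProj, NegMemClass.coe_neg, coe_kProj, adjCent_adjCent hB hskew hε hsym, ← smul_neg,
    neg_sub]

theorem pProj_adjCent (x : gCent e) :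
    pProj hB hskew hε hsym (adjCent hB hskew x) = pProj hB hskew hε hsym x := by
  apply Subtype.ext
  rw [coe_pProj, coe_pProj, adjCent_adjCent hB hskew hε hsym, add_comm]

end SymmetricPair

/-! ### The symplectic and orthogonal cases. -/

namespace JordanBasis.IsNormalised

variable {𝕜 : Type*} [Field 𝕜] {V : Type*} [AddCommGroup V] [Module 𝕜 V]
  [FiniteDimensional 𝕜 V] {e : End 𝕜 V} {b : JordanBasis e} {B : LinearMap.BilinForm 𝕜 V}
  {inv : Fin b.n → Fin b.n} {a : Fin b.n → 𝕜}

theorem alpha_adjCent {ε : ℤ} (hN : b.IsNormalised B ε inv) (hB : B.Nondegenerate)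
    (hε : ε = 1 ∨ ε = -1) (hsym : ∀ u v, B u v = (ε : 𝕜) * B v u)
    (hskew : LinearMap.IsSkewAdjoint B e) (hinv : ∀ i, inv i ≠ i → a (inv i) = - a i)
    (x : gCent e) : b.alpha a (adjCent hB hskew x) = ε * b.alpha a x := by
  rw [← alphaEnd_coe, ← alphaEnd_coe]
  exact hN.alphaEnd_adj hB hε hsym hskew hinv x

/-- The symplectic case. -/
theorem isGenericPoint_alpha_kCent [IsAlgClosed 𝕜] (hN : b.IsNormalised B (-1) inv) (he : IsNilpotent e)
    (h2 : (2 : 𝕜) ≠ 0) (hB : B.Nondegenerate) (hsym : ∀ u v, B u v = - B v u)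
    (hskew : LinearMap.IsSkewAdjoint B e) (ha : Function.Injective a)
    (ha0 : ∀ i j, b.size j < b.size i → a i ≠ 0) (hinv : ∀ i, inv i ≠ i → a (inv i) = - a i) :
    (∀ x ∈ pCent B e, b.alpha a x = 0) ∧
      IsGenericPoint 𝕜 (AdK B e)
        (b.alpha a ∘ₗ (kCent B e).toSubmodule.subtype : Dual 𝕜 (kCent B e)) := by
  have hsym' : ∀ u v, B u v = ((-1 : ℤ) : 𝕜) * B v u := fun u v => by rw [hsym]; push_cast; ring
  have hεε : ((-1 : ℤ) : 𝕜) * ((-1 : ℤ) : 𝕜) = 1 := by norm_num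
  have hα := hN.alpha_adjCent hB (.inr rfl) hsym' hskew hinv
  refine ⟨fun x hx => ?_, ?_⟩
  -- For self-adjoint `x` the symmetry of `α` with `ε = -1` reads `α(x) = -α(x)`.
  · have h1 : adjCent hB hskew x = x := Subtype.ext ((mem_pCent_iff_adj hB).1 hx)
    have h3 := hα x
    rw [h1] at h3
    push_cast at h3
    refine (mul_eq_zero.1 (?_ : 2 * b.alpha a x = 0)).resolve_left h2
    linear_combination h3
  · refine hN.isGenericPoint_of_proj hB he h2 (.inr rfl) hsym' hskew (kProj hB hskew hεε hsym')
      (kProj_surjective hB hskew hεε hsym' h2) (kProj_lie hB hskew hεε hsym') ?_ ha ha0 ?_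
    · intro x y hxy
      obtain rfl : adjCent hB hskew x = y := Subtype.ext hxy
      rw [kProj_adjCent]
      simp
    · refine LinearMap.ext fun x => ?_
      change b.alpha a (kProj hB hskew hεε hsym' x : gCent e) = _
      rw [coe_kProj, map_smul, map_sub, hα, smul_eq_mul]
      push_cast
      field_simp
      ring

/-- The orthogonal case. -/
theorem isGenericPoint_alpha_pCent [IsAlgClosed 𝕜] (hN : b.IsNormalised B 1 inv) (he : IsNilpotent e)
    (h2 : (2 : 𝕜) ≠ 0) (hB : B.Nondegenerate) (hsym : ∀ u v, B u v = B v u)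
    (hskew : LinearMap.IsSkewAdjoint B e) (ha : Function.Injective a)
    (ha0 : ∀ i j, b.size j < b.size i → a i ≠ 0) (hinv : ∀ i, inv i ≠ i → a (inv i) = - a i) :
    (∀ x ∈ kCent B e, b.alpha a x = 0) ∧
      IsGenericPoint 𝕜 (AdK B e)
        (b.alpha a ∘ₗ (pCent B e).toSubmodule.subtype : Dual 𝕜 (pCent B e)) := by
  have hsym' : ∀ u v, B u v = ((1 : ℤ) : 𝕜) * B v u := fun u v => by rw [hsym]; push_cast; ring
  have hεε : ((1 : ℤ) : 𝕜) * ((1 : ℤ) : 𝕜) = 1 := by norm_num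
  have hα := hN.alpha_adjCent hB (.inl rfl) hsym' hskew hinv
  refine ⟨fun x hx => ?_, ?_⟩
  -- For skew `x` the symmetry of `α` with `ε = 1` reads `-α(x) = α(x)`.
  · have h1 : adjCent hB hskew x = -x := Subtype.ext ((mem_kCent_iff_adj hB).1 hx)
    have h3 := hα x
    rw [h1, map_neg] at h3
    push_cast at h3
    refine (mul_eq_zero.1 (?_ : 2 * b.alpha a x = 0)).resolve_left h2
    linear_combination -h3
  · refine hN.isGenericPoint_of_proj hB he h2 (.inl rfl) hsym' hskew (pProj hB hskew hεε hsym')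
      (pProj_surjective hB hskew hεε hsym' h2) (pProj_lie hB hskew hεε hsym') ?_ ha ha0 ?_
    · intro x y hxy
      obtain rfl : adjCent hB hskew x = y := Subtype.ext hxy
      rw [pProj_adjCent]
      simp
    · refine LinearMap.ext fun x => ?_
      change b.alpha a (pProj hB hskew hεε hsym' x : gCent e) = _
      rw [coe_pProj, map_smul, map_add, hα, smul_eq_mul]
      push_cast
      field_simp
      ring

end JordanBasis.IsNormalised

end CentGen

theorem theorem6 {𝕜 : Type*} [Field 𝕜] [IsAlgClosed 𝕜]
    {V : Type*} [AddCommGroup V] [Module 𝕜 V] [FiniteDimensional 𝕜 V]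
    (e : Module.End 𝕜 V) (he : IsNilpotent e) (b : CentGen.JordanBasis e)
    (a : Fin b.n → 𝕜) (ha : Function.Injective a)
    (ha0 : ∀ i j, b.size j < b.size i → a i ≠ 0) :
    -- the action of `G_e` on the dual of `𝔤_e`
    (CentGen.IsGenericPoint 𝕜 (CentGen.AdG e) (b.alpha a) ∧
      CentGen.IsRegularPoint 𝕜 (CentGen.gCent e) (b.alpha a)) ∧
    -- the action of `K_e` on the dual of `𝔨_e`, symplectic case
    (∀ (B : LinearMap.BilinForm 𝕜 V) (inv : Fin b.n → Fin b.n),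
      (2 : 𝕜) ≠ 0 → B.Nondegenerate → (∀ u v, B u v = - B v u) →
      LinearMap.IsSkewAdjoint B e → b.IsNormalised B (-1) inv →
      (∀ i, inv i ≠ i → a (inv i) = - a i) →
      (∀ x ∈ CentGen.pCent B e, b.alpha a x = 0) ∧
      CentGen.IsGenericPoint 𝕜 (CentGen.AdK B e)
        (b.alpha a ∘ₗ (CentGen.kCent B e).toSubmodule.subtype :
          Module.Dual 𝕜 (CentGen.kCent B e)) ∧
      CentGen.IsRegularPoint 𝕜 (CentGen.kCent B e)
        (b.alpha a ∘ₗ (CentGen.kCent B e).toSubmodule.subtype :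
          Module.Dual 𝕜 (CentGen.kCent B e))) ∧
    -- the action of `K_e` on the dual of `𝔭_e`, orthogonal case
    (∀ (B : LinearMap.BilinForm 𝕜 V) (inv : Fin b.n → Fin b.n),
      (2 : 𝕜) ≠ 0 → B.Nondegenerate → (∀ u v, B u v = B v u) →
      LinearMap.IsSkewAdjoint B e → b.IsNormalised B 1 inv →
      (∀ i, inv i ≠ i → a (inv i) = - a i) →
      (∀ x ∈ CentGen.kCent B e, b.alpha a x = 0) ∧
      CentGen.IsGenericPoint 𝕜 (CentGen.AdK B e)
        (b.alpha a ∘ₗ (CentGen.pCent B e).toSubmodule.subtype :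
          Module.Dual 𝕜 (CentGen.pCent B e)) ∧
      CentGen.IsRegularPoint 𝕜 (CentGen.kCent B e)
        (b.alpha a ∘ₗ (CentGen.pCent B e).toSubmodule.subtype :
          Module.Dual 𝕜 (CentGen.pCent B e))) := by
  have : Infinite 𝕜 := IsAlgClosed.instInfinite
  refine ⟨?_, ?_, ?_⟩
  · have h := b.isGenericPoint_alpha he ha ha0
    exact ⟨h, h.isRegularPoint⟩
  · intro B inv h2 hB hsym hskew hN hinv
    have h := hN.isGenericPoint_alpha_kCent he h2 hB hsym hskew ha ha0 hinv
    exact ⟨h.1, h.2, h.2.isRegularPoint⟩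
  · intro B inv h2 hB hsym hskew hN hinv
    have h := hN.isGenericPoint_alpha_pCent he h2 hB hsym hskew ha ha0 hinv
    exact ⟨h.1, h.2, h.2.isRegularPoint⟩
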